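/- **Setting.** Let $T\subset\mathbb R^3$ be a (non-degenerate, closed) tetrahedron with vertices $a_1,\dots,a_4$ and barycentric coordinates $\lambda_1,\dots,\lambda_4$, let $p\in\mathbb N_0$ and $0<\epsilon<\tfrac12$. $e$ runs through the six edges of $T$, with a fixed direction, unit tangent $t_e$ and arclength derivative $\frac{d}{dl}$; $f$ runs through the four faces, with exterior unit normal $n_f$; for an edge $e\subset\partial f$ put $n_{e,f}:=t_e\times n_f$. $\mathcal P_d(F)$ is the space of polynomials of total degree $\le d$ on a facet $F$ ($\{0\}$ if $d<0$), $\boldsymbol{\mathcal P}_d(F)$ the space of (tangential) vector fields with components in it, $\mathring{\mathcal P}_d(F)$ the space of those $u\in\mathcal P_d(F)$ that vanish on $\partial F$. On a face, in orthonormal local coordinates $y_1,y_2$ along tangent vectors $\tau_1,\tau_2$ with $\tau_1\times\tau_2=n_f$, $\operatorname{\mathbf{curl}}u=(\partial_2u,-\partial_1u)$ and $\operatorname{div}$ is the surface divergence. $C^\infty(\overline T)$ consists of the restrictions to $T$ of functions in $C^\infty(\mathbb R^3)$, and $\boldsymbol C^\infty(\overline T)$ of the vector fields with such components. **Spaces.**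 $$W^1_p(T)=\{x\mapsto \mathbf p(x)+\mathbf q(x)\times x:\ \mathbf p,\mathbf q\in\boldsymbol{\mathcal P}_p(\mathbb R^3)\},\qquad W^1_p(f)=W^1_p(T)\times n_f ,$$ $\mathring W^1_p(f)=\{w\in W^1_p(f): w\cdot n_{e,f}=0\text{ on every edge } e\subset\partial f\}$, $\mathring W^1_p(T)=\{v\in W^1_p(T): v\times n_f=0\text{ on every face }f\}$. The degrees of freedom of $v\in W_p^1(T)$ are $\int_e q\,v\cdot t_e\,dl$ ($q\in\mathcal P_p(e)$), $\int_f \mathbf q\cdot(v\times n_f)\,dS$ ($\mathbf q\in\boldsymbol{\mathcal P}_{p-1}(f)$), $\int_T\mathbf q\cdot v\,dx$ ($\mathbf q\in\boldsymbol{\mathcal P}_{p-2}(T)$). $Y^1_p(f)$ is the space of all $v\in W^1_p(T)$ for which all degrees of freedom except those on $f$ vanish. **Inner products.** For $0<s<1$ and a facet $F$ of dimension $n\in\{1,2\}$ let $H^s_0(F)$ be the completion of $C_0^\infty(\operatorname{int}F)$ in the norm $\|\varphi\|^2=\int_F|\varphi|^2+\iint_{F\times F}\frac{|\varphi(x)-\varphi(y)|^2}{|x-y|^{n+2s}}$,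 and $H^{-s}(F)$ its dual, with the Hilbert space inner product of the dual norm; $u\in L^2(F)$ is identified with $\varphi\mapsto\int_F u\varphi$. For vector fields the inner products of the components are added. **Projections.** $P^1_{e,p}$ is the $H^{-1+\epsilon}(e)$-orthogonal projection onto $\frac{d}{dl}\mathring{\mathcal P}_{p+1}(e)$; $P^1_{f,p}$ and $P^2_{f,p}$ are the $H^{-1/2+\epsilon}(f)$-orthogonal projections onto $\operatorname{\mathbf{curl}}\mathring{\mathcal P}_{p+1}(f)$ and $\operatorname{div}\mathring W^1_p(f)$; $P^1_{T,p}$ and $P^2_{T,p}$ are the $L^2(T)$-orthogonal projections onto $\operatorname{grad}\mathring{\mathcal P}_{p+1}(T)$ and $\operatorname{curl}\mathring W^1_p(T)$. **Extensions.** Let $E^0_{e,p}:\mathring{\mathcal P}_{p+1}(e)\to\mathcal P_{p+1}(T)$ and $E^0_{f,p}:\mathring{\mathcal P}_{p+1}(f)\to\mathcal P_{p+1}(T)$ be any linear maps with $(E^0_{e,p}u)|_e=u$, $(E^0_{e,p}u)|_{e'}=0$ for all edges $e'\ne e$, and $(E^0_{f,p}u)|_f=u$, $(E^0_{f,p}u)|_{f'}=0$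 for all faces $f'\neq f$. For $w\in\mathring W^1_p(f)$ let $E^1_{f,p}w$ be the unique $v\in Y^1_p(f)$ with $(v\times n_f)|_f=w$. **Liftings.** $L^1_{e,p}$, $L^1_{f,p}$, $L^1_{T,p}$ are the inverses of $\frac d{dl}:\mathring{\mathcal P}_{p+1}(e)\to\frac d{dl}\mathring{\mathcal P}_{p+1}(e)$, of $\operatorname{\mathbf{curl}}:\mathring{\mathcal P}_{p+1}(f)\to\operatorname{\mathbf{curl}}\mathring{\mathcal P}_{p+1}(f)$ and of $\operatorname{grad}:\mathring{\mathcal P}_{p+1}(T)\to\operatorname{grad}\mathring{\mathcal P}_{p+1}(T)$. For every face $f$ choose any edge $\tilde e$ of $f$ and let $a$ be the vertex of $f$ opposite to $\tilde e$; choose any vertex $b$ of $T$ and let $\tilde f$ be the face opposite to $b$. With $$(R^{2D}_au)(x)=\int_0^1t\,u(a+t(x-a))(x-a)\,dt,\qquad (R_b\mathbf u)(x)=\int_0^1t\,\mathbf u(b+t(x-b))\,dt\times(x-b)$$ put $$L^2_{f,p}u=R^{2D}_au-\operatorname{\mathbf{curl}}\Bigl(\bigl(E^0_{\tilde e,p}L^1_{\tilde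 e,p}((R^{2D}_au\cdot n_{\tilde e,f})|_{\tilde e})\bigr)\big|_f\Bigr)\quad(u\in\operatorname{div}\mathring W^1_p(f)),$$ $$L^2_{T,p}\mathbf u=R_b\mathbf u-\operatorname{grad}E^0_{\tilde f,p}L^1_{\tilde f,p}\bigl((R_b\mathbf u\times n_{\tilde f})|_{\tilde f}\bigr)\quad(\mathbf u\in\operatorname{curl}\mathring W^1_p(T)).$$ **Interpolation operators.** For $u\in C^\infty(\overline T)$ put $w^{(0)}=\sum_iu(a_i)\lambda_i$, $u^{(0)}=u-w^{(0)}$, $w^{(1)}=\sum_eE^0_{e,p}L^1_{e,p}P^1_{e,p}\frac d{dl}u^{(0)}|_e$, $u^{(1)}=u^{(0)}-w^{(1)}$, $w^{(2)}=\sum_fE^0_{f,p}L^1_{f,p}P^1_{f,p}\operatorname{\mathbf{curl}}(u^{(1)}|_f)$, $u^{(2)}=u^{(1)}-w^{(2)}$, and $$\Pi^0_{T,p}u=L^1_{T,p}P^1_{T,p}\operatorname{grad}u^{(2)}+w^{(2)}+w^{(1)}+w^{(0)}.$$ For $\mathbf u\in\boldsymbol C^\infty(\overline T)$ put, with $\mathbf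 b_e=\lambda_i\operatorname{grad}\lambda_j-\lambda_j\operatorname{grad}\lambda_i$ for $e=[a_i,a_j]$, $$\begin{aligned} &\mathbf w^{(0)}=\sum_e\Bigl(\int_e\mathbf u\cdot t_e\,dl\Bigr)\mathbf b_e, &&\mathbf u^{(0)}=\mathbf u-\mathbf w^{(0)},\\ &\mathbf w^{(1)}=\sum_e\operatorname{grad}E^0_{e,p}L^1_{e,p}P^1_{e,p}((\mathbf u^{(0)}\cdot t_e)|_e), &&\mathbf u^{(1)}=\mathbf u^{(0)}-\mathbf w^{(1)},\\ &\mathbf w^{(2)}=\sum_fE^1_{f,p}L^2_{f,p}P^2_{f,p}\operatorname{div}((\mathbf u^{(1)}\times n_f)|_f), &&\mathbf u^{(2)}=\mathbf u^{(1)}-\mathbf w^{(2)},\\ &\mathbf w^{(3)}=\sum_f\operatorname{grad}E^0_{f,p}L^1_{f,p}P^1_{f,p}((\mathbf u^{(2)}\times n_f)|_f), &&\mathbf u^{(3)}=\mathbf u^{(2)}-\mathbf w^{(3)},\\ &\mathbf w^{(4)}=L^2_{T,p}P^2_{T,p}\operatorname{curl}\mathbf u^{(3)}, &&\mathbf u^{(4)}=\mathbf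 u^{(3)}-\mathbf w^{(4)}, \end{aligned}$$ $$\Pi^1_{T,p}\mathbf u=\operatorname{grad}L^1_{T,p}P^1_{T,p}\mathbf u^{(4)}+\mathbf w^{(4)}+\mathbf w^{(3)}+\mathbf w^{(2)}+\mathbf w^{(1)}+\mathbf w^{(0)}.$$ **Lemma.** For every such $T$, $p$, $\epsilon$ and every choice of $E^0_{e,p}$, $E^0_{f,p}$, $\tilde e$, $b$ as above, $\Pi^1_{T,p}$ is a well-defined linear map on $\boldsymbol C^\infty(\overline T)$ that is a projection onto $W^1_p(T)$, that is, $\Pi^1_{T,p}\mathbf u\in W^1_p(T)$ for all $\mathbf u\in\boldsymbol C^\infty(\overline T)$ and $\Pi^1_{T,p}\mathbf u=\mathbf u$ for all $\mathbf u\in W^1_p(T)$. Moreover $$\Pi^1_{T,p}(\operatorname{grad}u)=\operatorname{grad}(\Pi^0_{T,p}u)\qquad\text{on }T\text{ for all }u\in C^\infty(\overline T).$$ -/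

import Mathlib

open MeasureTheory Set
open scoped ContDiff

noncomputable section

namespace EdgeElement

/-! ## Generalities -/

/-- `ℝ²` and `ℝ³` with their Euclidean structure. -/
abbrev E2 := EuclideanSpace ℝ (Fin 2)

abbrev E3 := EuclideanSpace ℝ (Fin 3)

open Classical in
/-- The unique object with property `P` (and `0` if there is no such unique object). -/
def theUnique {F : Type*} [Zero F] (P : F → Prop) : F :=
  if h : ∃! q, P q then h.choose else 0

/-- Orthogonal projection of `u` onto the space `S` with respect to the inner product `B`:
the unique `q ∈ S` such that `u - q` is `B`-orthogonal to `S`. -/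
def orthProj {F : Type*} [AddCommGroup F] (B : F → F → ℝ) (S : Set F) (u : F) : F :=
  theUnique fun q => q ∈ S ∧ ∀ s ∈ S, B (u - q) s = 0

/-- Vector product in `ℝ³`. -/
def cross (u v : E3) : E3 := WithLp.toLp 2 (crossProduct u.ofLp v.ofLp)

/-- `partialD i u x` is the partial derivative of `u` at `x` in the `i`-th coordinate direction. -/
def partialD {n : ℕ} {F : Type*} [NormedAddCommGroup F] [NormedSpace ℝ F] (i : Fin n)
    (u : EuclideanSpace ℝ (Fin n) → F) (x : EuclideanSpace ℝ (Fin n)) : F :=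
  fderiv ℝ u x (EuclideanSpace.single i 1)

/-- The curl of a vector field on `ℝ³`. -/
def curl (u : E3 → E3) (x : E3) : E3 :=
  !₂[partialD 1 u x 2 - partialD 2 u x 1,
     partialD 2 u x 0 - partialD 0 u x 2,
     partialD 0 u x 1 - partialD 1 u x 0]

/-- The vector-valued curl of a scalar function on `ℝ²`. -/
def bcurl (g : E2 → ℝ) (y : E2) : E2 := !₂[partialD 1 g y, -partialD 0 g y]

/-- The divergence of a vector field on `ℝ²`. -/
def div2 (w : E2 → E2) (y : E2) : ℝ := partialD 0 w y 0 + partialD 1 w y 1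

/-! ## Polynomials -/

/-- Polynomial functions on `ℝⁿ` of total degree `≤ d`; only the zero function if `d < 0`. -/
def Poly (n : ℕ) (d : ℤ) : Set (EuclideanSpace ℝ (Fin n) → ℝ) :=
  {g | ∃ P : MvPolynomial (Fin n) ℝ, (∀ m ∈ P.support, (m.degree : ℤ) ≤ d) ∧
    ∀ x, g x = MvPolynomial.eval x.ofLp P}

/-- Vector fields on `ℝⁿ` all of whose components are polynomials of total degree `≤ d`. -/
def VPoly (n : ℕ) (d : ℤ) : Set (EuclideanSpace ℝ (Fin n) → EuclideanSpace ℝ (Fin n)) :=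
  {v | ∀ i, (fun x => v x i) ∈ Poly n d}

/-- Polynomial functions of degree `≤ d` in one variable. -/
def Poly1 (d : ℕ) : Set (ℝ → ℝ) :=
  {g | ∃ q : Polynomial ℝ, q.natDegree ≤ d ∧ ∀ s, g s = q.eval s}

/-! ## Sobolev spaces of negative fractional order -/

section Sobolev

variable {V : Type*} [NormedAddCommGroup V] [InnerProductSpace ℝ V] [MeasureSpace V]

/-- The Hilbert space `L²(D) × L²(D × D)`. -/
abbrev SobolevAmbient (D : Set V) :=
  WithLp 2 (Lp ℝ 2 ((volume : Measure V).restrict D) ×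
    Lp ℝ 2 (((volume : Measure V).restrict D).prod ((volume : Measure V).restrict D)))

/-- The Sobolev space `H₀ˢ(D)`, `0 < s < 1`: the completion of the space of test functions
`φ ∈ C₀^∞(int D)` for the Sobolev-Slobodeckij norm
`‖φ‖² = ∫_D |φ|² + ∬_{D × D} |φ(x) - φ(y)|² / |x - y|^(n + 2 s)`, `n = dim V`.
It is realized as the closure of all pairs of `φ` and its difference quotient
`(φ(x) - φ(y)) / |x - y|^(n / 2 + s)` in `L²(D) × L²(D × D)`. -/
def SobolevH0 (s : ℝ) (D : Set V) : Submodule ℝ (SobolevAmbient D) :=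
  (Submodule.span ℝ {z : SobolevAmbient D | ∃ φ : V → ℝ,
    ContDiff ℝ ∞ φ ∧ HasCompactSupport φ ∧ tsupport φ ⊆ interior D ∧
    (z.fst : V → ℝ) =ᵐ[(volume : Measure V).restrict D] φ ∧
    (z.snd : V × V → ℝ)
      =ᵐ[((volume : Measure V).restrict D).prod ((volume : Measure V).restrict D)]
      fun q => (φ q.1 - φ q.2) / ‖q.1 - q.2‖ ^ ((Module.finrank ℝ V : ℝ) / 2 + s)}
    ).topologicalClosure

instance (s : ℝ) (D : Set V) : CompleteSpace (SobolevH0 s D) :=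
  (Submodule.isClosed_topologicalClosure _).completeSpace_coe

open Classical in
/-- A function `F ∈ L²(D)` as an element `φ ↦ ∫_D F φ` of `H⁻ˢ(D)`, the dual of `H₀ˢ(D)`. -/
def toSobolevDual (s : ℝ) (D : Set V) (F : V → ℝ) : StrongDual ℝ (SobolevH0 s D) :=
  if h : MemLp F 2 ((volume : Measure V).restrict D) then
    (innerSL ℝ (h.toLp F)).comp
      ((WithLp.fstL 2 ℝ (Lp ℝ 2 ((volume : Measure V).restrict D))
        (Lp ℝ 2 (((volume : Measure V).restrict D).prod ((volume : Measure V).restrict D)))).comp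
        (SobolevH0 s D).subtypeL)
  else 0

/-- The inner product of `H⁻ˢ(D)`, `0 < s < 1` (the one that induces the dual norm), for two
functions in `L²(D)`. -/
def negInner (s : ℝ) (D : Set V) (F G : V → ℝ) : ℝ :=
  inner ℝ ((InnerProductSpace.toDual ℝ (SobolevH0 s D)).symm (toSobolevDual s D F))
    ((InnerProductSpace.toDual ℝ (SobolevH0 s D)).symm (toSobolevDual s D G))

end Sobolev

/-! ## The tetrahedron and its facets

Vertices are indexed by `Fin 4`; a face is indexed by the vertex opposite to it, and an edge by
its two vertices `i < j`; it is directed from vertex `i` to vertex `j`. -/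

/-- A tetrahedron in `ℝ³`. -/
abbrev Tetrahedron := Affine.Simplex ℝ E3 3

abbrev Edge := {e : Fin 4 × Fin 4 // e.1 < e.2}

/-- The edge `e` is contained in the face `k`. -/
def EdgeOf (e : Edge) (k : Fin 4) : Prop := e.1.1 ≠ k ∧ e.1.2 ≠ k

variable (T : Tetrahedron)

/-- The closed tetrahedron as a point set. -/
def cell : Set E3 := convexHull ℝ (range T.points)

/-- The closed face opposite to vertex `k`. -/
def face (k : Fin 4) : Set E3 := convexHull ℝ (T.points '' {k}ᶜ)

/-- The closed edge `e`. -/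
def edge (e : Edge) : Set E3 := segment ℝ (T.points e.1.1) (T.points e.1.2)

/-- The vertices as an affine basis of `ℝ³`. -/
def baryBasis : AffineBasis (Fin 4) ℝ E3 :=
  ⟨T.points, T.independent, by
    rw [T.independent.affineSpan_eq_top_iff_card_eq_finrank_add_one]; simp⟩

/-- The barycentric coordinate function belonging to vertex `i`. -/
def lam (i : Fin 4) : E3 → ℝ := fun x => (baryBasis T).coord i x

/-- Length of an edge. -/
def edgeLen (e : Edge) : ℝ := ‖T.points e.1.2 - T.points e.1.1‖

/-- Unit tangent vector `t_e` of a directed edge. -/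
def edgeTan (e : Edge) : E3 := (edgeLen T e)⁻¹ • (T.points e.1.2 - T.points e.1.1)

/-- Arclength parametrization of an edge, over the interval `[0, |e|]`. -/
def edgeMap (e : Edge) (s : ℝ) : E3 := T.points e.1.1 + s • edgeTan T e

/-- The parameter interval of an edge. -/
def edgeDom (e : Edge) : Set ℝ := Icc 0 (edgeLen T e)

/-- Exterior unit normal `n_f` of the face opposite to vertex `k`; note that the barycentric
coordinate of vertex `k` vanishes on that face and is positive inside the tetrahedron. -/
def normal (k : Fin 4) : E3 := -(‖gradient (lam T k) 0‖⁻¹ • gradient (lam T k) 0)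

/-- Origin of the local coordinate system of the face `k`: one of its vertices. -/
def faceOrg (k : Fin 4) : E3 := T.points (k.succAbove 0)

/-- Orthonormal tangent vectors `τ₁`, `τ₂` of the face `k`, with `τ₁ × τ₂ = n_f`. -/
def faceTan (k : Fin 4) : Fin 2 → E3 :=
  let t : E3 := ‖T.points (k.succAbove 1) - T.points (k.succAbove 0)‖⁻¹ •
    (T.points (k.succAbove 1) - T.points (k.succAbove 0))
  ![t, cross (normal T k) t]

/-- The isometric parametrization of the plane of the face `k` by `ℝ²`. -/
def faceMap (k : Fin 4) (y : E2) : E3 :=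
  faceOrg T k + y 0 • faceTan T k 0 + y 1 • faceTan T k 1

/-- Components of a vector with respect to the orthonormal tangent basis of the face `k`. -/
def faceComp (k : Fin 4) (v : E3) : E2 := !₂[inner ℝ v (faceTan T k 0), inner ℝ v (faceTan T k 1)]

/-- Local coordinates of a point in the plane of the face `k` (inverse of `faceMap`). -/
def faceCoord (k : Fin 4) (x : E3) : E2 := faceComp T k (x - faceOrg T k)

/-- The closed triangle in `ℝ²` that represents the face `k` in local coordinates. -/
def faceDom (k : Fin 4) : Set E2 := faceMap T k ⁻¹' face T k

/-- The in plane unit normal `n_{e,f} = t_e × n_f` of the face `k` with respect to its edge `e`, in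
local coordinates of the face. -/
def edgeNormal (e : Edge) (k : Fin 4) : E2 := faceComp T k (cross (edgeTan T e) (normal T k))

/-- Tangential trace `(u · t_e)|_e`, as a function of arclength. -/
def edgeTrace (e : Edge) (u : E3 → E3) (s : ℝ) : ℝ := inner ℝ (u (edgeMap T e s)) (edgeTan T e)

/-- Tangential trace `(u × n_f)|_f`, in local coordinates of the face. -/
def faceTrace (k : Fin 4) (u : E3 → E3) (y : E2) : E2 :=
  faceComp T k (cross (u (faceMap T k y)) (normal T k))

/-! ## Local spaces -/

/-- Polynomials of degree `≤ d` on an edge that vanish at its end points. -/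
def Poly0E (d : ℕ) (e : Edge) : Set (ℝ → ℝ) :=
  {g | g ∈ Poly1 d ∧ g 0 = 0 ∧ g (edgeLen T e) = 0}

/-- Polynomials of degree `≤ d` on a face that vanish on its boundary. -/
def Poly0F (d : ℤ) (k : Fin 4) : Set (E2 → ℝ) :=
  {g | g ∈ Poly 2 d ∧ ∀ e, EdgeOf e k → ∀ y, faceMap T k y ∈ edge T e → g y = 0}

/-- Polynomials of degree `≤ d` on the tetrahedron that vanish on its boundary. -/
def Poly0T (d : ℤ) : Set (E3 → ℝ) :=
  {g | g ∈ Poly 3 d ∧ ∀ k, ∀ x ∈ face T k, g x = 0}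

/-- The local edge element space `W¹_p(T)`: all fields `p(x) + q(x) × x` with polynomial vector
fields `p`, `q` of degree `≤ p`. (A polynomial field is determined by its values on `T`, and is
represented by its natural extension to `ℝ³`.) -/
def W1 (p : ℕ) : Set (E3 → E3) :=
  {v | ∃ a ∈ VPoly 3 p, ∃ b ∈ VPoly 3 p, ∀ x, v x = a x + cross (b x) x}

/-- `W¹_p(T)` with zero tangential trace on the boundary of `T`. -/
def W10T (p : ℕ) : Set (E3 → E3) :=
  {v | v ∈ W1 p ∧ ∀ k, ∀ x ∈ face T k, cross (v x) (normal T k) = 0}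

/-- The tangential trace space `W¹_p(f) = W¹_p(T) × n_f`. -/
def W1F (p : ℕ) (k : Fin 4) : Set (E2 → E2) := faceTrace T k '' W1 p

/-- The subspace of `W¹_p(f)` of fields with zero normal components on the edges of `f`. -/
def W10F (p : ℕ) (k : Fin 4) : Set (E2 → E2) :=
  {w | w ∈ W1F T p k ∧ ∀ e, EdgeOf e k → ∀ y, faceMap T k y ∈ edge T e →
    inner ℝ (w y) (edgeNormal T e k) = 0}

/-! ## Degrees of freedom and the extension operators for tangential face traces -/

/-- All degrees of freedom on the edge `e` vanish at `v`. -/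
def DofZeroE (p : ℕ) (e : Edge) (v : E3 → E3) : Prop :=
  ∀ q ∈ Poly1 p, ∫ s in edgeDom T e, q s * edgeTrace T e v s = 0

/-- All degrees of freedom on the face `k` vanish at `v`. -/
def DofZeroF (p : ℕ) (k : Fin 4) (v : E3 → E3) : Prop :=
  ∀ q ∈ VPoly 2 ((p : ℤ) - 1), ∫ y in faceDom T k, inner ℝ (q y) (faceTrace T k v y) = 0

/-- All interior degrees of freedom vanish at `v`. -/
def DofZeroT (p : ℕ) (v : E3 → E3) : Prop :=
  ∀ q ∈ VPoly 3 ((p : ℤ) - 2), ∫ x in cell T, inner ℝ (q x) (v x) = 0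

/-- The space `Y¹_p(f)`: fields in `W¹_p(T)` for which all degrees of freedom except those on the
face `f` vanish. -/
def Y1F (p : ℕ) (k : Fin 4) : Set (E3 → E3) :=
  {v | v ∈ W1 p ∧ (∀ e, DofZeroE T p e v) ∧ (∀ k', k' ≠ k → DofZeroF T p k' v) ∧ DofZeroT T p v}

/-- The extension operator `E¹_{f,p}`: the unique field in `Y¹_p(f)` with given tangential trace
on `f`. -/
def ext1F (p : ℕ) (k : Fin 4) (w : E2 → E2) : E3 → E3 :=
  theUnique fun v => v ∈ Y1F T p k ∧ faceTrace T k v = w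

/-! ## Orthogonal projections -/

/-- `P¹_{e,p}`: the `H^{-1+ε}(e)`-orthogonal projection onto the derivatives of polynomials of
degree `≤ p + 1` that vanish at the end points of `e`. -/
def proj1E (ε : ℝ) (p : ℕ) (e : Edge) : (ℝ → ℝ) → (ℝ → ℝ) :=
  orthProj (negInner (1 - ε) (edgeDom T e)) (deriv '' Poly0E T (p + 1) e)

/-- The `H^{-1/2+ε}(f)` inner product of vector fields. -/
def negInnerF (ε : ℝ) (k : Fin 4) (v w : E2 → E2) : ℝ :=
  ∑ i, negInner (1 / 2 - ε) (faceDom T k) (fun y => v y i) (fun y => w y i)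

/-- `P¹_{f,p}`: the `H^{-1/2+ε}(f)`-orthogonal projection onto the curls of polynomials of degree
`≤ p + 1` that vanish on the boundary of `f`. -/
def proj1F (ε : ℝ) (p : ℕ) (k : Fin 4) : (E2 → E2) → (E2 → E2) :=
  orthProj (negInnerF T ε k) (bcurl '' Poly0F T (p + 1) k)

/-- `P²_{f,p}`: the `H^{-1/2+ε}(f)`-orthogonal projection onto the divergences of fields in
`W¹_p(f)` with zero normal components on the boundary of `f`. -/
def proj2F (ε : ℝ) (p : ℕ) (k : Fin 4) : (E2 → ℝ) → (E2 → ℝ) :=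
  orthProj (negInner (1 / 2 - ε) (faceDom T k)) (div2 '' W10F T p k)

/-- The `L²(T)` inner product of vector fields. -/
def l2Inner (u v : E3 → E3) : ℝ := ∫ x in cell T, inner ℝ (u x) (v x)

/-- `P¹_{T,p}`: the `L²(T)`-orthogonal projection onto the gradients of polynomials of degree
`≤ p + 1` that vanish on the boundary of `T`. -/
def proj1T (p : ℕ) : (E3 → E3) → (E3 → E3) :=
  orthProj (l2Inner T) (gradient '' Poly0T T (p + 1))

/-- `P²_{T,p}`: the `L²(T)`-orthogonal projection onto the curls of fields in `W¹_p(T)` with zero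
tangential trace. -/
def proj2T (p : ℕ) : (E3 → E3) → (E3 → E3) :=
  orthProj (l2Inner T) (curl '' W10T T p)

/-! ## Liftings -/

/-- `L¹_{e,p}`: right inverse of the arclength derivative. -/
def lift1E (p : ℕ) (e : Edge) (u : ℝ → ℝ) : ℝ → ℝ :=
  theUnique fun g => g ∈ Poly0E T (p + 1) e ∧ deriv g = u

/-- `L¹_{f,p}`: right inverse of the vector-valued curl on a face. -/
def lift1F (p : ℕ) (k : Fin 4) (u : E2 → E2) : E2 → ℝ :=
  theUnique fun g => g ∈ Poly0F T (p + 1) k ∧ bcurl g = u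

/-- `L¹_{T,p}`: right inverse of the gradient. -/
def lift1T (p : ℕ) (u : E3 → E3) : E3 → ℝ :=
  theUnique fun g => g ∈ Poly0T T (p + 1) ∧ gradient g = u

/-- The Poincaré lifting in the plane with base point `a`. -/
def poincare2 (a : E2) (u : E2 → ℝ) (y : E2) : E2 :=
  ∫ t in (0 : ℝ)..1, (t * u (a + t • (y - a))) • (y - a)

/-- The Poincaré lifting in space with base point `a`. -/
def poincare3 (a : E3) (u : E3 → E3) (x : E3) : E3 :=
  cross (∫ t in (0 : ℝ)..1, t • u (a + t • (x - a))) (x - a)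

/-- Polynomial extension operators `E⁰_{e,p}`, `E⁰_{f,p}`: linear maps that extend polynomials of
degree `≤ p + 1` that vanish on the boundary of an edge (a face) to polynomials of degree `≤ p + 1`
on `T` that vanish on all other edges (faces). Only the values on such polynomials matter. -/
structure ExtensionOperators (p : ℕ) where
  /-- extension from edges -/
  E : Edge → (ℝ → ℝ) →ₗ[ℝ] (E3 → ℝ)
  E_poly : ∀ e, ∀ u ∈ Poly0E T (p + 1) e, E e u ∈ Poly 3 (p + 1)
  E_self : ∀ e, ∀ u ∈ Poly0E T (p + 1) e, ∀ s ∈ edgeDom T e, E e u (edgeMap T e s) = u s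
  E_other : ∀ e, ∀ u ∈ Poly0E T (p + 1) e, ∀ e', e' ≠ e → ∀ x ∈ edge T e', E e u x = 0
  /-- extension from faces -/
  F : Fin 4 → (E2 → ℝ) →ₗ[ℝ] (E3 → ℝ)
  F_poly : ∀ k, ∀ u ∈ Poly0F T (p + 1) k, F k u ∈ Poly 3 (p + 1)
  F_self : ∀ k, ∀ u ∈ Poly0F T (p + 1) k, ∀ y ∈ faceDom T k, F k u (faceMap T k y) = u y
  F_other : ∀ k, ∀ u ∈ Poly0F T (p + 1) k, ∀ k', k' ≠ k → ∀ x ∈ face T k', F k u x = 0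

/-- The choices in the construction of the liftings `L²`: for every face an edge and the vertex
of the face opposite to that edge, and for the tetrahedron a vertex. -/
structure LiftingChoice where
  /-- the chosen edge of a face -/
  faceEdge : Fin 4 → Edge
  /-- the vertex of the face opposite to the chosen edge -/
  faceVertex : Fin 4 → Fin 4
  opposite : ∀ k : Fin 4,
    ({k, faceVertex k, (faceEdge k).1.1, (faceEdge k).1.2} : Finset (Fin 4)) = Finset.univ
  /-- the chosen vertex of the tetrahedron; the face opposite to it has the same index -/
  apex : Fin 4

variable {T} {p : ℕ} (X : ExtensionOperators T p) (c : LiftingChoice)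

/-- `L²_{f,p}`: right inverse of the divergence on a face. -/
def lift2F (k : Fin 4) (u : E2 → ℝ) : E2 → E2 :=
  let e := c.faceEdge k
  let r := poincare2 (faceCoord T k (T.points (c.faceVertex k))) u
  r - bcurl fun y => X.E e (lift1E T p e fun s =>
    inner ℝ (r (faceCoord T k (edgeMap T e s))) (edgeNormal T e k)) (faceMap T k y)

/-- `L²_{T,p}`: right inverse of the curl. -/
def lift2T (u : E3 → E3) : E3 → E3 :=
  let r := poincare3 (T.points c.apex) u
  r - gradient (X.F c.apex (lift1F T p c.apex (faceTrace T c.apex r)))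

/-! ## The interpolation operators -/

/-- The linear interpolant of `u`. -/
def scalarW0 (T : Tetrahedron) (u : E3 → ℝ) : E3 → ℝ := ∑ i, u (T.points i) • lam T i

/-- The edge contribution for the scalar function `u`. -/
def scalarW1 (ε : ℝ) (u : E3 → ℝ) : E3 → ℝ :=
  ∑ e, X.E e (lift1E T p e (proj1E T ε p e (deriv fun s => u (edgeMap T e s))))

/-- The face contribution for the scalar function `u`. -/
def scalarW2 (ε : ℝ) (u : E3 → ℝ) : E3 → ℝ :=
  ∑ k, X.F k (lift1F T p k (proj1F T ε p k (bcurl fun y => u (faceMap T k y))))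

/-- The projection based interpolation operator `Π⁰_{T,p}`. -/
def Pi0 (ε : ℝ) (u : E3 → ℝ) : E3 → ℝ :=
  let w0 := scalarW0 T u
  let u0 := u - w0
  let w1 := scalarW1 X ε u0
  let u1 := u0 - w1
  let w2 := scalarW2 X ε u1
  let u2 := u1 - w2
  lift1T T p (proj1T T p (gradient u2)) + w2 + w1 + w0

/-- The Whitney-1-form basis function `λ_i ∇λ_j - λ_j ∇λ_i` of the edge `e = [a_i, a_j]`. -/
def whitney (T : Tetrahedron) (e : Edge) (x : E3) : E3 :=
  lam T e.1.1 x • gradient (lam T e.1.2) x - lam T e.1.2 x • gradient (lam T e.1.1) x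

/-- The interpolant of `u` in the space of Whitney-1-forms. -/
def fieldW0 (T : Tetrahedron) (u : E3 → E3) : E3 → E3 :=
  ∑ e : Edge, (∫ s in edgeDom T e, edgeTrace T e u s) • whitney T e

/-- The edge contribution. -/
def fieldW1 (ε : ℝ) (u : E3 → E3) : E3 → E3 :=
  ∑ e, gradient (X.E e (lift1E T p e (proj1E T ε p e (edgeTrace T e u))))

/-- The first face contribution. -/
def fieldW2 (ε : ℝ) (u : E3 → E3) : E3 → E3 :=
  ∑ k, ext1F T p k (lift2F X c k (proj2F T ε p k (div2 (faceTrace T k u))))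

/-- The second face contribution. -/
def fieldW3 (ε : ℝ) (u : E3 → E3) : E3 → E3 :=
  ∑ k, gradient (X.F k (lift1F T p k (proj1F T ε p k (faceTrace T k u))))

/-- The first interior contribution. -/
def fieldW4 (u : E3 → E3) : E3 → E3 := lift2T X c (proj2T T p (curl u))

/-- The projection based interpolation operator `Π¹_{T,p}`. -/
def Pi1 (ε : ℝ) (u : E3 → E3) : E3 → E3 :=
  let w0 := fieldW0 T u
  let u0 := u - w0
  let w1 := fieldW1 X ε u0
  let u1 := u0 - w1
  let w2 := fieldW2 X c ε u1
  let u2 := u1 - w2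
  let w3 := fieldW3 X ε u2
  let u3 := u2 - w3
  let w4 := fieldW4 X c u3
  let u4 := u3 - w4
  gradient (lift1T T p (proj1T T p u4)) + w4 + w3 + w2 + w1 + w0

end EdgeElement

end

open EdgeElement

/-! The operator peels a field apart from low to high dimension: edge means, edge traces, surface
divergences, remaining face traces, curl in the interior, remaining gradient part. Everything rests
on one exactness statement per stage, in polynomial spaces with sharp degrees.

Projection property. Let `u` be in `W1 p`. After the Whitney part is removed, the tangential trace
on every edge has mean zero, so it is the derivative of a polynomial vanishing at both ends
(`exists_edgeTrace_res0`). The edge projection reproduces it, and the next residual has no edge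
traces (`edgeTrace_res1`). Its face traces then lie in `W10F`, so the divergence stage removes the
surface divergences without creating edge traces (`res2_spec`). A divergence-free face trace without
edge traces is the curl of a polynomial vanishing on the boundary of the face (`exists_poly0F`), so
the third stage leaves a field in `W10T` (`res3_mem_w10T`). The curl stage removes its curl inside
`W10T`. What remains is the gradient of a polynomial vanishing on the boundary (`exists_poly0T`),
which the last stage reproduces. The contributions therefore add up to `u` (`Pi1_self`).

Commutation. Each residual of `gradient u` is the gradient of a scalar residual of `u`. The
divergence and curl stages contribute nothing because div curl and curl grad vanish; the other
stages project the same traces on both sides (`Pi1_gradient`).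

What makes the objects meaningful. Projections, liftings and extensions are defined through
`theUnique`, so existence and uniqueness have to be shown before they can be used. For the
projections this is definiteness of the negative norms on polynomials (`eqOn_zero_of_negInner_self`)
together with finite dimension. For the liftings of divergence and curl it is the Poincaré homotopy
formula (`coneAvg_euler`), with a correction that repairs the trace on one edge or face
(`liftEdge_mem`, `faceTrace_poincare3_apex`). For the extension from a face it is unisolvence: a
field with vanishing moments is tested against a polynomial that turns the pairing into a sum of
squares with nonnegative barycentric weights (`faceTrace_eq_zero_of_dof`, `eq_zero_of_dof`).
Existence uses the same positivity, applied to explicit bubble fields, in place of a dimension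
count.

Independence of the values outside the tetrahedron follows by linearity from the case of a field
vanishing on it, where every stage sees zero data (`Pi1_eq_zero`). -/

noncomputable section

namespace EdgeElement

/-! ## Polynomial functions -/

/-- `ℝⁿ` with its Euclidean structure. -/
abbrev EN (n : ℕ) := EuclideanSpace ℝ (Fin n)

/-- The exponents of total degree at most `d`. -/
def expSet (n : ℕ) (d : ℤ) : Set (Fin n →₀ ℕ) := {m | (m.degree : ℤ) ≤ d}

lemma expSet_finite (n : ℕ) (d : ℤ) : (expSet n d).Finite :=
  (Finsupp.finite_of_degree_le d.toNat).subset fun m hm => by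
    simp only [expSet, mem_ofPred_eq] at *; omega

/-- Evaluation of multivariate polynomials, as a linear map to functions. -/
def evalLin (n : ℕ) : MvPolynomial (Fin n) ℝ →ₗ[ℝ] (EN n → ℝ) where
  toFun P x := MvPolynomial.eval x.ofLp P
  map_add' P Q := by ext; simp
  map_smul' c P := by ext; simp [MvPolynomial.smul_eval]

/-- `Poly n d` as a submodule. -/
def polySub (n : ℕ) (d : ℤ) : Submodule ℝ (EN n → ℝ) :=
  (MvPolynomial.restrictSupport ℝ (expSet n d)).map (evalLin n)

lemma mem_polySub {n : ℕ} {d : ℤ} {g : EN n → ℝ} : g ∈ polySub n d ↔ g ∈ Poly n d := by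
  simp only [polySub, Submodule.mem_map, MvPolynomial.mem_restrictSupport_iff, Poly, mem_ofPred_eq]
  constructor
  · rintro ⟨P, hP, rfl⟩
    exact ⟨P, fun m hm => hP hm, fun x => rfl⟩
  · rintro ⟨P, hP, h⟩
    exact ⟨P, fun m hm => hP m hm, funext fun x => (h x).symm⟩

instance (n : ℕ) (d : ℤ) : FiniteDimensional ℝ (polySub n d) := by
  have : Finite (expSet n d) := expSet_finite n d
  have : Module.Finite ℝ (MvPolynomial.restrictSupport ℝ (expSet n d)) :=
    Module.Finite.of_basis (MvPolynomial.basisRestrictSupport ℝ (expSet n d))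
  exact Module.Finite.map _ _

/-- The monomial functions. -/
def monoFun {n : ℕ} (m : Fin n →₀ ℕ) (x : EN n) : ℝ := ∏ i, x i ^ m i

/-- Closure of polynomial functions under products, affine substitution and restriction to lines is
proved below by span induction, hence only for monomials. -/
lemma polySub_eq_span (n : ℕ) (d : ℤ) :
    polySub n d = Submodule.span ℝ (monoFun '' expSet n d) := by
  rw [polySub, MvPolynomial.restrictSupport_eq_span, Submodule.map_span, image_image]
  congr 2
  ext m x
  simp [evalLin, monoFun, MvPolynomial.eval_monomial, Finsupp.prod_fintype]

lemma monoFun_mem {n : ℕ} {d : ℤ} {m : Fin n →₀ ℕ} (hm : (m.degree : ℤ) ≤ d) :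
    monoFun m ∈ polySub n d := by
  rw [polySub_eq_span]; exact Submodule.subset_span ⟨m, hm, rfl⟩

lemma polySub_mono {n : ℕ} {d e : ℤ} (h : d ≤ e) : polySub n d ≤ polySub n e :=
  Submodule.map_mono (MvPolynomial.restrictSupport_mono _ fun _ hm => le_trans hm h)

lemma const_mem_polySub {n : ℕ} {d : ℤ} (hd : 0 ≤ d) (c : ℝ) :
    (fun _ => c) ∈ polySub n d := by
  have h1 : monoFun (0 : Fin n →₀ ℕ) ∈ polySub n d := monoFun_mem (by simpa using hd)
  convert (polySub n d).smul_mem c h1 using 1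
  ext x; simp [monoFun]

lemma coord_mem_polySub {n : ℕ} {d : ℤ} (hd : 1 ≤ d) (i : Fin n) :
    (fun x : EN n => x i) ∈ polySub n d := by
  have h1 : monoFun (Finsupp.single i 1 : Fin n →₀ ℕ) ∈ polySub n d :=
    monoFun_mem (by simpa using hd)
  convert h1 using 1
  ext x
  rw [monoFun, Finset.prod_eq_single i] <;> simp +contextual [Finsupp.single_apply, eq_comm]

lemma mul_mem_polySub {n : ℕ} {d e : ℤ} {f g : EN n → ℝ} (hf : f ∈ polySub n d)
    (hg : g ∈ polySub n e) : f * g ∈ polySub n (d + e) := by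
  rw [polySub_eq_span] at hf hg
  induction hf using Submodule.span_induction with
  | zero => simp
  | add f f' _ _ h h' => rw [add_mul]; exact add_mem h h'
  | smul c f _ h => rw [smul_mul_assoc]; exact Submodule.smul_mem _ _ h
  | mem f hf =>
    obtain ⟨m, hm, rfl⟩ := hf
    induction hg using Submodule.span_induction with
    | zero => simp
    | add f f' _ _ h h' => rw [mul_add]; exact add_mem h h'
    | smul c f _ h => rw [mul_smul_comm]; exact Submodule.smul_mem _ _ h
    | mem g hg =>
      obtain ⟨m', hm', rfl⟩ := hg
      have : monoFun m * monoFun m' = monoFun (m + m') := by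
        ext x; simp [monoFun, pow_add, Finset.prod_mul_distrib]
      rw [this]
      refine monoFun_mem ?_
      simp only [expSet, mem_ofPred_eq] at hm hm'
      simp only [map_add]; push_cast; omega

lemma mul_mem_polySub' {n : ℕ} {d e k : ℤ} {f g : EN n → ℝ} (hf : f ∈ polySub n d)
    (hg : g ∈ polySub n e) (h : d + e ≤ k) : (fun x => f x * g x) ∈ polySub n k :=
  polySub_mono h (mul_mem_polySub hf hg)

lemma pow_mem_polySub {n : ℕ} {f : EN n → ℝ} (hf : f ∈ polySub n 1) (k : ℕ) :
    f ^ k ∈ polySub n k := by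
  induction k with
  | zero => exact const_mem_polySub (le_refl 0) 1
  | succ k ih =>
    have := mul_mem_polySub ih hf
    rwa [← pow_succ] at this

lemma prod_pow_mem_polySub {ι : Type*} {n : ℕ} (s : Finset ι) {f : ι → EN n → ℝ}
    (hf : ∀ i, f i ∈ polySub n 1) (k : ι → ℕ) :
    ∏ i ∈ s, f i ^ k i ∈ polySub n ((∑ i ∈ s, k i : ℕ) : ℤ) := by
  classical
  induction s using Finset.induction_on with
  | empty => exact const_mem_polySub (le_refl 0) 1
  | insert a s ha ih =>
    rw [Finset.prod_insert ha, Finset.sum_insert ha]; push_cast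
    have := mul_mem_polySub (pow_mem_polySub (hf a) (k a)) ih
    exact_mod_cast this

/-- An affine substitution turns a monomial into a product of as many affine functions, so the
degree bound survives. -/
lemma comp_mem_polySub {m n : ℕ} {d : ℤ} {f : EN n → ℝ} (hf : f ∈ polySub n d)
    {L : EN m → EN n} (hL : ∀ i, (fun x => L x i) ∈ polySub m 1) :
    (fun x => f (L x)) ∈ polySub m d := by
  rw [polySub_eq_span] at hf
  induction hf using Submodule.span_induction with
  | zero => exact Submodule.zero_mem _
  | add f f' _ _ h h' => exact add_mem h h'
  | smul c f _ h => exact Submodule.smul_mem _ c h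
  | mem f hf =>
    obtain ⟨k, hk, rfl⟩ := hf
    have := prod_pow_mem_polySub Finset.univ hL k
    have h2 : (fun x => monoFun k (L x)) = ∏ i, (fun x => L x i) ^ k i := by
      ext x; simp [monoFun, Finset.prod_apply]
    rw [h2]
    refine polySub_mono ?_ this
    simpa [expSet, Finsupp.degree_eq_sum] using hk

/-- The univariate polynomial functions of degree at most `d` as a submodule. -/
def poly1Sub (d : ℕ) : Submodule ℝ (ℝ → ℝ) where
  carrier := Poly1 d
  zero_mem' := ⟨0, by simp, by simp⟩
  add_mem' := by
    rintro f g ⟨P, hP, hf⟩ ⟨Q, hQ, hg⟩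
    exact ⟨P + Q, (Polynomial.natDegree_add_le_of_degree_le hP hQ), fun s => by simp [hf, hg]⟩
  smul_mem' := by
    rintro c f ⟨P, hP, hf⟩
    exact ⟨c • P, (Polynomial.natDegree_smul_le c P).trans hP, fun s => by simp [hf]⟩

lemma mem_poly1Sub {d : ℕ} {f : ℝ → ℝ} : f ∈ poly1Sub d ↔ f ∈ Poly1 d := Iff.rfl

instance (d : ℕ) : FiniteDimensional ℝ (poly1Sub d) := by
  let ev : Polynomial ℝ →ₗ[ℝ] (ℝ → ℝ) :=
    { toFun := fun P s => P.eval s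
      map_add' := fun P Q => by ext; simp
      map_smul' := fun c P => by ext; simp }
  have h : poly1Sub d = (Polynomial.degreeLT ℝ (d + 1)).map ev := by
    ext f
    simp only [mem_poly1Sub, Poly1, mem_ofPred_eq, Submodule.mem_map, Polynomial.mem_degreeLT]
    constructor
    · rintro ⟨q, hq, hf⟩
      refine ⟨q, ?_, funext fun s => (hf s).symm⟩
      exact lt_of_le_of_lt Polynomial.degree_le_natDegree (by exact_mod_cast Nat.lt_succ_of_le hq)
    · rintro ⟨q, hq, rfl⟩
      refine ⟨q, ?_, fun s => rfl⟩
      by_cases hq0 : q = 0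
      · simp [hq0]
      · rw [Polynomial.degree_eq_natDegree hq0] at hq
        have : q.natDegree < d + 1 := by exact_mod_cast hq
        omega
  rw [h]
  have : FiniteDimensional ℝ (Polynomial.degreeLT ℝ (d + 1)) :=
    (Polynomial.degreeLTEquiv ℝ (d + 1)).symm.finiteDimensional
  infer_instance

lemma line_mem_poly1Sub {n d : ℕ} {f : EN n → ℝ} (hf : f ∈ polySub n d) (a b : EN n) :
    (fun s : ℝ => f (a + s • b)) ∈ poly1Sub d := by
  rw [polySub_eq_span] at hf
  induction hf using Submodule.span_induction with
  | zero => exact Submodule.zero_mem _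
  | add f f' _ _ h h' => exact add_mem h h'
  | smul c f _ h => exact Submodule.smul_mem _ c h
  | mem f hf =>
    obtain ⟨k, hk, rfl⟩ := hf
    refine ⟨∏ i, (Polynomial.C (b i) * Polynomial.X + Polynomial.C (a i)) ^ k i, ?_, fun s => ?_⟩
    · refine (Polynomial.natDegree_prod_le _ _).trans ?_
      have hk' : ∑ i, k i ≤ d := by
        have : ((∑ i, k i : ℕ) : ℤ) ≤ d := by
          simpa [expSet, Finsupp.degree_eq_sum] using hk
        exact_mod_cast this
      refine (Finset.sum_le_sum fun i _ => ?_).trans hk'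
      refine Polynomial.natDegree_pow_le.trans ?_
      have := Polynomial.natDegree_linear_le (a := b i) (b := a i)
      nlinarith
    · simp only [monoFun, Polynomial.eval_prod]
      refine Finset.prod_congr rfl fun i _ => ?_
      simp only [PiLp.add_apply, PiLp.smul_apply, smul_eq_mul, Polynomial.eval_pow,
        Polynomial.eval_add, Polynomial.eval_mul, Polynomial.eval_C, Polynomial.eval_X]
      ring

lemma poly1_eq_zero {d : ℕ} {f : ℝ → ℝ} (hf : f ∈ poly1Sub d) {S : Set ℝ} (hS : S.Infinite)
    (h : ∀ s ∈ S, f s = 0) : f = 0 := by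
  obtain ⟨q, -, hq⟩ := hf
  have : q = 0 := Polynomial.eq_zero_of_infinite_isRoot q (hS.mono fun s hs => by
    simp [Polynomial.IsRoot, ← hq, h s hs])
  ext s; simp [hq, this]

/-- Passes from an integer degree bound, possibly negative, to a natural one, as restriction to a
line requires. -/
lemma natDeg_of_polySub {n : ℕ} {d : ℤ} {f : EN n → ℝ} (hf : f ∈ polySub n d) :
    f ∈ polySub n (d.toNat : ℕ) := polySub_mono (Int.self_le_toNat d) hf

/-- Identity theorem for polynomial functions. -/
lemma poly_eq_zero_of_open {n : ℕ} {d : ℤ} {f : EN n → ℝ} (hf : f ∈ polySub n d) {U : Set (EN n)}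
    (hU : IsOpen U) (hne : U.Nonempty) (h : ∀ x ∈ U, f x = 0) : f = 0 := by
  obtain ⟨a, ha⟩ := hne
  ext x
  have h1 := line_mem_poly1Sub (natDeg_of_polySub hf) a (x - a)
  have hc : Continuous fun s : ℝ => a + s • (x - a) := by fun_prop
  have hopen : IsOpen ((fun s : ℝ => a + s • (x - a)) ⁻¹' U) := hU.preimage hc
  have hinf : ((fun s : ℝ => a + s • (x - a)) ⁻¹' U).Infinite := by
    refine infinite_of_mem_nhds (0 : ℝ) (hopen.mem_nhds ?_)
    simpa using ha
  have := congrFun (poly1_eq_zero h1 hinf fun s hs => h _ hs) 1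
  simpa using this

lemma hasFDerivAt_evalLin {n : ℕ} (P : MvPolynomial (Fin n) ℝ) (x : EN n) :
    HasFDerivAt (evalLin n P)
      (∑ i, evalLin n (MvPolynomial.pderiv i P) x • (EuclideanSpace.proj i : EN n →L[ℝ] ℝ)) x := by
  induction P using MvPolynomial.induction_on with
  | C a =>
    have : evalLin n (MvPolynomial.C a) = fun _ => a := by ext; simp [evalLin]
    rw [this]
    convert hasFDerivAt_const a x using 1
    simp
  | add p q hp hq =>
    rw [map_add]
    refine (hp.add hq).congr_fderiv ?_
    simp [add_smul, Finset.sum_add_distrib]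
  | mul_X p i hp =>
    have h1 : evalLin n (p * MvPolynomial.X i) = fun x => evalLin n p x * x i := by
      ext; simp [evalLin]
    rw [h1]
    have h2 : HasFDerivAt (fun x : EN n => x i) (EuclideanSpace.proj i : EN n →L[ℝ] ℝ) x :=
      (EuclideanSpace.proj i : EN n →L[ℝ] ℝ).hasFDerivAt
    refine (hp.mul h2).congr_fderiv ?_
    have h3 : ∀ j, evalLin n (MvPolynomial.pderiv j (p * MvPolynomial.X i)) x =
        evalLin n p x * (if j = i then 1 else 0) + x i * evalLin n (MvPolynomial.pderiv j p) x := by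
      intro j
      by_cases hj : j = i <;> simp [evalLin, MvPolynomial.pderiv_X, Pi.single_apply, hj]
    simp only [h3, add_smul, Finset.sum_add_distrib, mul_ite, mul_one, mul_zero, ite_smul,
      zero_smul, Finset.sum_ite_eq', Finset.mem_univ, if_true, Finset.smul_sum, mul_smul]

lemma contDiff_of_polySub {n : ℕ} {d : ℤ} {f : EN n → ℝ} (hf : f ∈ polySub n d) :
    ContDiff ℝ ∞ f := by
  rw [polySub_eq_span] at hf
  induction hf using Submodule.span_induction with
  | zero => exact contDiff_const
  | add f f' _ _ h h' => exact h.add h'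
  | smul c f _ h => exact contDiff_const.smul h
  | mem f hf =>
    obtain ⟨k, hk, rfl⟩ := hf
    unfold monoFun
    fun_prop

lemma partialD_mem_polySub {n : ℕ} {d : ℤ} {f : EN n → ℝ} (hf : f ∈ polySub n d) (i : Fin n) :
    partialD i f ∈ polySub n (d - 1) := by
  obtain ⟨P, hP, rfl⟩ := hf
  have h : partialD i (evalLin n P) = evalLin n (MvPolynomial.pderiv i P) := by
    ext x
    rw [partialD, (hasFDerivAt_evalLin P x).fderiv]
    simp [ContinuousLinearMap.sum_apply, Finset.sum_eq_single i]
  rw [h]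
  refine Submodule.mem_map_of_mem ?_
  rw [P.as_sum, map_sum]
  refine Submodule.sum_mem _ fun m hm => ?_
  rw [MvPolynomial.pderiv_monomial, MvPolynomial.monomial_mem_restrictSupport]
  -- A monomial free of the `i`-th variable is killed; any other loses exactly one degree. Hence the
  -- bound `d - 1` is right even when it is negative.
  by_cases hmi : m i = 0
  · right; simp [hmi]
  · left
    have h1 : (m.degree : ℤ) ≤ d := hP hm
    have h2 : m = (m - Finsupp.single i 1) + Finsupp.single i 1 := by
      rw [tsub_add_cancel_of_le]
      rw [Finsupp.single_le_iff]; omega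
    have h3 : m.degree = (m - Finsupp.single i 1).degree + 1 := by
      conv_lhs => rw [h2]
      simp
    simp only [expSet, mem_ofPred_eq]
    omega

/-! ## Parameter integrals in finite-dimensional spaces of functions -/

section ParamIntegral

variable {X : Type*}

/-- Linear functionals on a finite-dimensional space of functions are combinations of point
evaluations. -/
lemma exists_eval_repr (V : Submodule ℝ (X → ℝ)) [FiniteDimensional ℝ V] (l : V →ₗ[ℝ] ℝ) :
    ∃ c : X →₀ ℝ, ∀ f : V, l f = c.sum fun x a => a * (f : X → ℝ) x := by
  let ev : X → (V →ₗ[ℝ] ℝ) := fun x => (LinearMap.proj x).comp V.subtype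
  -- A function killed by all point evaluations is zero, so the evaluations span the dual of a
  -- finite-dimensional space.
  have h : Submodule.span ℝ (range ev) = ⊤ := by
    refine Submodule.span_eq_top_of_ne_zero fun z hz => ?_
    by_contra! hc
    refine hz (Subtype.ext (funext fun x => ?_))
    exact hc (ev x) ⟨x, rfl⟩
  have hl : l ∈ Submodule.span ℝ (range ev) := by rw [h]; trivial
  obtain ⟨c, hc⟩ := (Finsupp.mem_span_range_iff_exists_finsupp).1 hl
  refine ⟨c, fun f => ?_⟩
  rw [← hc]
  simp [Finsupp.sum, ev, LinearMap.sum_apply]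

variable {V : Submodule ℝ (X → ℝ)} [FiniteDimensional ℝ V] {F : ℝ → X → ℝ}

lemma intervalIntegrable_functional (hF : ∀ t, F t ∈ V)
    (hi : ∀ x, IntervalIntegrable (fun t => F t x) volume 0 1) (l : V →ₗ[ℝ] ℝ) :
    IntervalIntegrable (fun t => l ⟨F t, hF t⟩) volume 0 1 := by
  obtain ⟨c, hc⟩ := exists_eval_repr V l
  simp only [hc, Finsupp.sum]
  have := IntervalIntegrable.sum c.support (f := fun x t => c x * F t x) (a := 0) (b := 1)
    (μ := volume) fun x _ => (hi x).const_mul (c x)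
  refine this.congr fun t _ => ?_
  simp

/-- The integral is taken pointwise. A functional on `V` is a finite combination of point
evaluations, so it passes through the integral; applied to coordinate functionals this gives
membership, applied to derivatives it replaces differentiation under the integral sign. -/
lemma integral_mem_and_functional (hF : ∀ t, F t ∈ V)
    (hi : ∀ x, IntervalIntegrable (fun t => F t x) volume 0 1) :
    ∃ h : (fun x => ∫ t in (0 : ℝ)..1, F t x) ∈ V,
      ∀ l : V →ₗ[ℝ] ℝ, l ⟨_, h⟩ = ∫ t in (0 : ℝ)..1, l ⟨F t, hF t⟩ := by
  have h : (fun x => ∫ t in (0 : ℝ)..1, F t x) ∈ V := by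
    let b := Module.finBasis ℝ V
    have h1 : (fun x => ∫ t in (0 : ℝ)..1, F t x) =
        ∑ i, (∫ t in (0 : ℝ)..1, b.coord i ⟨F t, hF t⟩) • (b i : X → ℝ) := by
      ext x
      have h2 : ∀ t, F t x = ∑ i, b.coord i ⟨F t, hF t⟩ * (b i : X → ℝ) x := by
        intro t
        have := congrArg (fun v : V => (v : X → ℝ) x) (b.sum_repr ⟨F t, hF t⟩)
        simp only [Submodule.coe_sum, Submodule.coe_smul, Finset.sum_apply, Pi.smul_apply,
          smul_eq_mul] at this
        exact this.symm
      simp only [h2, Finset.sum_apply, Pi.smul_apply, smul_eq_mul]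
      rw [intervalIntegral.integral_finsetSum]
      · simp
      · exact fun i _ => (intervalIntegrable_functional hF hi _).mul_const _
    rw [h1]
    exact Submodule.sum_mem _ fun i _ => Submodule.smul_mem _ _ (b i).2
  refine ⟨h, fun l => ?_⟩
  obtain ⟨c, hc⟩ := exists_eval_repr V l
  simp only [hc, Finsupp.sum]
  rw [intervalIntegral.integral_finsetSum]
  · simp
  · exact fun x _ => (hi x).const_mul _

end ParamIntegral

lemma integral_mem_polySub {n : ℕ} {d : ℤ} {F : ℝ → EN n → ℝ} (hF : ∀ t, F t ∈ polySub n d)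
    (hi : ∀ x, Continuous fun t => F t x) :
    (fun x => ∫ t in (0 : ℝ)..1, F t x) ∈ polySub n d :=
  (integral_mem_and_functional hF fun x => (hi x).intervalIntegrable _ _).1

/-- `partialD i` as a linear functional on polynomials. -/
def partialLin {n : ℕ} (d : ℤ) (i : Fin n) (x : EN n) : polySub n d →ₗ[ℝ] ℝ where
  toFun f := partialD i (f : EN n → ℝ) x
  map_add' f g := by
    simp only [partialD, Submodule.coe_add]
    rw [fderiv_add ((contDiff_of_polySub f.2).differentiable (by simp) x)
      ((contDiff_of_polySub g.2).differentiable (by simp) x)]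
    rfl
  map_smul' c f := by
    simp only [partialD, Submodule.coe_smul]
    rw [fderiv_const_smul ((contDiff_of_polySub f.2).differentiable (by simp) x)]
    rfl

lemma partialD_integral {n : ℕ} {d : ℤ} {F : ℝ → EN n → ℝ} (hF : ∀ t, F t ∈ polySub n d)
    (hi : ∀ x, Continuous fun t => F t x) (i : Fin n) (x : EN n) :
    partialD i (fun x => ∫ t in (0 : ℝ)..1, F t x) x = ∫ t in (0 : ℝ)..1, partialD i (F t) x := by
  obtain ⟨h, h'⟩ := integral_mem_and_functional hF fun x => (hi x).intervalIntegrable _ _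
  exact h' (partialLin d i x)

/-! ## Affine functions and division -/

lemma affine_mem_polySub {n : ℕ} {d : ℤ} (hd : 1 ≤ d) (c : ℝ) (g : EN n) :
    (fun x : EN n => c + inner ℝ g x) ∈ polySub n d := by
  refine add_mem (const_mem_polySub (by omega) c) ?_
  have : (fun x : EN n => inner ℝ g x) = ∑ i, g i • fun x : EN n => x i := by
    ext x; simp [PiLp.inner_apply, mul_comm]
  change (fun x : EN n => inner ℝ g x) ∈ polySub n d
  rw [this]
  exact Submodule.sum_mem _ fun i _ => Submodule.smul_mem _ _ (coord_mem_polySub hd i)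

lemma fderiv_apply_eq_sum {n : ℕ} {f : EN n → ℝ} (x v : EN n) :
    fderiv ℝ f x v = ∑ i, v i * partialD i f x := by
  conv_lhs => rw [← (EuclideanSpace.basisFun (Fin n) ℝ).sum_repr v]
  simp [partialD]

lemma fderiv_mem_polySub {n : ℕ} {d : ℤ} {f : EN n → ℝ} (hf : f ∈ polySub n d) (v : EN n) :
    (fun x => fderiv ℝ f x v) ∈ polySub n (d - 1) := by
  have : (fun x => fderiv ℝ f x v) = ∑ i, v i • partialD i f := by
    ext x; simp [fderiv_apply_eq_sum]
  rw [this]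
  exact Submodule.sum_mem _ fun i _ => Submodule.smul_mem _ _ (partialD_mem_polySub hf i)

/-- One affine map covers both substitutions needed: the contraction towards `a` and the sliding
along `b` by an affine amount. -/
lemma line_comp_mem {n : ℕ} (c : ℝ) (g a b : EN n) (s : ℝ) (i : Fin n) :
    (fun x : EN n => (a + s • (x - a) + (c + inner ℝ g x) • b) i) ∈ polySub n 1 := by
  have : (fun x : EN n => (a + s • (x - a) + (c + inner ℝ g x) • b) i) =
      (fun _ => (1 - s) * a i) + s • (fun x : EN n => x i) + b i • fun x => c + inner ℝ g x := by
    ext x; simp; ring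
  rw [this]
  exact add_mem (add_mem (const_mem_polySub (by simp) _) (Submodule.smul_mem _ _
    (coord_mem_polySub le_rfl i))) (Submodule.smul_mem _ _ (affine_mem_polySub le_rfl c g))

/-- A polynomial that vanishes on a hyperplane is divisible by the affine function defining it. -/
lemma exists_quotient {n : ℕ} {d : ℤ} {f : EN n → ℝ} (hf : f ∈ polySub n (d + 1)) (c : ℝ)
    {g : EN n} (hg : g ≠ 0) (h0 : ∀ x, c + inner ℝ g x = 0 → f x = 0) :
    ∃ q ∈ polySub n d, ∀ x, f x = (c + inner ℝ g x) * q x := by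
  -- Normalised so that the affine function `l` grows at unit rate along `h`. Sliding `x` by `- l x`
  -- along `h` reaches the hyperplane, where `f` vanishes; integrating the derivative of `f` back
  -- along this segment produces the factor `l x`.
  set h : EN n := (‖g‖ ^ 2)⁻¹ • g with hh
  have hgh : inner ℝ g h = 1 := by
    rw [hh, inner_smul_right, real_inner_self_eq_norm_sq, inv_mul_cancel₀]
    positivity
  set l : EN n → ℝ := fun x => c + inner ℝ g x with hl
  have hD := fderiv_mem_polySub hf h
  rw [add_sub_cancel_right] at hD
  have hcd : Continuous fun x => fderiv ℝ f x h := (contDiff_of_polySub hD).continuous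
  refine ⟨fun x => ∫ t in (0 : ℝ)..1, fderiv ℝ f (x + ((t - 1) * l x) • h) h, ?_, ?_⟩
  · refine integral_mem_polySub (F := fun t x => fderiv ℝ f (x + ((t - 1) * l x) • h) h)
      (fun t => ?_) (fun x => hcd.comp (by fun_prop))
    refine comp_mem_polySub hD (L := fun x => x + ((t - 1) * l x) • h) fun i => ?_
    convert line_comp_mem ((t - 1) * c) ((t - 1) • g) 0 h 1 i using 2 with x
    simp only [l, inner_smul_left, PiLp.add_apply, PiLp.smul_apply, smul_eq_mul, PiLp.sub_apply,
      PiLp.zero_apply, RCLike.conj_to_real]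
    ring
  · intro x
    have h1 : ∀ t ∈ uIcc (0 : ℝ) 1, HasDerivAt (fun t : ℝ => f (x + ((t - 1) * l x) • h))
        (l x * fderiv ℝ f (x + ((t - 1) * l x) • h) h) t := by
      intro t _
      have h2 : HasDerivAt (fun t : ℝ => x + ((t - 1) * l x) • h) ((1 * l x) • h) t :=
        ((((hasDerivAt_id t).sub_const 1).mul_const (l x)).smul_const h).const_add x
      have h3 := ((contDiff_of_polySub hf).differentiable (by simp)
        (x + ((t - 1) * l x) • h)).hasFDerivAt.comp_hasDerivAt t h2
      simpa [Function.comp_def] using h3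
    have h4 := intervalIntegral.integral_eq_sub_of_hasDerivAt h1
      ((continuous_const.mul (hcd.comp (by fun_prop))).intervalIntegrable _ _)
    rw [intervalIntegral.integral_const_mul] at h4
    rw [h4]
    have h5 : f (x + ((0 - 1) * l x) • h) = 0 := by
      apply h0
      rw [inner_add_right, inner_smul_right, hgh]
      simp only [l]; ring
    rw [h5]; simp

/-- Nonconstant affine functions can be cancelled. -/
lemma affine_cancel {n : ℕ} {c : ℝ} {g : EN n} (hg : g ≠ 0) {f₁ f₂ : EN n → ℝ}
    (h1 : Continuous f₁) (h2 : Continuous f₂)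
    (h : ∀ x, (c + inner ℝ g x) * f₁ x = (c + inner ℝ g x) * f₂ x) : f₁ = f₂ := by
  ext x
  have hgg : inner ℝ g g ≠ 0 := by simpa using hg
  -- Cancellation is possible off the hyperplane only. The line through `x` in direction `g` avoids
  -- it for small nonzero `s`, and continuity then gives the value at `x`.
  have hc : ∀ᶠ s in nhdsWithin (0 : ℝ) {0}ᶜ, c + inner ℝ g (x + s • g) ≠ 0 := by
    by_cases hx : c + inner ℝ g x = 0
    · filter_upwards [self_mem_nhdsWithin] with s hs
      rw [inner_add_right, inner_smul_right, ← add_assoc, hx, zero_add]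
      exact mul_ne_zero hs hgg
    · have : Continuous fun s : ℝ => c + inner ℝ g (x + s • g) := by fun_prop
      refine nhdsWithin_le_nhds (this.continuousAt.eventually_ne ?_)
      simpa using hx
  have hs : ∀ᶠ s in nhdsWithin (0 : ℝ) {0}ᶜ, f₁ (x + s • g) = f₂ (x + s • g) :=
    hc.mono fun s hs => mul_left_cancel₀ hs (h _)
  have hl : Continuous fun s : ℝ => x + s • g := by fun_prop
  have t1 : Filter.Tendsto (fun s : ℝ => f₁ (x + s • g)) (nhdsWithin 0 {0}ᶜ) (nhds (f₁ x)) := by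
    have := ((h1.comp hl).tendsto 0).mono_left (nhdsWithin_le_nhds (s := {0}ᶜ))
    simpa [Function.comp_def] using this
  have t2 : Filter.Tendsto (fun s : ℝ => f₂ (x + s • g)) (nhdsWithin 0 {0}ᶜ) (nhds (f₂ x)) := by
    have := ((h2.comp hl).tendsto 0).mono_left (nhdsWithin_le_nhds (s := {0}ᶜ))
    simpa [Function.comp_def] using this
  exact tendsto_nhds_unique t1 (t2.congr' (hs.mono fun _ h => h.symm))

/-- The product is divisible with a quotient of the right degree, and cancellation identifies that
quotient with `q`. The a priori bound `e` only supplies continuity. -/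
lemma degree_of_affine_mul {n : ℕ} {d e : ℤ} {c : ℝ} {g : EN n} (hg : g ≠ 0) {q : EN n → ℝ}
    (hq : q ∈ polySub n e) (h : (fun x => (c + inner ℝ g x) * q x) ∈ polySub n (d + 1)) :
    q ∈ polySub n d := by
  obtain ⟨r, hr, h'⟩ := exists_quotient h c hg fun x hx => by simp [hx]
  rwa [affine_cancel hg (contDiff_of_polySub hq).continuous (contDiff_of_polySub hr).continuous h']

/-- Divisibility by two independent affine functions. -/
lemma exists_quotient₂ {n : ℕ} {d : ℤ} {f : EN n → ℝ} (hf : f ∈ polySub n (d + 2)) (c c' : ℝ)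
    {g g' h : EN n} (hg : inner ℝ g h ≠ 0) (hg' : g' ≠ 0) (hh : inner ℝ g' h = 0)
    (h0 : ∀ x, c + inner ℝ g x = 0 → f x = 0) (h0' : ∀ x, c' + inner ℝ g' x = 0 → f x = 0) :
    ∃ q ∈ polySub n d, ∀ x, f x = (c + inner ℝ g x) * (c' + inner ℝ g' x) * q x := by
  have hg0 : g ≠ 0 := by rintro rfl; simp at hg
  obtain ⟨r, hr, hfr⟩ := exists_quotient (d := d + 1) (by convert hf using 2; ring) c hg0 h0
  have hrc := (contDiff_of_polySub hr).continuous
  -- The first quotient `r` must vanish on the second hyperplane. Direction `h` stays in that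
  -- hyperplane and leaves the first one, so if `r x ≠ 0` the first affine function would vanish
  -- along a whole interval.
  obtain ⟨q, hq, hrq⟩ := exists_quotient hr c' hg' fun x hx => by
    by_contra hne
    have hl : Continuous fun s : ℝ => x + s • h := by fun_prop
    have h1 : ∀ᶠ s in nhds (0 : ℝ), r (x + s • h) ≠ 0 :=
      (hrc.comp hl).continuousAt.eventually_ne (by simpa using hne)
    have h2 : ∀ᶠ s in nhds (0 : ℝ), c + inner ℝ g (x + s • h) = 0 := h1.mono fun s hs => by
      have h3 := h0' (x + s • h) (by rw [inner_add_right, inner_smul_right, hh]; simpa using hx)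
      rw [hfr] at h3
      exact (mul_eq_zero.1 h3).resolve_right hs
    have h4 : c + inner ℝ g x = 0 := by simpa using h2.self_of_nhds
    obtain ⟨s, hs, hs0⟩ :=
      ((h2.filter_mono (nhdsWithin_le_nhds (s := {0}ᶜ))).and self_mem_nhdsWithin).exists
    have hs' : c + inner ℝ g (x + s • h) = 0 := hs
    rw [inner_add_right, inner_smul_right, ← add_assoc, h4, zero_add] at hs'
    exact (mul_ne_zero hs0 hg) hs'
  exact ⟨q, hq, fun x => by rw [hfr, hrq]; ring⟩

/-! ## Polynomial vector fields -/

/-- `VPoly n d` as a submodule. -/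
def vpolySub (n : ℕ) (d : ℤ) : Submodule ℝ (EN n → EN n) where
  carrier := {v | ∀ i, (fun x => v x i) ∈ polySub n d}
  zero_mem' := fun _ => Submodule.zero_mem _
  add_mem' := fun hu hv i => add_mem (hu i) (hv i)
  smul_mem' := fun c _ hu i => Submodule.smul_mem _ c (hu i)

lemma mem_vpolySub_iff {n : ℕ} {d : ℤ} {v : EN n → EN n} :
    v ∈ vpolySub n d ↔ ∀ i, (fun x => v x i) ∈ polySub n d := Iff.rfl

lemma mem_vpolySub {n : ℕ} {d : ℤ} {v : EN n → EN n} : v ∈ vpolySub n d ↔ v ∈ VPoly n d := by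
  simp only [mem_vpolySub_iff, VPoly, mem_polySub, mem_ofPred_eq]

instance (n : ℕ) (d : ℤ) : FiniteDimensional ℝ (vpolySub n d) := by
  let L : vpolySub n d →ₗ[ℝ] (Fin n → polySub n d) :=
    { toFun := fun v i => ⟨fun x => (v : EN n → EN n) x i, v.2 i⟩
      map_add' := fun u v => rfl
      map_smul' := fun c v => rfl }
  refine Module.Finite.of_injective L fun u v h => ?_
  ext x i
  exact congrArg (fun w : polySub n d => (w : EN n → ℝ) x) (congrFun h i)

lemma vpolySub_mono {n : ℕ} {d e : ℤ} (h : d ≤ e) : vpolySub n d ≤ vpolySub n e :=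
  fun _ hv i => polySub_mono h (hv i)

lemma contDiff_of_vpolySub {n : ℕ} {d : ℤ} {v : EN n → EN n} (hv : v ∈ vpolySub n d) :
    ContDiff ℝ ∞ v := contDiff_euclidean.2 fun i => contDiff_of_polySub (hv i)

lemma inner_mem_polySub {n m : ℕ} {d : ℤ} {v : EN m → EN n}
    (hv : ∀ i, (fun x => v x i) ∈ polySub m d) (w : EN n) :
    (fun x => inner ℝ (v x) w) ∈ polySub m d := by
  have : (fun x => inner ℝ (v x) w) = ∑ i, w i • fun x => v x i := by
    ext x; simp [PiLp.inner_apply]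
  rw [this]
  exact Submodule.sum_mem _ fun i _ => Submodule.smul_mem _ _ (hv i)

lemma const_mem_vpolySub {n : ℕ} {d : ℤ} (hd : 0 ≤ d) (w : EN n) :
    (fun _ => w) ∈ vpolySub n d := fun i => const_mem_polySub hd (w i)

lemma smul_mem_vpolySub {n : ℕ} {d e k : ℤ} {f : EN n → ℝ} {v : EN n → EN n}
    (hf : f ∈ polySub n d) (hv : v ∈ vpolySub n e) (h : d + e ≤ k) :
    (fun x => f x • v x) ∈ vpolySub n k := fun i => mul_mem_polySub' hf (hv i) h

lemma smul_const_mem_vpolySub {n : ℕ} {d : ℤ} {f : EN n → ℝ} (hf : f ∈ polySub n d) (w : EN n) :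
    (fun x => f x • w) ∈ vpolySub n d :=
  smul_mem_vpolySub hf (const_mem_vpolySub le_rfl w) (by simp)

lemma vpoly_eq_zero_of_open {n : ℕ} {d : ℤ} {f : EN n → EN n} (hf : f ∈ vpolySub n d)
    {U : Set (EN n)} (hU : IsOpen U) (hne : U.Nonempty) (h : ∀ x ∈ U, f x = 0) : f = 0 := by
  ext x i
  exact congrFun (poly_eq_zero_of_open (hf i) hU hne fun x hx => by simp [h x hx]) x

lemma inner_gradient {n : ℕ} (f : EN n → ℝ) (x v : EN n) :
    inner ℝ (gradient f x) v = fderiv ℝ f x v := by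
  simp [gradient]

lemma gradient_apply {n : ℕ} (f : EN n → ℝ) (x : EN n) (i : Fin n) :
    gradient f x i = partialD i f x := by
  rw [partialD, ← inner_gradient, EuclideanSpace.inner_single_right]
  simp

lemma gradient_mem_vpolySub {n : ℕ} {d : ℤ} {f : EN n → ℝ} (hf : f ∈ polySub n (d + 1)) :
    gradient f ∈ vpolySub n d := fun i => by
  simp only [gradient_apply]
  have := partialD_mem_polySub hf i
  rwa [add_sub_cancel_right] at this

lemma contDiff_gradient {n : ℕ} {f : EN n → ℝ} (hf : ContDiff ℝ ∞ f) :
    ContDiff ℝ ∞ (gradient f) := by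
  unfold gradient
  exact (InnerProductSpace.toDual ℝ (EN n)).symm.toContinuousLinearEquiv.contDiff.comp
    (hf.fderiv_right (by simp))

lemma gradient_add {n : ℕ} {f g : EN n → ℝ} (hf : Differentiable ℝ f) (hg : Differentiable ℝ g) :
    gradient (f + g) = gradient f + gradient g := by
  ext1 x; simp [gradient, fderiv_add (hf x) (hg x)]

lemma gradient_smul {n : ℕ} {f : EN n → ℝ} (c : ℝ) :
    gradient (c • f) = c • gradient f := by
  ext1 x; simp [gradient, fderiv_const_smul_field]

lemma gradient_sub {n : ℕ} {f g : EN n → ℝ} (hf : Differentiable ℝ f) (hg : Differentiable ℝ g) :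
    gradient (f - g) = gradient f - gradient g := by
  ext1 x; simp [gradient, fderiv_sub (hf x) (hg x)]

lemma gradient_zero {n : ℕ} : gradient (0 : EN n → ℝ) = 0 := by
  ext1 x; simp [gradient]

lemma gradient_sum {n : ℕ} {ι : Type*} (s : Finset ι) {f : ι → EN n → ℝ}
    (hf : ∀ i, Differentiable ℝ (f i)) :
    gradient (∑ i ∈ s, f i) = ∑ i ∈ s, gradient (f i) := by
  classical
  induction s using Finset.induction_on with
  | empty => simp [gradient_zero]
  | insert a s ha ih =>
    rw [Finset.sum_insert ha, Finset.sum_insert ha, gradient_add (hf a), ih]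
    exact Differentiable.sum fun i _ => hf i

lemma partialD_apply {n m : ℕ} {u : EN n → EN m} {x : EN n} (hu : DifferentiableAt ℝ u x)
    (i : Fin n) (j : Fin m) : partialD i u x j = partialD i (fun y => u y j) x := by
  have h := ((EuclideanSpace.proj j : EN m →L[ℝ] ℝ).hasFDerivAt.comp x hu.hasFDerivAt).fderiv
  have h' : fderiv ℝ (fun y => u y j) x = (EuclideanSpace.proj j : EN m →L[ℝ] ℝ).comp
      (fderiv ℝ u x) := h
  simp [partialD, h']

lemma partialD_sub {n : ℕ} {F : Type*} [NormedAddCommGroup F] [NormedSpace ℝ F]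
    {f g : EN n → F} {x : EN n} (hf : DifferentiableAt ℝ f x)
    (hg : DifferentiableAt ℝ g x) (i : Fin n) :
    partialD i (fun y => f y - g y) x = partialD i f x - partialD i g x := by
  simp [partialD, fderiv_fun_sub hf hg]

lemma partialD_mul {n : ℕ} {f g : EN n → ℝ} {x : EN n} (hf : DifferentiableAt ℝ f x)
    (hg : DifferentiableAt ℝ g x) (i : Fin n) :
    partialD i (fun y => f y * g y) x = f x * partialD i g x + g x * partialD i f x := by
  simp [partialD, fderiv_fun_mul hf hg]

lemma partialD_coord_sub {n : ℕ} (a : EN n) (i j : Fin n) (x : EN n) :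
    partialD i (fun y : EN n => y j - a j) x = if i = j then 1 else 0 := by
  have h : HasFDerivAt (fun y : EN n => y j - a j) (EuclideanSpace.proj j : EN n →L[ℝ] ℝ) x :=
    (EuclideanSpace.proj j : EN n →L[ℝ] ℝ).hasFDerivAt.sub_const _
  rw [partialD, h.fderiv]
  simp [eq_comm]

/-! ## Closed polynomial fields -/

/-- Poincaré's lemma for polynomial fields, with control of the degree of the potential. -/
lemma exists_potential {n : ℕ} {d e : ℤ} {u : EN n → EN n} (hu : u ∈ vpolySub n e)
    (hsym : ∀ x i j, partialD i u x j = partialD j u x i)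
    (hdeg : ∀ t : ℝ, (fun x => inner ℝ (u (t • x)) x) ∈ polySub n d) :
    ∃ φ ∈ polySub n d, gradient φ = u := by
  have hc := contDiff_of_vpolySub hu
  have hdu : Differentiable ℝ u := hc.differentiable (by simp)
  have hdi : ∀ i, Differentiable ℝ fun x => u x i := fun i =>
    (contDiff_of_polySub (hu i)).differentiable (by simp)
  let J : EN n → EN n →L[ℝ] ℝ := fun v => ∑ i, v i • (EuclideanSpace.proj i : EN n →L[ℝ] ℝ)
  have hJa : ∀ v w, J v w = inner ℝ v w := by
    intro v w; simp [J, PiLp.inner_apply, mul_comm]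
  have hJ : ∀ a, HasFDerivAt (fun x => J (u x))
      (∑ i, (fderiv ℝ (fun x => u x i) a).smulRight (EuclideanSpace.proj i : EN n →L[ℝ] ℝ)) a := by
    intro a
    refine HasFDerivAt.fun_sum fun i _ => ?_
    have h := (hdi i a).hasFDerivAt.smul_const (EuclideanSpace.proj i : EN n →L[ℝ] ℝ)
    exact h
  obtain ⟨f, hf⟩ := (convex_univ (𝕜 := ℝ) (E := EN n)).exists_forall_hasFDerivAt_of_fderiv_symmetric
    isOpen_univ (fun a _ => (hJ a).differentiableAt.differentiableWithinAt) (by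
      intro a _ x y
      rw [(hJ a).fderiv]
      have h1 : ∀ x y : EN n, (∑ i, (fderiv ℝ (fun x => u x i) a).smulRight
          (EuclideanSpace.proj i : EN n →L[ℝ] ℝ)) x y =
          ∑ j, ∑ i, x i * y j * partialD i u a j := by
        intro x y
        simp only [partialD_apply (hdu a)]
        simp [fderiv_apply_eq_sum, Finset.sum_mul]
        exact Finset.sum_congr rfl fun i _ => Finset.sum_congr rfl fun j _ => by ring
      rw [h1, h1, Finset.sum_comm]
      refine Finset.sum_congr rfl fun i _ => Finset.sum_congr rfl fun j _ => ?_
      rw [hsym]; ring)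
  have hf' : ∀ x, HasFDerivAt f (J (u x)) x := fun x => hf x trivial
  have hg : ∀ x, fderiv ℝ f x = J (u x) := fun x => (hf' x).fderiv
  refine ⟨fun x => f x - f 0, ?_, ?_⟩
  -- The primitive obtained so far is merely differentiable. Written as a ray integral it inherits
  -- the degree from `hdeg`, which may be better than the degree of `u` plus one.
  · have h1 : (fun x => f x - f 0) = fun x => ∫ t in (0 : ℝ)..1, inner ℝ (u (t • x)) x := by
      ext x
      have h2 : ∀ t ∈ uIcc (0 : ℝ) 1,
          HasDerivAt (fun t : ℝ => f (t • x)) (inner ℝ (u (t • x)) x) t := by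
        intro t _
        have h3 : HasDerivAt (fun t : ℝ => t • x) ((1 : ℝ) • x) t := (hasDerivAt_id t).smul_const x
        have := (hf' (t • x)).comp_hasDerivAt t h3
        simpa [Function.comp_def, hJa] using this
      have hcu : Continuous u := hc.continuous
      rw [intervalIntegral.integral_eq_sub_of_hasDerivAt h2
        ((by fun_prop : Continuous fun t : ℝ => inner ℝ (u (t • x)) x).intervalIntegrable _ _)]
      simp
    rw [h1]
    have hcu : Continuous u := hc.continuous
    exact integral_mem_polySub (F := fun t x => inner ℝ (u (t • x)) x) hdeg
      fun x => by fun_prop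
  · ext1 x
    have : fderiv ℝ (fun x => f x - f 0) x = J (u x) := by
      rw [fderiv_sub_const]; exact hg x
    refine ext_inner_right ℝ fun v => ?_
    rw [inner_gradient, this, hJa]

/-! ## Homotopy formulas -/

/-- The weighted average `∫₀¹ t u(a + t (x - a)) dt`. -/
def coneAvg {n : ℕ} (a : EN n) (u : EN n → ℝ) (x : EN n) : ℝ :=
  ∫ t in (0 : ℝ)..1, t * u (a + t • (x - a))

lemma coneFun_mem {n : ℕ} {d : ℤ} (a : EN n) {u : EN n → ℝ} (hu : u ∈ polySub n d) (t : ℝ) :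
    (fun x => u (a + t • (x - a))) ∈ polySub n d := by
  refine comp_mem_polySub hu (L := fun x => a + t • (x - a)) fun i => ?_
  convert line_comp_mem 0 0 a 0 t i using 2 with x
  simp

lemma coneAvg_mem {n : ℕ} {d : ℤ} (a : EN n) {u : EN n → ℝ} (hu : u ∈ polySub n d) :
    coneAvg a u ∈ polySub n d := by
  have hcu := (contDiff_of_polySub hu).continuous
  exact integral_mem_polySub (F := fun t x => t * u (a + t • (x - a)))
    (fun t => Submodule.smul_mem _ t (coneFun_mem a hu t)) fun x => by fun_prop

lemma partialD_coneAvg {n : ℕ} {d : ℤ} (a : EN n) {u : EN n → ℝ} (hu : u ∈ polySub n d)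
    (i : Fin n) (x : EN n) :
    partialD i (coneAvg a u) x =
      ∫ t in (0 : ℝ)..1, t ^ 2 * partialD i u (a + t • (x - a)) := by
  have hcu := (contDiff_of_polySub hu).continuous
  have h := partialD_integral (F := fun t x => t * u (a + t • (x - a)))
    (fun t => Submodule.smul_mem _ t (coneFun_mem a hu t)) (fun x => by fun_prop) i x
  rw [show coneAvg a u = fun x => ∫ t in (0 : ℝ)..1, t * u (a + t • (x - a)) from rfl, h]
  refine intervalIntegral.integral_congr fun t _ => ?_
  have h1 : HasFDerivAt (fun x : EN n => a + t • (x - a))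
      (t • ContinuousLinearMap.id ℝ (EN n)) x :=
    (((hasFDerivAt_id x).sub_const a).const_smul t).const_add a
  have h2 := (((contDiff_of_polySub hu).differentiable (by simp)
    (a + t • (x - a))).hasFDerivAt.comp x h1).const_mul t
  have h3 : fderiv ℝ (fun x => t * u (a + t • (x - a))) x = _ := h2.fderiv
  simp only [partialD, h3]
  simp; ring

/-- Integrate the `t`-derivative of `t² u(a + t (x - a))` over the unit interval. This identity is
the core of both homotopy formulas. -/
lemma coneAvg_euler {n : ℕ} {d : ℤ} (a : EN n) {u : EN n → ℝ} (hu : u ∈ polySub n d) (x : EN n) :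
    2 * coneAvg a u x + ∑ i, (x i - a i) * partialD i (coneAvg a u) x = u x := by
  have hcu := (contDiff_of_polySub hu).continuous
  have hcp : ∀ i, Continuous (partialD i u) := fun i =>
    (contDiff_of_polySub (partialD_mem_polySub hu i)).continuous
  have h1 : ∀ t ∈ uIcc (0 : ℝ) 1, HasDerivAt (fun t : ℝ => t ^ 2 * u (a + t • (x - a)))
      (2 * (t * u (a + t • (x - a))) +
        ∑ i, (x i - a i) * (t ^ 2 * partialD i u (a + t • (x - a)))) t := by
    intro t _
    have h2 : HasDerivAt (fun t : ℝ => a + t • (x - a)) ((1 : ℝ) • (x - a)) t :=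
      ((hasDerivAt_id t).smul_const _).const_add a
    have h3 := ((contDiff_of_polySub hu).differentiable (by simp)
      (a + t • (x - a))).hasFDerivAt.comp_hasDerivAt t h2
    have h4 := (hasDerivAt_pow 2 t).mul h3
    have h5 : HasDerivAt (fun t : ℝ => t ^ 2 * u (a + t • (x - a))) _ t := h4
    convert h5 using 1
    rw [fderiv_apply_eq_sum, Finset.mul_sum]
    simp only [PiLp.smul_apply, PiLp.sub_apply, Function.comp_apply, smul_eq_mul]
    push_cast
    rw [mul_assoc, pow_one]
    congr 1
    exact Finset.sum_congr rfl fun i _ => by ring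
  have h6 := intervalIntegral.integral_eq_sub_of_hasDerivAt h1
    ((by fun_prop : Continuous fun t : ℝ => 2 * (t * u (a + t • (x - a))) +
        ∑ i, (x i - a i) * (t ^ 2 * partialD i u (a + t • (x - a)))).intervalIntegrable _ _)
  rw [intervalIntegral.integral_add ((by fun_prop : Continuous _).intervalIntegrable _ _)
    ((by fun_prop : Continuous _).intervalIntegrable _ _),
    intervalIntegral.integral_const_mul, intervalIntegral.integral_finsetSum
      (fun i _ => ((by fun_prop : Continuous _).intervalIntegrable _ _))] at h6
  simp only [intervalIntegral.integral_const_mul, ← partialD_coneAvg a hu] at h6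
  rw [coneAvg, h6]
  simp

lemma poincare2_eq (a : E2) {u : E2 → ℝ} :
    poincare2 a u = fun y => coneAvg a u y • (y - a) := by
  ext1 y
  rw [poincare2, coneAvg, intervalIntegral.integral_smul_const]

/-- With `c` the weighted average, `div (c (y - a)) = 2 c + (y - a) · ∇c`, which is the left side of
`coneAvg_euler`. -/
lemma div2_poincare2 {d : ℤ} (a : E2) {u : E2 → ℝ} (hu : u ∈ polySub 2 d) :
    div2 (poincare2 a u) = u := by
  ext y
  have hc := contDiff_of_polySub (coneAvg_mem a hu)
  have hd : Differentiable ℝ (coneAvg a u) := hc.differentiable (by simp)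
  have hd2 : Differentiable ℝ fun y => coneAvg a u y • (y - a) := by fun_prop
  rw [poincare2_eq, div2, partialD_apply (hd2 y), partialD_apply (hd2 y)]
  have h1 : ∀ i j : Fin 2, partialD i (fun y => (coneAvg a u y • (y - a)) j) y =
      coneAvg a u y * (if i = j then 1 else 0) + (y j - a j) * partialD i (coneAvg a u) y := by
    intro i j
    rw [← partialD_coord_sub a i j y, ← partialD_mul (hd y) (by fun_prop)]
    rfl
  have h2 := coneAvg_euler a hu y
  rw [Fin.sum_univ_two] at h2
  rw [h1, h1]
  simp only [if_true]
  linear_combination h2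

lemma cross_eq (u v : E3) : cross u v =
    !₂[u 1 * v 2 - u 2 * v 1, u 2 * v 0 - u 0 * v 2, u 0 * v 1 - u 1 * v 0] := rfl

lemma cross_zero (u v : E3) : cross u v 0 = u 1 * v 2 - u 2 * v 1 := rfl

lemma cross_one (u v : E3) : cross u v 1 = u 2 * v 0 - u 0 * v 2 := rfl

lemma cross_two (u v : E3) : cross u v 2 = u 0 * v 1 - u 1 * v 0 := rfl

lemma inner_E3 (u v : E3) : inner ℝ u v = u 0 * v 0 + u 1 * v 1 + u 2 * v 2 := by
  simp [PiLp.inner_apply, Fin.sum_univ_three, mul_comm]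

lemma inner_E2 (u v : E2) : inner ℝ u v = u 0 * v 0 + u 1 * v 1 := by
  simp [PiLp.inner_apply, Fin.sum_univ_two, mul_comm]

/-- The componentwise weighted average of a field. -/
def coneAvgField (a : E3) (u : E3 → E3) (x : E3) : E3 :=
  WithLp.toLp 2 fun i => coneAvg a (fun x => u x i) x

lemma coneAvgField_apply (a : E3) (u : E3 → E3) (x : E3) (i : Fin 3) :
    coneAvgField a u x i = coneAvg a (fun x => u x i) x := rfl

lemma coneAvgField_mem {d : ℤ} (a : E3) {u : E3 → E3} (hu : u ∈ vpolySub 3 d) :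
    coneAvgField a u ∈ vpolySub 3 d := fun i => coneAvg_mem a (hu i)

lemma poincare3_eq (a : E3) {u : E3 → E3} (hu : Continuous u) :
    poincare3 a u = fun x => cross (coneAvgField a u x) (x - a) := by
  ext1 x
  rw [poincare3]
  congr 1
  ext i
  rw [coneAvgField_apply, coneAvg]
  have h := (EuclideanSpace.proj i : E3 →L[ℝ] ℝ).intervalIntegral_comp_comm (a := 0) (b := 1)
    (μ := volume) (f := fun t : ℝ => t • u (a + t • (x - a)))
    ((by fun_prop : Continuous fun t : ℝ => t • u (a + t • (x - a))).intervalIntegrable _ _)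
  simpa using h.symm

/-- For `z = x - a` and the averaged field `c`, `curl (c × z) = 2 c + (z · ∇) c - z div c`. The
first two terms give `u` by `coneAvg_euler`, componentwise. -/
lemma curl_poincare3 {d : ℤ} (a : E3) {u : E3 → E3} (hu : u ∈ vpolySub 3 d)
    (hdiv : ∀ x, ∑ i, partialD i (fun x => u x i) x = 0) :
    curl (poincare3 a u) = u := by
  rw [poincare3_eq a (contDiff_of_vpolySub hu).continuous]
  have hm := coneAvgField_mem a hu
  set c := coneAvgField a u with hcdef
  have hd : Differentiable ℝ c := (contDiff_of_vpolySub hm).differentiable (by simp)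
  have hdi : ∀ i, Differentiable ℝ fun x => c x i := fun i =>
    (contDiff_of_polySub (hm i)).differentiable (by simp)
  have hz : ∀ i, Differentiable ℝ fun x : E3 => x i - a i := fun i => by fun_prop
  have hdr : Differentiable ℝ fun x => cross (c x) (x - a) := by
    rw [differentiable_euclidean]
    intro i
    fin_cases i
    · exact ((hdi 1).mul (hz 2)).sub ((hdi 2).mul (hz 1))
    · exact ((hdi 2).mul (hz 0)).sub ((hdi 0).mul (hz 2))
    · exact ((hdi 0).mul (hz 1)).sub ((hdi 1).mul (hz 0))
  have hp : ∀ (x : E3) (i j k : Fin 3), partialD i (fun x => c x j * (x k - a k)) x =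
      c x j * (if i = k then 1 else 0) + (x k - a k) * partialD i (fun x => c x j) x := by
    intro x i j k
    rw [partialD_mul (hdi j x) (hz k x), partialD_coord_sub]
  have hpp : ∀ (x : E3) (i j k l m : Fin 3),
      partialD i (fun x => c x j * (x k - a k) - c x l * (x m - a m)) x =
      (c x j * (if i = k then 1 else 0) + (x k - a k) * partialD i (fun x => c x j) x) -
      (c x l * (if i = m then 1 else 0) + (x m - a m) * partialD i (fun x => c x l) x) := by
    intro x i j k l m
    rw [partialD_sub ((hdi j x).fun_mul (hz k x)) ((hdi l x).fun_mul (hz m x)), hp, hp]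
  -- The divergence of the average is the `t²`-weighted average of the divergence of `u`.
  have hdivc : ∀ x, ∑ i, partialD i (fun x => c x i) x = 0 := by
    intro x
    have h1 : ∀ i, partialD i (fun x => c x i) x =
        ∫ t in (0 : ℝ)..1, t ^ 2 * partialD i (fun x => u x i) (a + t • (x - a)) :=
      fun i => partialD_coneAvg a (hu i) i x
    have hcp : ∀ i, Continuous (partialD i fun x => u x i) := fun i =>
      (contDiff_of_polySub (partialD_mem_polySub (hu i) i)).continuous
    simp only [h1]
    rw [← intervalIntegral.integral_finsetSum
      (fun i _ => ((by fun_prop : Continuous _).intervalIntegrable _ _))]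
    simp [← Finset.mul_sum, hdiv]
  ext x i
  have he := coneAvg_euler a (hu i) x
  have hcc : coneAvg a (fun x => u x i) = fun x => c x i := rfl
  rw [hcc, Fin.sum_univ_three] at he
  have hdc := hdivc x
  rw [Fin.sum_univ_three] at hdc
  have e0 : (fun y => cross (c y) (y - a) 0) =
    fun y => c y 1 * (y 2 - a 2) - c y 2 * (y 1 - a 1) := rfl
  have e1 : (fun y => cross (c y) (y - a) 1) =
    fun y => c y 2 * (y 0 - a 0) - c y 0 * (y 2 - a 2) := rfl
  have e2 : (fun y => cross (c y) (y - a) 2) =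
    fun y => c y 0 * (y 1 - a 1) - c y 1 * (y 0 - a 0) := rfl
  rw [curl]
  simp only [partialD_apply (hdr x), e0, e1, e2, hpp]
  fin_cases i
  · simp at he ⊢
    linear_combination he - (x 0 - a 0) * hdc
  · simp at he ⊢
    linear_combination he - (x 1 - a 1) * hdc
  · simp at he ⊢
    linear_combination he - (x 2 - a 2) * hdc

/-! ## Maps that are linear on a subset -/

section LinOn

variable {F G H : Type*} [AddCommGroup F] [Module ℝ F] [AddCommGroup G] [Module ℝ G]
  [AddCommGroup H] [Module ℝ H]

/-- `D` respects linear combinations of elements of `S`. -/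
def LinOn (S : Set F) (D : F → G) : Prop :=
  ∀ u ∈ S, ∀ v ∈ S, ∀ a b : ℝ, D (a • u + b • v) = a • D u + b • D v

lemma LinOn.comp {S : Set F} {S' : Set G} {D : F → G} {D' : G → H} (hD' : LinOn S' D')
    (hD : LinOn S D) (hm : ∀ u ∈ S, D u ∈ S') : LinOn S fun u => D' (D u) := by
  intro u hu v hv a b
  simp only
  rw [hD u hu v hv, hD' _ (hm u hu) _ (hm v hv)]

lemma LinOn.mono {S S' : Set F} {D : F → G} (h : LinOn S' D) (hS : S ⊆ S') : LinOn S D :=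
  fun u hu v hv => h u (hS hu) v (hS hv)

lemma LinOn.sum {ι : Type*} {S : Set F} {D : ι → F → G} (s : Finset ι) (h : ∀ i, LinOn S (D i)) :
    LinOn S fun u => ∑ i ∈ s, D i u := by
  intro u hu v hv a b
  simp only [h _ u hu v hv, Finset.sum_add_distrib, Finset.smul_sum]

lemma LinOn.add {S : Set F} {D D' : F → G} (h : LinOn S D) (h' : LinOn S D') :
    LinOn S fun u => D u + D' u := by
  intro u hu v hv a b
  simp only [h u hu v hv, h' u hu v hv, smul_add]; abel

lemma LinOn.sub {S : Set F} {D D' : F → G} (h : LinOn S D) (h' : LinOn S D') :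
    LinOn S fun u => D u - D' u := by
  intro u hu v hv a b
  simp only [h u hu v hv, h' u hu v hv, smul_sub]; abel

lemma LinOn.id {S : Set F} : LinOn S fun u : F => u := fun _ _ _ _ _ _ => rfl

lemma LinearMap.linOn (S : Set F) (D : F →ₗ[ℝ] G) : LinOn S D := by
  intro u _ v _ a b; simp

lemma LinOn.map_zero {S : Submodule ℝ F} {D : F → G} (h : LinOn (S : Set F) D) : D 0 = 0 := by
  simpa using h 0 S.zero_mem 0 S.zero_mem 0 0

lemma LinOn.map_sub {S : Set F} {D : F → G} (h : LinOn S D) {u v : F} (hu : u ∈ S) (hv : v ∈ S) :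
    D (u - v) = D u - D v := by
  have := h u hu v hv 1 (-1)
  simpa [sub_eq_add_neg] using this

/-- The differential operators are linear only on differentiable functions, so the targets of the
projections, given as images, have to be recognised as subspaces. -/
lemma LinOn.exists_image {V : Submodule ℝ F} [FiniteDimensional ℝ V] {D : F → G}
    (h : LinOn (V : Set F) D) :
    ∃ N : Submodule ℝ G, (N : Set G) = D '' V ∧ FiniteDimensional ℝ N := by
  let L : V →ₗ[ℝ] G :=
    { toFun := fun u => D u
      map_add' := fun u v => by simpa using h u u.2 v v.2 1 1
      map_smul' := fun c u => by simpa using h u u.2 u u.2 c 0 }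
  refine ⟨LinearMap.range L, ?_, inferInstance⟩
  ext x
  simp [L, LinearMap.mem_range]

end LinOn

lemma theUnique_eq {F : Type*} [Zero F] {P : F → Prop} {q : F} (hq : P q)
    (h : ∀ q', P q' → q' = q) : theUnique P = q := by
  have hu : ∃! q, P q := ⟨q, hq, h⟩
  rw [theUnique, dif_pos hu]
  exact h _ hu.choose_spec.1

/-- The default value 0 lies in every subspace, so liftings and extensions stay in theirs for
arbitrary data, without any existence proof. -/
lemma theUnique_mem_or {F : Type*} [Zero F] (P : F → Prop) : P (theUnique P) ∨ theUnique P = 0 := by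
  by_cases hu : ∃! q, P q
  · left; rw [theUnique, dif_pos hu]; exact hu.choose_spec.1
  · right; rw [theUnique, dif_neg hu]

/-! ## Orthogonal projections -/

section OrthProj

variable {F : Type*} [AddCommGroup F] [Module ℝ F]

/-- `B` is bilinear and nondegenerate enough to project elements of `M` orthogonally to `S`. -/
structure IsInnerOn (B : F → F → ℝ) (M S : Submodule ℝ F) : Prop where
  le : S ≤ M
  left : ∀ w ∈ S, LinOn (M : Set F) fun u => B u w
  right : ∀ u ∈ M, LinOn (S : Set F) fun w => B u w
  definite : ∀ q ∈ S, B q q = 0 → q = 0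

variable {B : F → F → ℝ} {M S : Submodule ℝ F}

/-- A definite bilinear form represents every functional. -/
lemma IsInnerOn.exists_repr [FiniteDimensional ℝ S] (h : IsInnerOn B M S) {f : F → ℝ}
    (hf : LinOn (S : Set F) f) : ∃ q ∈ S, ∀ s ∈ S, B q s = f s := by
  let L : S →ₗ[ℝ] Module.Dual ℝ S :=
    { toFun := fun q =>
        { toFun := fun s => B q s
          map_add' := fun s t => by simpa using h.right q (h.le q.2) s s.2 t t.2 1 1
          map_smul' := fun c s => by simpa using h.right q (h.le q.2) s s.2 s s.2 c 0 }
      map_add' := fun q r => by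
        ext s; simpa using h.left s s.2 q (h.le q.2) r (h.le r.2) 1 1
      map_smul' := fun c q => by
        ext s; simpa using h.left s s.2 q (h.le q.2) q (h.le q.2) c 0 }
  have hinj : Function.Injective L := by
    rw [← LinearMap.ker_eq_bot, LinearMap.ker_eq_bot']
    intro q hq
    exact Subtype.ext (h.definite q q.2 (LinearMap.congr_fun hq q))
  -- Definiteness makes `L` injective (test `q` with itself); equal finite dimensions make it onto.
  -- Symmetry of the form plays no role, which matters for the bubble forms below.
  have hsurj : Function.Surjective L :=
    (LinearMap.injective_iff_surjective_of_finrank_eq_finrank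
      (Subspace.dual_finrank_eq (K := ℝ) (V := S)).symm).1 hinj
  let f' : Module.Dual ℝ S :=
    { toFun := fun s => f s
      map_add' := fun s t => by simpa using hf s s.2 t t.2 1 1
      map_smul' := fun c s => by simpa using hf s s.2 s s.2 c 0 }
  obtain ⟨q, hq⟩ := hsurj f'
  exact ⟨q, q.2, fun s hs => LinearMap.congr_fun hq ⟨s, hs⟩⟩

/-- Two candidates differ by an element of `S` orthogonal to `S`, in particular to itself. This
justifies the unique choice in `orthProj`. -/
lemma IsInnerOn.orthProj_eq (h : IsInnerOn B M S) {u q : F} (hu : u ∈ M) (hq : q ∈ S)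
    (ho : ∀ s ∈ S, B (u - q) s = 0) : orthProj B (S : Set F) u = q := by
  refine theUnique_eq ⟨hq, ho⟩ ?_
  rintro r ⟨hr, hr'⟩
  rw [← sub_eq_zero]
  have hS := S.sub_mem hr hq
  refine h.definite _ hS ?_
  have h1 := LinOn.map_sub (h.left _ hS) (M.sub_mem hu (h.le hq)) (M.sub_mem hu (h.le hr))
  rw [show u - q - (u - r) = r - q by abel] at h1
  rw [h1, ho _ hS, hr' _ hS, sub_zero]

lemma IsInnerOn.orthProj_spec [FiniteDimensional ℝ S] (h : IsInnerOn B M S) {u : F} (hu : u ∈ M) :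
    orthProj B (S : Set F) u ∈ S ∧ ∀ s ∈ S, B (u - orthProj B (S : Set F) u) s = 0 := by
  obtain ⟨q, hq, hqs⟩ := h.exists_repr (h.right u hu)
  have ho : ∀ s ∈ S, B (u - q) s = 0 := fun s hs => by
    rw [LinOn.map_sub (h.left s hs) hu (h.le hq), hqs s hs, sub_self]
  rw [h.orthProj_eq hu hq ho]
  exact ⟨hq, ho⟩

lemma IsInnerOn.orthProj_self [FiniteDimensional ℝ S] (h : IsInnerOn B M S) {u : F} (hu : u ∈ S) :
    orthProj B (S : Set F) u = u :=
  h.orthProj_eq (h.le hu) hu fun s hs => by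
    rw [sub_self]; exact (h.left s hs).map_zero

lemma IsInnerOn.orthProj_eq_zero (h : IsInnerOn B M S) {u : F} (hu : u ∈ M)
    (ho : ∀ s ∈ S, B u s = 0) : orthProj B (S : Set F) u = 0 :=
  h.orthProj_eq hu S.zero_mem fun s hs => by rw [sub_zero, ho s hs]

lemma IsInnerOn.orthProj_linOn [FiniteDimensional ℝ S] (h : IsInnerOn B M S) :
    LinOn (M : Set F) (orthProj B (S : Set F)) := by
  intro u hu v hv a b
  obtain ⟨h1, h1'⟩ := h.orthProj_spec hu
  obtain ⟨h2, h2'⟩ := h.orthProj_spec hv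
  refine h.orthProj_eq (M.add_mem (M.smul_mem a hu) (M.smul_mem b hv))
    (S.add_mem (S.smul_mem a h1) (S.smul_mem b h2)) fun s hs => ?_
  have h3 := h.left s hs _ (M.sub_mem hu (h.le h1)) _ (M.sub_mem hv (h.le h2)) a b
  simp only at h3
  rw [show a • u + b • v - (a • orthProj B (S : Set F) u + b • orthProj B (S : Set F) v) =
    a • (u - orthProj B (S : Set F) u) + b • (v - orthProj B (S : Set F) v) by module, h3,
    h1' s hs, h2' s hs]
  simp

end OrthProj

/-! ## The inner product of the negative order Sobolev space -/

section Sobolev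

variable {V : Type*} [NormedAddCommGroup V] [InnerProductSpace ℝ V] [MeasureSpace V]

lemma toSobolevDual_apply (s : ℝ) (D : Set V) {F : V → ℝ}
    (hF : MemLp F 2 ((volume : Measure V).restrict D)) (z : SobolevH0 s D) :
    toSobolevDual s D F z = inner ℝ (hF.toLp F) (z : SobolevAmbient D).fst := by
  rw [toSobolevDual, dif_pos hF]
  rfl

lemma toSobolevDual_linOn (s : ℝ) (D : Set V) :
    LinOn {F : V → ℝ | MemLp F 2 ((volume : Measure V).restrict D)} (toSobolevDual s D) := by
  intro F hF G hG a b
  ext z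
  have h : MemLp (a • F + b • G) 2 ((volume : Measure V).restrict D) :=
    (hF.const_smul a).add (hG.const_smul b)
  have h1 : h.toLp _ = a • hF.toLp F + b • hG.toLp G := rfl
  have hz : (a • toSobolevDual s D F + b • toSobolevDual s D G) z =
    a * toSobolevDual s D F z + b * toSobolevDual s D G z := rfl
  rw [hz, toSobolevDual_apply s D h, toSobolevDual_apply s D hF, toSobolevDual_apply s D hG, h1,
    inner_add_left, inner_smul_left, inner_smul_left]
  simp

lemma inner_toDual_symm_linear {H : Type*} [NormedAddCommGroup H] [InnerProductSpace ℝ H]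
    [CompleteSpace H] (f g h : StrongDual ℝ H) (a b : ℝ) :
    inner ℝ ((InnerProductSpace.toDual ℝ H).symm (a • f + b • g))
      ((InnerProductSpace.toDual ℝ H).symm h) =
    a * inner ℝ ((InnerProductSpace.toDual ℝ H).symm f) ((InnerProductSpace.toDual ℝ H).symm h) +
    b * inner ℝ ((InnerProductSpace.toDual ℝ H).symm g) ((InnerProductSpace.toDual ℝ H).symm h) := by
  simp only [InnerProductSpace.toDual_symm_apply, add_apply, smul_apply, smul_eq_mul]

lemma eq_zero_of_inner_toDual_symm {H : Type*} [NormedAddCommGroup H] [InnerProductSpace ℝ H]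
    [CompleteSpace H] (f : StrongDual ℝ H)
    (h : inner ℝ ((InnerProductSpace.toDual ℝ H).symm f)
      ((InnerProductSpace.toDual ℝ H).symm f) = 0) : f = 0 := by
  simpa using h

lemma negInner_linOn_left (s : ℝ) (D : Set V) (G : V → ℝ) :
    LinOn {F : V → ℝ | MemLp F 2 ((volume : Measure V).restrict D)} fun F => negInner s D F G := by
  intro F hF F' hF' a b
  simp only [negInner]
  rw [toSobolevDual_linOn s D F hF F' hF']
  exact inner_toDual_symm_linear _ _ _ a b

lemma negInner_comm (s : ℝ) (D : Set V) (F G : V → ℝ) : negInner s D F G = negInner s D G F :=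
  real_inner_comm _ _

lemma negInner_linOn_right (s : ℝ) (D : Set V) (F : V → ℝ) :
    LinOn {G : V → ℝ | MemLp G 2 ((volume : Measure V).restrict D)} fun G => negInner s D F G := by
  simp only [negInner_comm s D F]
  exact negInner_linOn_left s D F

lemma negInner_self_nonneg (s : ℝ) (D : Set V) (F : V → ℝ) : 0 ≤ negInner s D F F :=
  real_inner_self_nonneg

lemma negInner_eq_zero_of_ae (s : ℝ) (D : Set V) {F G : V → ℝ}
    (hF : F =ᵐ[(volume : Measure V).restrict D] 0) : negInner s D F G = 0 := by
  have hm : MemLp F 2 ((volume : Measure V).restrict D) := MemLp.ae_eq hF.symm MemLp.zero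
  have h : toSobolevDual s D F = 0 := by
    ext z
    have h1 : hm.toLp F = 0 := by
      rw [MemLp.toLp_eq_toLp_iff hm MemLp.zero |>.2 hF]; rfl
    rw [toSobolevDual_apply s D hm, h1, inner_zero_left]; rfl
  have h0 := inner_toDual_symm_linear 0 0 (toSobolevDual s D G) 0 0
  rw [negInner, h]
  simpa only [zero_mul, add_zero, smul_zero] using h0

variable [FiniteDimensional ℝ V] [BorelSpace V] [(volume : Measure V).IsAddHaarMeasure]

lemma integrable_diff_rpow {a : ℝ} (ha : a < Module.finrank ℝ V) (hn : 1 ≤ Module.finrank ℝ V)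
    {D : Set V} (hD : MeasurableSet D) (hb : Bornology.IsBounded D) :
    Integrable (fun q : V × V => ‖q.1 - q.2‖ ^ (-a))
      (((volume : Measure V).restrict D).prod ((volume : Measure V).restrict D)) := by
  obtain ⟨R, hR⟩ := hb.subset_ball 0
  -- Differences of points of `D` stay in this ball, so the kernel on `D × D` is the integrand of
  -- the convolution of the indicator of `D` with an integrable function.
  set g : V → ℝ := (Metric.ball (0 : V) (2 * R)).indicator fun z => ‖z‖ ^ (-a)
  have hg : Integrable g := by
    rw [integrable_indicator_iff Metric.isOpen_ball.measurableSet]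
    refine integrableOn_ball_of_norm_le_rpow (C := 1) (α := a) hn ha ?_ ?_
    · exact Filter.Eventually.of_forall fun x => by
        rw [Real.norm_of_nonneg (by positivity)]; simp
    · exact ((measurable_norm.pow_const _).aestronglyMeasurable)
  have hf : Integrable (D.indicator fun _ : V => (1 : ℝ)) := by
    rw [integrable_indicator_iff hD]
    exact integrableOn_const hb.measure_lt_top.ne
  have h := hf.convolution_integrand (ContinuousLinearMap.mul ℝ ℝ) hg
  rw [Measure.prod_restrict]
  have h2 : Integrable (fun q : V × V => (D.indicator (fun _ : V => (1 : ℝ)) q.2) * g (q.1 - q.2))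
    ((volume : Measure V).prod volume) := h
  refine (h2.integrableOn (s := D ×ˢ D)).congr ?_
  filter_upwards [ae_restrict_mem (hD.prod hD)] with q hq
  have h3 : q.1 - q.2 ∈ Metric.ball (0 : V) (2 * R) := by
    have h4 := hR hq.1
    have h5 := hR hq.2
    rw [mem_ball_zero_iff] at *
    linarith [norm_sub_le q.1 q.2]
  simp [g, indicator_of_mem hq.2, indicator_of_mem h3]

/-- Test functions define elements of `H₀ˢ(D)`. -/
lemma exists_mem_sobolevH0 {s : ℝ} (hs : s < 1) (hn : 1 ≤ Module.finrank ℝ V)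
    {D : Set V} (hD : MeasurableSet D) (hb : Bornology.IsBounded D) {φ : V → ℝ}
    (h1 : ContDiff ℝ ∞ φ) (h2 : HasCompactSupport φ) (h3 : tsupport φ ⊆ interior D) :
    ∃ z : SobolevH0 s D, ((z : SobolevAmbient D).fst : V → ℝ)
      =ᵐ[(volume : Measure V).restrict D] φ := by
  have hfin : IsFiniteMeasure ((volume : Measure V).restrict D) :=
    ⟨by rw [Measure.restrict_apply_univ]; exact hb.measure_lt_top⟩
  have hφ : MemLp φ 2 ((volume : Measure V).restrict D) :=
    (h1.continuous.memLp_of_hasCompactSupport h2).restrict D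
  obtain ⟨C, hC⟩ := ContDiff.lipschitzWith_of_hasCompactSupport h2 h1 (by simp)
  set n : ℝ := (Module.finrank ℝ V : ℝ) with hnd
  set Q : V × V → ℝ := fun q => (φ q.1 - φ q.2) / ‖q.1 - q.2‖ ^ (n / 2 + s)
  have hQm : AEStronglyMeasurable Q
      (((volume : Measure V).restrict D).prod ((volume : Measure V).restrict D)) := by
    have hc := h1.continuous
    have e1 : Measurable fun q : V × V => φ q.1 - φ q.2 := (by fun_prop : Continuous _).measurable
    have e2 : Measurable fun q : V × V => ‖q.1 - q.2‖ := (by fun_prop : Continuous _).measurable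
    exact (e1.div (e2.pow_const _)).aestronglyMeasurable
  have hQ : MemLp Q 2
      (((volume : Measure V).restrict D).prod ((volume : Measure V).restrict D)) := by
    rw [memLp_two_iff_integrable_sq hQm]
    -- The Lipschitz bound gains two powers of the distance against the weight `n + 2 s`; the
    -- remaining singularity is below the dimension exactly because `s < 1`.
    refine ((integrable_diff_rpow (a := n + 2 * s - 2) (by linarith) hn hD hb).const_mul
      ((C : ℝ) ^ 2)).mono' (hQm.pow 2) (Filter.Eventually.of_forall fun q => ?_)
    rw [Real.norm_of_nonneg (by positivity)]
    have hL : |φ q.1 - φ q.2| ≤ C * ‖q.1 - q.2‖ := by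
      have := hC.dist_le_mul q.1 q.2
      rwa [Real.dist_eq, dist_eq_norm] at this
    rcases eq_or_ne q.1 q.2 with he | hne
    · simp only [Q, he, sub_self, zero_div, ne_eq, OfNat.ofNat_ne_zero, not_false_eq_true, zero_pow]
      positivity
    · have hp : 0 < ‖q.1 - q.2‖ := norm_pos_iff.2 (sub_ne_zero.2 hne)
      simp only [Q]
      rw [div_pow, div_le_iff₀ (by positivity), ← Real.rpow_natCast (_ ^ _) 2,
        ← Real.rpow_mul hp.le, mul_assoc, ← Real.rpow_add hp]
      have : -(n + 2 * s - 2) + (n / 2 + s) * ((2 : ℕ) : ℝ) = ((2 : ℕ) : ℝ) := by push_cast; ring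
      rw [this, Real.rpow_natCast, ← mul_pow, ← sq_abs]
      gcongr
  refine ⟨⟨WithLp.toLp 2 (hφ.toLp φ, hQ.toLp Q), ?_⟩, hφ.coeFn_toLp⟩
  refine Submodule.le_topologicalClosure _ (Submodule.subset_span ?_)
  exact ⟨φ, h1, h2, h3, hφ.coeFn_toLp, hQ.coeFn_toLp⟩

/-- A function of zero dual norm annihilates all test functions, hence vanishes almost everywhere
inside `D`, and everywhere there by continuity. For polynomials this makes the negative norms
definite. -/
lemma eqOn_zero_of_negInner_self {s : ℝ} (hs : s < 1) (hn : 1 ≤ Module.finrank ℝ V)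
    {D : Set V} (hD : MeasurableSet D) (hb : Bornology.IsBounded D) {F : V → ℝ}
    (hF : Continuous F) (hm : MemLp F 2 ((volume : Measure V).restrict D))
    (h0 : negInner s D F F = 0) : ∀ x ∈ interior D, F x = 0 := by
  have h1 : toSobolevDual s D F = 0 := eq_zero_of_inner_toDual_symm _ h0
  have h2 : ∀ᵐ x ∂(volume : Measure V), x ∈ interior D → F x = 0 := by
    refine isOpen_interior.ae_eq_zero_of_integral_contDiff_smul_eq_zero
      (hF.locallyIntegrable.locallyIntegrableOn _) fun φ e1 e2 e3 => ?_
    obtain ⟨z, hz⟩ := exists_mem_sobolevH0 hs hn hD hb e1 e2 e3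
    have h3 := toSobolevDual_apply s D hm z
    rw [h1, L2.inner_def] at h3
    have h4 : ∫ x in D, φ x • F x = 0 := by
      refine Eq.trans ?_ h3.symm
      refine integral_congr_ae ?_
      filter_upwards [hm.coeFn_toLp, hz] with x hx hx'
      rw [hx, hx']
      simp [mul_comm]
    rw [← h4]
    symm
    refine setIntegral_eq_integral_of_forall_compl_eq_zero fun x hx => ?_
    have : φ x = 0 := by
      by_contra hne
      exact hx (interior_subset (e3 (subset_tsupport φ hne)))
    simp [this]
  have h3 : F =ᵐ[(volume : Measure V).restrict (interior D)] fun _ => 0 := by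
    rw [Filter.EventuallyEq, ae_restrict_iff' isOpen_interior.measurableSet]
    exact h2
  exact Measure.eqOn_open_of_ae_eq h3 isOpen_interior hF.continuousOn continuousOn_const

end Sobolev

lemma memLp_of_continuous {V : Type*} [NormedAddCommGroup V] [InnerProductSpace ℝ V]
    [MeasureSpace V] [BorelSpace V] [FiniteDimensional ℝ V]
    [(volume : Measure V).IsAddHaarMeasure] {D : Set V}
    (hD : IsCompact D) {F : V → ℝ} (hF : Continuous F) :
    MemLp F 2 ((volume : Measure V).restrict D) := by
  have hfin : IsFiniteMeasure ((volume : Measure V).restrict D) :=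
    ⟨by rw [Measure.restrict_apply_univ]; exact hD.measure_lt_top⟩
  obtain ⟨C, hC⟩ := hD.exists_bound_of_continuousOn hF.continuousOn
  refine MemLp.of_bound hF.aestronglyMeasurable C ?_
  filter_upwards [ae_restrict_mem hD.measurableSet] with x hx using hC x hx

/-- A nonnegative continuous function with vanishing integral vanishes. -/
lemma eqOn_zero_of_setIntegral {V : Type*} [NormedAddCommGroup V] [InnerProductSpace ℝ V]
    [MeasureSpace V] [BorelSpace V] [FiniteDimensional ℝ V]
    [(volume : Measure V).IsAddHaarMeasure] {D : Set V}
    (hD : IsCompact D) {F : V → ℝ} (hF : Continuous F) (h0 : ∀ x ∈ D, 0 ≤ F x)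
    (hi : ∫ x in D, F x = 0) : ∀ x ∈ interior D, F x = 0 := by
  have h1 := (setIntegral_eq_zero_iff_of_nonneg_ae
    ((ae_restrict_iff' hD.measurableSet).2 (Filter.Eventually.of_forall h0))
    (hF.continuousOn.integrableOn_compact hD)).1 hi
  have h2 := ae_restrict_of_ae_restrict_of_subset interior_subset h1
  exact Measure.eqOn_open_of_ae_eq h2 isOpen_interior hF.continuousOn continuousOn_const

/-! ## Geometry of the tetrahedron -/

lemma cross_cross_right (a b c : E3) : cross a (cross b c) = inner ℝ a c • b - inner ℝ a b • c := by
  ext i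
  fin_cases i <;> simp [cross_eq, inner_E3] <;> ring

lemma cross_inner_cyclic (a b c : E3) : inner ℝ (cross a b) c = inner ℝ a (cross b c) := by
  simp [cross_eq, inner_E3]; ring

lemma cross_self_inner (a b : E3) : inner ℝ (cross a b) b = 0 := by
  simp [cross_eq, inner_E3]; ring

lemma cross_self_inner_left (a b : E3) : inner ℝ (cross a b) a = 0 := by
  simp [cross_eq, inner_E3]; ring

lemma cross_inner_cross (a b c d : E3) : inner ℝ (cross a b) (cross c d) =
    inner ℝ a c * inner ℝ b d - inner ℝ a d * inner ℝ b c := by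
  simp [cross_eq, inner_E3]; ring

variable (T : Tetrahedron)

/-- The (constant) gradient of a barycentric coordinate. -/
def glam (i : Fin 4) : E3 := gradient (lam T i) 0

lemma hasFDerivAt_lam (i : Fin 4) (x : E3) :
    HasFDerivAt (lam T i) (((baryBasis T).coord i).linear.toContinuousLinearMap) x := by
  have h : lam T i = fun x => ((baryBasis T).coord i).linear.toContinuousLinearMap x +
      (baryBasis T).coord i 0 := by
    ext x
    exact congrFun (AffineMap.decomp ((baryBasis T).coord i)) x
  rw [h]
  exact (ContinuousLinearMap.hasFDerivAt _).add_const _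

lemma gradient_lam (i : Fin 4) (x : E3) : gradient (lam T i) x = glam T i := by
  rw [glam, gradient, gradient, (hasFDerivAt_lam T i x).fderiv, (hasFDerivAt_lam T i 0).fderiv]

lemma lam_sub (i : Fin 4) (x y : E3) : lam T i x - lam T i y = inner ℝ (glam T i) (x - y) := by
  rw [glam, inner_gradient, (hasFDerivAt_lam T i 0).fderiv]
  have := ((baryBasis T).coord i).linearMap_vsub x y
  simp only [vsub_eq_sub] at this
  exact this.symm

/-- Brings barycentric coordinates into the form in which the divisibility lemmas are stated. -/
lemma lam_eq (i : Fin 4) (x : E3) : lam T i x = lam T i 0 + inner ℝ (glam T i) x := by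
  have := lam_sub T i x 0
  rw [sub_zero] at this
  linarith

lemma lam_mem_polySub {d : ℤ} (hd : 1 ≤ d) (i : Fin 4) : lam T i ∈ polySub 3 d := by
  rw [show lam T i = fun x => lam T i 0 + inner ℝ (glam T i) x from funext (lam_eq T i)]
  exact affine_mem_polySub hd _ _

lemma continuous_lam (i : Fin 4) : Continuous (lam T i) :=
  (contDiff_of_polySub (lam_mem_polySub T le_rfl i)).continuous

lemma lam_vertex (i j : Fin 4) : lam T i (T.points j) = if i = j then 1 else 0 :=
  (baryBasis T).coord_apply i j

lemma sum_lam (x : E3) : ∑ i, lam T i x = 1 := (baryBasis T).sum_coord_apply_eq_one x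

lemma sum_lam_smul (x : E3) : ∑ i, lam T i x • T.points i = x :=
  (baryBasis T).linear_combination_coord_eq_self x

lemma inner_glam_vertices (i j k : Fin 4) : inner ℝ (glam T i) (T.points j - T.points k) =
    (if i = j then 1 else 0) - if i = k then 1 else 0 := by
  rw [← lam_sub, lam_vertex, lam_vertex]

lemma sum_glam : ∑ i, glam T i = 0 := by
  refine ext_inner_right ℝ fun v => ?_
  rw [sum_inner, inner_zero_left]
  have h1 : ∀ i, inner ℝ (glam T i) v = lam T i v - lam T i 0 := fun i => by
    rw [lam_sub, sub_zero]
  simp only [h1, Finset.sum_sub_distrib, sum_lam, sub_self]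

lemma sum_inner_glam_smul (v : E3) : ∑ i, inner ℝ (glam T i) v • T.points i = v := by
  have h1 : ∀ i, inner ℝ (glam T i) v = lam T i v - lam T i 0 := fun i => by
    rw [lam_sub, sub_zero]
  simp only [h1, sub_smul, Finset.sum_sub_distrib, sum_lam_smul, sub_zero]

lemma eq_zero_of_inner_glam {v : E3} (h : ∀ i, inner ℝ (glam T i) v = 0) : v = 0 := by
  rw [← sum_inner_glam_smul T v]; simp [h]

lemma glam_ne_zero (i : Fin 4) : glam T i ≠ 0 := by
  intro h
  obtain ⟨j, hj⟩ : ∃ j, i ≠ j := ⟨i + 1, by fin_cases i <;> simp⟩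
  have := inner_glam_vertices T i i j
  simp [h, hj] at this

lemma mem_cell {x : E3} : x ∈ cell T ↔ ∀ i, 0 ≤ lam T i x := by
  have := (baryBasis T).convexHull_eq_nonneg_coord
  have h2 : cell T = {x | ∀ i, 0 ≤ (baryBasis T).coord i x} := this
  rw [h2]; rfl

lemma isCompact_cell : IsCompact (cell T) := (finite_range _).isCompact_convexHull (𝕜 := ℝ)

/-- The open tetrahedron. -/
def openCell : Set E3 := {x | ∀ i, 0 < lam T i x}

lemma isOpen_openCell : IsOpen (openCell T) := by
  simp only [openCell, ofPred_forall]
  exact isOpen_iInter_of_finite fun i => isOpen_lt continuous_const (continuous_lam T i)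

lemma openCell_subset : openCell T ⊆ interior (cell T) :=
  interior_maximal (fun _ hx => (mem_cell T).2 fun i => (hx i).le) (isOpen_openCell T)

lemma lam_sum_vertices {ι : Type*} (s : Finset ι) (w : ι → ℝ) (v : ι → Fin 4)
    (hw : ∑ j ∈ s, w j = 1) (i : Fin 4) :
    lam T i (∑ j ∈ s, w j • T.points (v j)) = ∑ j ∈ s, w j * lam T i (T.points (v j)) := by
  have h : ∀ j, lam T i (T.points (v j)) = lam T i 0 + inner ℝ (glam T i) (T.points (v j)) :=
    fun j => lam_eq T i _
  rw [lam_eq T i (∑ j ∈ s, w j • T.points (v j))]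
  simp only [h, mul_add, Finset.sum_add_distrib, ← Finset.sum_mul, hw, one_mul, inner_sum,
    inner_smul_right]

lemma openCell_nonempty : (openCell T).Nonempty := by
  refine ⟨∑ j, (1 / 4 : ℝ) • T.points j, fun i => ?_⟩
  have h := lam_sum_vertices T Finset.univ (fun _ => 1 / 4) id (by simp) i
  simp only [id] at h
  rw [h]
  simp [lam_vertex]

lemma mem_face {k : Fin 4} {x : E3} : x ∈ face T k ↔ lam T k x = 0 ∧ ∀ i, 0 ≤ lam T i x := by
  constructor
  · intro hx
    have hsub : face T k ⊆ cell T := convexHull_mono (image_subset_range _ _)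
    refine ⟨?_, (mem_cell T).1 (hsub hx)⟩
    have hc : Convex ℝ {x | lam T k x = 0} := by
      intro y hy z hz a b _ _ hab
      simp only [mem_ofPred_eq] at *
      rw [lam_eq] at hy hz ⊢
      rw [inner_add_right, inner_smul_right, inner_smul_right]
      linear_combination a * hy + b * hz + (lam T k 0) * (1 - hab) - lam T k 0 * 1 + lam T k 0 * 0
    refine convexHull_min ?_ hc hx
    rintro _ ⟨j, hj, rfl⟩
    have : k ≠ j := fun h => hj h.symm
    simp [lam_vertex, this]
  · rintro ⟨h0, h⟩
    rw [← sum_lam_smul T x]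
    have h1 : ∑ i, lam T i x • T.points i = ∑ i ∈ Finset.univ.erase k, lam T i x • T.points i := by
      rw [← Finset.add_sum_erase _ _ (Finset.mem_univ k), h0, zero_smul, zero_add]
    have h2 : ∑ i ∈ Finset.univ.erase k, lam T i x = 1 := by
      rw [← sum_lam T x, ← Finset.add_sum_erase Finset.univ _ (Finset.mem_univ k), h0, zero_add]
    rw [h1]
    refine (convex_convexHull ℝ _).sum_mem (fun i _ => h i) h2 fun i hi => ?_
    exact subset_convexHull ℝ _ ⟨i, by simpa using (Finset.mem_erase.1 hi).1, rfl⟩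

/-! ### The frame of a face -/

lemma points_ne {i j : Fin 4} (h : i ≠ j) : T.points i ≠ T.points j :=
  fun h' => h (T.independent.injective h')

lemma normal_eq (k : Fin 4) : normal T k = -(‖glam T k‖⁻¹ • glam T k) := rfl

lemma inner_normal_self (k : Fin 4) : inner ℝ (normal T k) (normal T k) = 1 := by
  have := glam_ne_zero T k
  have h : ‖glam T k‖ ≠ 0 := by simpa using this
  rw [normal_eq, inner_neg_neg, inner_smul_left, inner_smul_right, real_inner_self_eq_norm_sq]
  simp; field_simp

lemma inner_normal_eq_zero {k : Fin 4} {v : E3} (h : inner ℝ (glam T k) v = 0) :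
    inner ℝ v (normal T k) = 0 := by
  rw [normal_eq, inner_neg_right, inner_smul_right, real_inner_comm, h]; simp

lemma inner_glam_eq_zero {k : Fin 4} {v : E3} (h : inner ℝ v (normal T k) = 0) :
    inner ℝ (glam T k) v = 0 := by
  have := glam_ne_zero T k
  rw [normal_eq, inner_neg_right, inner_smul_right, real_inner_comm] at h
  simpa [this] using h

lemma faceTan_zero (k : Fin 4) : faceTan T k 0 =
    ‖T.points (k.succAbove 1) - T.points (k.succAbove 0)‖⁻¹ •
    (T.points (k.succAbove 1) - T.points (k.succAbove 0)) := rfl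

lemma faceTan_one (k : Fin 4) : faceTan T k 1 = cross (normal T k) (faceTan T k 0) := rfl

lemma inner_tan_zero_self (k : Fin 4) : inner ℝ (faceTan T k 0) (faceTan T k 0) = 1 := by
  have h : T.points (k.succAbove 1) - T.points (k.succAbove 0) ≠ 0 :=
    sub_ne_zero.2 (points_ne T (fun h => by simpa using Fin.succAbove_right_injective h))
  have h : ‖T.points (k.succAbove 1) - T.points (k.succAbove 0)‖ ≠ 0 := by simpa using h
  rw [faceTan_zero, inner_smul_left, inner_smul_right, real_inner_self_eq_norm_sq]
  simp; field_simp

lemma inner_tan_zero_normal (k : Fin 4) : inner ℝ (faceTan T k 0) (normal T k) = 0 := by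
  apply inner_normal_eq_zero
  rw [faceTan_zero, inner_smul_right, inner_glam_vertices]
  simp [(Fin.succAbove_ne k _).symm]

lemma inner_tan_one_normal (k : Fin 4) : inner ℝ (faceTan T k 1) (normal T k) = 0 :=
  cross_self_inner_left _ _

lemma inner_tan_zero_one (k : Fin 4) : inner ℝ (faceTan T k 0) (faceTan T k 1) = 0 := by
  rw [real_inner_comm]; exact cross_self_inner _ _

lemma inner_tan_one_self (k : Fin 4) : inner ℝ (faceTan T k 1) (faceTan T k 1) = 1 := by
  rw [faceTan_one, cross_inner_cross, inner_normal_self, inner_tan_zero_self, real_inner_comm,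
    inner_tan_zero_normal]; simp

lemma cross_tan (k : Fin 4) : cross (faceTan T k 0) (faceTan T k 1) = normal T k := by
  rw [faceTan_one, cross_cross_right, inner_tan_zero_self, inner_tan_zero_normal]; simp

lemma frame_expand (k : Fin 4) (v : E3) : v = inner ℝ v (faceTan T k 0) • faceTan T k 0 +
    inner ℝ v (faceTan T k 1) • faceTan T k 1 + inner ℝ v (normal T k) • normal T k := by
  have ho : Orthonormal ℝ ![faceTan T k 0, faceTan T k 1, normal T k] := by
    rw [orthonormal_iff_ite]
    have h1 := inner_tan_zero_self T k
    have h2 := inner_tan_one_self T k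
    have h3 := inner_normal_self T k
    have h4 := inner_tan_zero_one T k
    have h5 := inner_tan_zero_normal T k
    have h6 := inner_tan_one_normal T k
    have h4' := (real_inner_comm (faceTan T k 0) (faceTan T k 1)).trans h4
    have h5' := (real_inner_comm (faceTan T k 0) (normal T k)).trans h5
    have h6' := (real_inner_comm (faceTan T k 1) (normal T k)).trans h6
    intro i j
    fin_cases i <;> fin_cases j <;> simp only [Fin.zero_eta, Fin.mk_one, Fin.reduceFinMk,
      Matrix.cons_val, h1, h2, h3, h4, h5, h6, h4', h5', h6'] <;> simp
  let b := (basisOfOrthonormalOfCardEqFinrank ho (by simp)).toOrthonormalBasis (by simpa using ho)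
  have hb := b.sum_repr' v
  rw [Fin.sum_univ_three] at hb
  simp only [b, Module.Basis.coe_toOrthonormalBasis, coe_basisOfOrthonormalOfCardEqFinrank] at hb
  simp only [Matrix.cons_val, real_inner_comm v] at hb
  exact hb.symm

lemma lam_faceOrg (k : Fin 4) : lam T k (faceOrg T k) = 0 := by
  rw [faceOrg, lam_vertex, if_neg (Fin.succAbove_ne k 0).symm]

lemma faceMap_sub_org (k : Fin 4) (y : E2) :
    faceMap T k y - faceOrg T k = y 0 • faceTan T k 0 + y 1 • faceTan T k 1 := by
  rw [faceMap]; abel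

lemma inner_faceMap_normal (k : Fin 4) (y : E2) :
    inner ℝ (faceMap T k y - faceOrg T k) (normal T k) = 0 := by
  rw [faceMap_sub_org, inner_add_left, inner_smul_left, inner_smul_left, inner_tan_zero_normal,
    inner_tan_one_normal]; simp

lemma lam_faceMap (k : Fin 4) (y : E2) : lam T k (faceMap T k y) = 0 := by
  have h := lam_sub T k (faceMap T k y) (faceOrg T k)
  rwa [inner_glam_eq_zero T (inner_faceMap_normal T k y), lam_faceOrg, sub_zero] at h

lemma faceCoord_faceMap (k : Fin 4) (y : E2) : faceCoord T k (faceMap T k y) = y := by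
  rw [faceCoord, faceMap_sub_org, faceComp]
  have h4' := (real_inner_comm (faceTan T k 0) (faceTan T k 1)).trans (inner_tan_zero_one T k)
  rw [inner_add_left, inner_add_left, inner_smul_left, inner_smul_left, inner_smul_left,
    inner_smul_left, inner_tan_zero_self, inner_tan_one_self, inner_tan_zero_one, h4']
  ext i
  fin_cases i <;> simp

lemma faceMap_faceCoord {k : Fin 4} {x : E3} (hx : lam T k x = 0) :
    faceMap T k (faceCoord T k x) = x := by
  have h : inner ℝ (x - faceOrg T k) (normal T k) = 0 := by
    apply inner_normal_eq_zero
    rw [← lam_sub, hx, lam_faceOrg, sub_zero]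
  have h2 := frame_expand T k (x - faceOrg T k)
  rw [h, zero_smul, add_zero] at h2
  rw [faceMap, faceCoord, faceComp]
  simp only [Matrix.cons_val]
  rw [add_assoc, ← h2]
  abel

lemma continuous_faceMap (k : Fin 4) : Continuous (faceMap T k) := by
  unfold faceMap; fun_prop

lemma contDiff_faceMap (k : Fin 4) : ContDiff ℝ ∞ (faceMap T k) := by
  unfold faceMap; fun_prop

lemma continuous_faceCoord (k : Fin 4) : Continuous (faceCoord T k) := by
  have : faceCoord T k = fun x => WithLp.toLp 2 ![inner ℝ (x - faceOrg T k) (faceTan T k 0),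
    inner ℝ (x - faceOrg T k) (faceTan T k 1)] := rfl
  rw [this]
  refine (PiLp.continuous_toLp 2 _).comp (continuous_pi fun i => ?_)
  fin_cases i <;> simp <;> fun_prop

lemma mem_faceDom {k : Fin 4} {y : E2} : y ∈ faceDom T k ↔ ∀ i, 0 ≤ lam T i (faceMap T k y) := by
  rw [faceDom, mem_preimage, mem_face]
  simp [lam_faceMap]

/-- The domain is defined as a preimage; compactness is seen from its description as the image of
the face under the inverse chart. -/
lemma isCompact_faceDom (k : Fin 4) : IsCompact (faceDom T k) := by
  have h : faceDom T k = faceCoord T k '' face T k := by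
    ext y
    constructor
    · intro hy
      exact ⟨_, hy, faceCoord_faceMap T k y⟩
    · rintro ⟨x, hx, rfl⟩
      rw [faceDom, mem_preimage, faceMap_faceCoord T ((mem_face T).1 hx).1]
      exact hx
  rw [h]
  exact (((finite_univ.subset (subset_univ {k}ᶜ)).image _).isCompact_convexHull (𝕜 := ℝ)).image
    (continuous_faceCoord T k)

/-- The open triangle. -/
def openFace (k : Fin 4) : Set E2 := {y | ∀ i, i ≠ k → 0 < lam T i (faceMap T k y)}

lemma isOpen_openFace (k : Fin 4) : IsOpen (openFace T k) := by
  simp only [openFace, ofPred_forall]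
  exact isOpen_iInter_of_finite fun i => isOpen_iInter_of_finite fun _ =>
    isOpen_lt continuous_const ((continuous_lam T i).comp (continuous_faceMap T k))

lemma openFace_subset (k : Fin 4) : openFace T k ⊆ interior (faceDom T k) :=
  interior_maximal (fun y hy => (mem_faceDom T).2 fun i => by
    by_cases h : i = k
    · rw [h, lam_faceMap]
    · exact (hy i h).le) (isOpen_openFace T k)

lemma openFace_nonempty (k : Fin 4) : (openFace T k).Nonempty := by
  set x : E3 := ∑ j : Fin 3, (1 / 3 : ℝ) • T.points (k.succAbove j) with hx
  have hl : ∀ i, lam T i x = ∑ j : Fin 3, (1 / 3 : ℝ) * lam T i (T.points (k.succAbove j)) :=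
    fun i => lam_sum_vertices T Finset.univ (fun _ => 1 / 3) k.succAbove (by simp) i
  have hk : lam T k x = 0 := by
    rw [hl]
    simp [lam_vertex, (Fin.succAbove_ne k _).symm]
  refine ⟨faceCoord T k x, fun i hi => ?_⟩
  rw [faceMap_faceCoord T hk, hl]
  obtain ⟨j, rfl⟩ := Fin.exists_succAbove_eq hi
  simp [lam_vertex]

/-! ### Edges -/

lemma edgeLen_pos (e : Edge) : 0 < edgeLen T e :=
  norm_pos_iff.2 (sub_ne_zero.2 (points_ne T e.2.ne'))

lemma edgeLen_smul_tan (e : Edge) :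
    edgeLen T e • edgeTan T e = T.points e.1.2 - T.points e.1.1 := by
  rw [edgeTan, smul_smul, mul_inv_cancel₀ (edgeLen_pos T e).ne', one_smul]

lemma edgeMap_zero (e : Edge) : edgeMap T e 0 = T.points e.1.1 := by simp [edgeMap]

lemma edgeMap_len (e : Edge) : edgeMap T e (edgeLen T e) = T.points e.1.2 := by
  simp [edgeMap, edgeLen_smul_tan]

lemma edgeMap_eq (e : Edge) (s : ℝ) : edgeMap T e s =
    (1 - s / edgeLen T e) • T.points e.1.1 + (s / edgeLen T e) • T.points e.1.2 := by
  rw [edgeMap, edgeTan, smul_smul, div_eq_mul_inv]; module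

lemma edgeMap_mem_edge {e : Edge} {s : ℝ} (hs : s ∈ edgeDom T e) : edgeMap T e s ∈ edge T e := by
  have h := edgeLen_pos T e
  rw [edgeMap_eq, edge]
  refine ⟨1 - s / edgeLen T e, s / edgeLen T e, ?_, ?_, by ring, rfl⟩
  · rw [sub_nonneg, div_le_one h]; exact hs.2
  · exact div_nonneg hs.1 h.le

lemma exists_of_mem_edge {e : Edge} {x : E3} (hx : x ∈ edge T e) :
    ∃ s ∈ edgeDom T e, edgeMap T e s = x := by
  obtain ⟨a, b, ha, hb, hab, rfl⟩ := hx
  have h := edgeLen_pos T e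
  refine ⟨b * edgeLen T e, ⟨by positivity, by nlinarith⟩, ?_⟩
  rw [edgeMap_eq, mul_div_cancel_right₀ _ h.ne', ← hab, add_sub_cancel_right]

lemma infinite_edgeDom (e : Edge) : (edgeDom T e).Infinite := Icc_infinite (edgeLen_pos T e)

lemma inner_glam_edgeTan {e : Edge} {k : Fin 4} (h : EdgeOf e k) :
    inner ℝ (glam T k) (edgeTan T e) = 0 := by
  rw [edgeTan, inner_smul_right, inner_glam_vertices, if_neg h.1.symm, if_neg h.2.symm]; simp

lemma lam_edgeMap {e : Edge} {k : Fin 4} (h : EdgeOf e k) (s : ℝ) :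
    lam T k (edgeMap T e s) = 0 := by
  have h1 := lam_sub T k (edgeMap T e s) (T.points e.1.1)
  rw [lam_vertex, if_neg h.1.symm, edgeMap, add_sub_cancel_left, inner_smul_right,
    inner_glam_edgeTan T h] at h1
  rw [edgeMap]; simpa using h1

lemma inner_edgeTan_normal {e : Edge} {k : Fin 4} (h : EdgeOf e k) :
    inner ℝ (edgeTan T e) (normal T k) = 0 :=
  inner_normal_eq_zero T (inner_glam_edgeTan T h)

lemma faceMap_faceCoord_edgeMap {e : Edge} {k : Fin 4} (h : EdgeOf e k) (s : ℝ) :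
    faceMap T k (faceCoord T k (edgeMap T e s)) = edgeMap T e s :=
  faceMap_faceCoord T (lam_edgeMap T h s)

lemma faceComp_add (k : Fin 4) (v w : E3) :
    faceComp T k (v + w) = faceComp T k v + faceComp T k w := by
  ext i; fin_cases i <;> simp [faceComp, inner_add_left]

lemma faceComp_smul (k : Fin 4) (c : ℝ) (v : E3) :
    faceComp T k (c • v) = c • faceComp T k v := by
  ext i; fin_cases i <;> simp [faceComp, inner_smul_left]

lemma faceCoord_edgeMap (k : Fin 4) (e : Edge) (s : ℝ) : faceCoord T k (edgeMap T e s) =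
    faceCoord T k (T.points e.1.1) + s • faceComp T k (edgeTan T e) := by
  rw [faceCoord, faceCoord, edgeMap, ← faceComp_smul, ← faceComp_add]
  congr 1; abel

lemma faceComp_cross_normal (k : Fin 4) (v : E3) : faceComp T k (cross v (normal T k)) =
    !₂[inner ℝ v (faceTan T k 1), -inner ℝ v (faceTan T k 0)] := by
  have h1 : inner ℝ (cross v (normal T k)) (faceTan T k 0) = inner ℝ v (faceTan T k 1) := by
    rw [cross_inner_cyclic]; rfl
  have h2 : inner ℝ (cross v (normal T k)) (faceTan T k 1) = -inner ℝ v (faceTan T k 0) := by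
    rw [faceTan_one, cross_inner_cross, inner_normal_self, real_inner_comm (faceTan T k 0),
      inner_tan_zero_normal]; simp
  rw [faceComp, h1, h2]

lemma faceTrace_eq (k : Fin 4) (u : E3 → E3) (y : E2) : faceTrace T k u y =
    !₂[inner ℝ (u (faceMap T k y)) (faceTan T k 1), -inner ℝ (u (faceMap T k y)) (faceTan T k 0)] :=
  faceComp_cross_normal T k _

/-- Crossing with the unit normal drops the normal part and turns the tangential part by a right
angle, an isometry of the plane. One tangential factor suffices. -/
lemma inner_rot {k : Fin 4} {v t : E3} (h : inner ℝ t (normal T k) = 0) :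
    inner ℝ (faceComp T k (cross v (normal T k))) (faceComp T k (cross t (normal T k))) =
      inner ℝ v t := by
  rw [faceComp_cross_normal, faceComp_cross_normal]
  conv_rhs => rw [frame_expand T k t, h]
  simp [inner_E2, inner_add_right, inner_smul_right]; ring

/-- Both `u` and the edge tangent are turned by the same right angle. This translates the normal
boundary condition of `W10F` into vanishing edge traces. -/
lemma inner_faceTrace_edgeNormal {e : Edge} {k : Fin 4} (h : EdgeOf e k) (u : E3 → E3) (s : ℝ) :
    inner ℝ (faceTrace T k u (faceCoord T k (edgeMap T e s))) (edgeNormal T e k) =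
      edgeTrace T e u s := by
  rw [faceTrace, edgeNormal, inner_rot T (inner_edgeTan_normal T h),
    faceMap_faceCoord_edgeMap T h, edgeTrace]

/-! ## The edge element space -/

lemma cross_add_left (a b c : E3) : cross (a + b) c = cross a c + cross b c := by
  simp [cross]

lemma cross_smul_left (r : ℝ) (a c : E3) : cross (r • a) c = r • cross a c := by
  simp [cross]

lemma cross_add_right (a b c : E3) : cross a (b + c) = cross a b + cross a c := by
  simp [cross]

lemma cross_sub_right (a b c : E3) : cross a (b - c) = cross a b - cross a c := by
  simp [cross]

lemma cross_smul_right (r : ℝ) (a c : E3) : cross a (r • c) = r • cross a c := by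
  simp [cross]

/-- `W1 p` as a submodule. -/
def w1Sub (p : ℕ) : Submodule ℝ (E3 → E3) where
  carrier := W1 p
  zero_mem' := ⟨0, mem_vpolySub.1 (Submodule.zero_mem _), 0,
    mem_vpolySub.1 (Submodule.zero_mem _), fun x => by simp [cross]⟩
  add_mem' := by
    rintro u v ⟨a, ha, b, hb, h⟩ ⟨a', ha', b', hb', h'⟩
    simp only [← mem_vpolySub] at *
    refine ⟨a + a', mem_vpolySub.1 (add_mem ha ha'), b + b', mem_vpolySub.1 (add_mem hb hb'),
      fun x => ?_⟩
    simp only [Pi.add_apply, h, h', cross_add_left]; module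
  smul_mem' := by
    rintro r u ⟨a, ha, b, hb, h⟩
    simp only [← mem_vpolySub] at *
    refine ⟨r • a, mem_vpolySub.1 (Submodule.smul_mem _ r ha), r • b,
      mem_vpolySub.1 (Submodule.smul_mem _ r hb), fun x => ?_⟩
    simp only [Pi.smul_apply, h, cross_smul_left, smul_add]

lemma mem_w1Sub {p : ℕ} {v : E3 → E3} : v ∈ w1Sub p ↔ ∃ a ∈ vpolySub 3 p, ∃ b ∈ vpolySub 3 p,
    ∀ x, v x = a x + cross (b x) x := by
  simp only [mem_vpolySub]; rfl

lemma cross_mem_vpolySub {d e k : ℤ} {b c : E3 → E3} (hb : b ∈ vpolySub 3 d)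
    (hc : c ∈ vpolySub 3 e) (h : d + e ≤ k) : (fun x => cross (b x) (c x)) ∈ vpolySub 3 k := by
  intro i
  fin_cases i
  · exact sub_mem (mul_mem_polySub' (hb 1) (hc 2) h) (mul_mem_polySub' (hb 2) (hc 1) h)
  · exact sub_mem (mul_mem_polySub' (hb 2) (hc 0) h) (mul_mem_polySub' (hb 0) (hc 2) h)
  · exact sub_mem (mul_mem_polySub' (hb 0) (hc 1) h) (mul_mem_polySub' (hb 1) (hc 0) h)

lemma cross_const_mem_vpolySub {d : ℤ} {b : E3 → E3} (hb : b ∈ vpolySub 3 d) (w : E3) :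
    (fun x => cross (b x) w) ∈ vpolySub 3 d :=
  cross_mem_vpolySub hb (const_mem_vpolySub le_rfl w) (by simp)

lemma id_mem_vpolySub {n : ℕ} : (fun x => x) ∈ vpolySub n 1 := fun i => coord_mem_polySub le_rfl i

lemma w1Sub_le (p : ℕ) : w1Sub p ≤ vpolySub 3 (p + 1) := by
  intro v hv
  obtain ⟨a, ha, b, hb, h⟩ := mem_w1Sub.1 hv
  rw [show v = a + fun x => cross (b x) x from funext h]
  exact add_mem (vpolySub_mono (by simp) ha) (cross_mem_vpolySub hb id_mem_vpolySub le_rfl)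

lemma vpolySub_le_w1Sub (p : ℕ) : vpolySub 3 p ≤ w1Sub p := fun v hv =>
  mem_w1Sub.2 ⟨v, hv, 0, Submodule.zero_mem _, fun x => by simp [cross]⟩

instance (p : ℕ) : FiniteDimensional ℝ (w1Sub p) := Submodule.finiteDimensional_of_le (w1Sub_le p)

lemma contDiff_of_w1Sub {p : ℕ} {v : E3 → E3} (hv : v ∈ w1Sub p) : ContDiff ℝ ∞ v :=
  contDiff_of_vpolySub (w1Sub_le p hv)

/-- Moving the base point changes the cross term only by a field of degree `p`, so the space does
not depend on the origin. -/
lemma cross_sub_mem_w1Sub {p : ℕ} {b : E3 → E3} (hb : b ∈ vpolySub 3 p) (a : E3) :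
    (fun x => cross (b x) (x - a)) ∈ w1Sub p := by
  refine mem_w1Sub.2 ⟨fun x => -cross (b x) a, ?_, b, hb, fun x => ?_⟩
  · exact neg_mem (cross_const_mem_vpolySub hb a)
  · rw [cross_sub_right]; module

lemma gradient_mem_w1Sub {p : ℕ} {f : E3 → ℝ} (hf : f ∈ polySub 3 (p + 1)) :
    gradient f ∈ w1Sub p := vpolySub_le_w1Sub p (gradient_mem_vpolySub hf)

/-- The degree is one less than for a general field of degree `p + 1`, since `b × x` is orthogonal
to `x`. This gain is what the interior unisolvence argument lives on. -/
lemma inner_sub_mem_polySub {p : ℕ} {v : E3 → E3} (hv : v ∈ w1Sub p) (a : E3) :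
    (fun x => inner ℝ (v x) (x - a)) ∈ polySub 3 (p + 1) := by
  obtain ⟨α, hα, b, hb, h⟩ := mem_w1Sub.1 hv
  have h1 : (fun x => inner ℝ (v x) (x - a)) = (fun x => α x 0 * x 0) + (fun x => α x 1 * x 1) +
      (fun x => α x 2 * x 2) - (fun x => inner ℝ (α x) a) - fun x => inner ℝ (cross (b x) a) (-x) := by
    ext x
    simp [h, inner_E3, cross_eq]; ring
  have h2 : (fun x => inner ℝ (cross (b x) a) (-x)) = -((fun x => (cross (b x) a) 0 * x 0) +
      (fun x => (cross (b x) a) 1 * x 1) + (fun x => (cross (b x) a) 2 * x 2)) := by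
    ext x
    simp [inner_E3]
  have hx : ∀ i, (fun x : E3 => x i) ∈ polySub 3 1 := fun i => coord_mem_polySub le_rfl i
  have hc := cross_const_mem_vpolySub hb a
  rw [h1, h2]
  refine sub_mem (sub_mem (add_mem (add_mem ?_ ?_) ?_) ?_) (neg_mem (add_mem (add_mem ?_ ?_) ?_))
  · exact mul_mem_polySub' (hα 0) (hx 0) le_rfl
  · exact mul_mem_polySub' (hα 1) (hx 1) le_rfl
  · exact mul_mem_polySub' (hα 2) (hx 2) le_rfl
  · exact polySub_mono (by simp) (inner_mem_polySub hα a)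
  · exact mul_mem_polySub' (hc 0) (hx 0) le_rfl
  · exact mul_mem_polySub' (hc 1) (hx 1) le_rfl
  · exact mul_mem_polySub' (hc 2) (hx 2) le_rfl

variable (T : Tetrahedron)

/-- Polynomial multiples of Whitney forms. -/
lemma smul_whitney_mem_w1Sub {p : ℕ} {f : E3 → ℝ} (hf : f ∈ polySub 3 p) (i j : Fin 4) :
    (fun x => f x • (lam T i x • glam T j - lam T j x • glam T i)) ∈ w1Sub p := by
  refine mem_w1Sub.2 ⟨fun x => f x • (lam T i 0 • glam T j - lam T j 0 • glam T i),
    smul_const_mem_vpolySub hf _, fun x => f x • cross (glam T i) (glam T j),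
    smul_const_mem_vpolySub hf _, fun x => ?_⟩
  -- The linear part of a Whitney form is the rotation field of `∇λ_i × ∇λ_j`.
  have h : cross (cross (glam T i) (glam T j)) x =
      inner ℝ (glam T i) x • glam T j - inner ℝ (glam T j) x • glam T i := by
    ext l
    fin_cases l <;> simp [cross_eq, inner_E3] <;> ring
  rw [cross_smul_left, h, lam_eq T i x, lam_eq T j x]
  module

lemma whitney_eq (e : Edge) : whitney T e =
    fun x => lam T e.1.1 x • glam T e.1.2 - lam T e.1.2 x • glam T e.1.1 := by
  ext1 x; rw [whitney, gradient_lam, gradient_lam]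

lemma whitney_mem_w1Sub (p : ℕ) (e : Edge) : whitney T e ∈ w1Sub p := by
  have := smul_whitney_mem_w1Sub T (f := fun _ => 1) (p := p)
    (const_mem_polySub (by simp) 1) e.1.1 e.1.2
  rw [whitney_eq]; simpa using this

/-! ### Traces -/

lemma edgeTrace_linOn (e : Edge) : LinOn univ (edgeTrace T e) := by
  intro u _ v _ a b
  ext s
  simp [edgeTrace, inner_add_left, inner_smul_left]

lemma faceTrace_linOn (k : Fin 4) : LinOn univ (faceTrace T k) := by
  intro u _ v _ a b
  ext s i
  fin_cases i <;> simp [faceTrace_eq, inner_add_left, inner_smul_left]; ring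

lemma edgeTrace_add (e : Edge) (u v : E3 → E3) :
    edgeTrace T e (u + v) = edgeTrace T e u + edgeTrace T e v := by
  simpa using edgeTrace_linOn T e u trivial v trivial 1 1

lemma edgeTrace_sub (e : Edge) (u v : E3 → E3) :
    edgeTrace T e (u - v) = edgeTrace T e u - edgeTrace T e v :=
  (edgeTrace_linOn T e).map_sub trivial trivial

lemma edgeTrace_sum {ι : Type*} (s : Finset ι) (e : Edge) (u : ι → E3 → E3) :
    edgeTrace T e (∑ i ∈ s, u i) = ∑ i ∈ s, edgeTrace T e (u i) := by
  ext t; simp [edgeTrace, sum_inner]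

lemma faceTrace_zero (k : Fin 4) : faceTrace T k 0 = 0 := by
  ext y i
  fin_cases i <;> simp [faceTrace_eq]

lemma faceTrace_add (k : Fin 4) (u v : E3 → E3) :
    faceTrace T k (u + v) = faceTrace T k u + faceTrace T k v := by
  simpa using faceTrace_linOn T k u trivial v trivial 1 1

lemma faceTrace_sub (k : Fin 4) (u v : E3 → E3) :
    faceTrace T k (u - v) = faceTrace T k u - faceTrace T k v :=
  (faceTrace_linOn T k).map_sub trivial trivial

lemma faceTrace_sum {ι : Type*} (s : Finset ι) (k : Fin 4) (u : ι → E3 → E3) :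
    faceTrace T k (∑ i ∈ s, u i) = ∑ i ∈ s, faceTrace T k (u i) := by
  classical
  induction s using Finset.induction_on with
  | empty => simp [faceTrace_zero]
  | insert a s ha ih => rw [Finset.sum_insert ha, Finset.sum_insert ha, faceTrace_add, ih]

/-- Along an edge the variable part of `x` is parallel to the tangent, so it drops out of the cross
term and the degree stays at `p`. -/
lemma edgeTrace_mem {p : ℕ} {v : E3 → E3} (hv : v ∈ w1Sub p) (e : Edge) :
    edgeTrace T e v ∈ poly1Sub p := by
  obtain ⟨a, ha, b, hb, h⟩ := mem_w1Sub.1 hv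
  have h1 : edgeTrace T e v = fun s => (fun x => inner ℝ (a x) (edgeTan T e) +
      inner ℝ (cross (b x) (T.points e.1.1)) (edgeTan T e)) (T.points e.1.1 + s • edgeTan T e) := by
    ext s
    rw [edgeTrace, h, edgeMap, inner_add_left, cross_add_right, cross_smul_right, inner_add_left,
      inner_smul_left, cross_self_inner]
    simp
  rw [h1]
  exact line_mem_poly1Sub (add_mem (inner_mem_polySub ha _)
    (inner_mem_polySub (cross_const_mem_vpolySub hb _) _)) _ _

lemma faceMap_comp_mem {d : ℤ} {f : E3 → ℝ} (hf : f ∈ polySub 3 d) (k : Fin 4) :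
    (fun y => f (faceMap T k y)) ∈ polySub 2 d := by
  refine comp_mem_polySub hf fun i => ?_
  have : (fun y => faceMap T k y i) = (fun _ => faceOrg T k i) +
      faceTan T k 0 i • (fun y : E2 => y 0) + faceTan T k 1 i • fun y : E2 => y 1 := by
    ext y; simp [faceMap]; ring
  rw [this]
  exact add_mem (add_mem (const_mem_polySub (by simp) _)
    (Submodule.smul_mem _ _ (coord_mem_polySub le_rfl 0)))
    (Submodule.smul_mem _ _ (coord_mem_polySub le_rfl 1))

lemma faceCoord_comp_mem {d : ℤ} {f : E2 → ℝ} (hf : f ∈ polySub 2 d) (k : Fin 4) :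
    (fun x => f (faceCoord T k x)) ∈ polySub 3 d := by
  refine comp_mem_polySub hf fun i => ?_
  have h : ∀ w : E3, (fun x : E3 => inner ℝ (x - faceOrg T k) w) ∈ polySub 3 1 := by
    intro w
    convert affine_mem_polySub (n := 3) le_rfl (-inner ℝ (faceOrg T k) w) w using 2 with x
    rw [inner_sub_left, real_inner_comm x w]; ring
  fin_cases i
  · exact h (faceTan T k 0)
  · exact h (faceTan T k 1)

/-- The structure of tangential traces of edge element fields. -/
lemma faceTrace_form {p : ℕ} {v : E3 → E3} (hv : v ∈ w1Sub p) (k : Fin 4) :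
    ∃ α ∈ vpolySub 2 p, ∃ c ∈ polySub 2 p, ∀ y, faceTrace T k v y = α y + c y • y := by
  obtain ⟨a, ha, b, hb, h⟩ := mem_w1Sub.1 hv
  set f : E3 → E3 := fun x => a x + cross (b x) (faceOrg T k)
  have hf : f ∈ vpolySub 3 p := add_mem ha (cross_const_mem_vpolySub hb _)
  refine ⟨faceTrace T k f, ?_, fun y => inner ℝ (b (faceMap T k y)) (normal T k),
    faceMap_comp_mem T (inner_mem_polySub hb _) k, fun y => ?_⟩
  · intro i
    fin_cases i
    · simpa [faceTrace_eq] using faceMap_comp_mem T (inner_mem_polySub hf (faceTan T k 1)) k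
    · have := neg_mem (faceMap_comp_mem T (inner_mem_polySub hf (faceTan T k 0)) k)
      simp only [faceTrace_eq]
      exact this
  -- The origin of the face is absorbed in `f`. For the tangential part of `x`, only the normal
  -- component of `b` matters, and the trace turns it into a radial field: this is the
  -- Raviart-Thomas form.
  · have e1 : inner ℝ (cross (b (faceMap T k y)) (faceTan T k 0)) (faceTan T k 1) =
        inner ℝ (b (faceMap T k y)) (normal T k) := by rw [cross_inner_cyclic, cross_tan]
    have e2 : inner ℝ (cross (b (faceMap T k y)) (faceTan T k 1)) (faceTan T k 0) =
        -inner ℝ (b (faceMap T k y)) (normal T k) := by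
      rw [← cross_tan]; simp [cross_eq, inner_E3]; ring
    have e3 : v (faceMap T k y) = f (faceMap T k y) +
        y 0 • cross (b (faceMap T k y)) (faceTan T k 0) +
        y 1 • cross (b (faceMap T k y)) (faceTan T k 1) := by
      rw [h]
      simp only [f]
      rw [add_assoc (a _ + _), add_assoc (a _), ← cross_smul_right, ← cross_smul_right,
        ← cross_add_right, ← cross_add_right]
      congr 2
      rw [faceMap]; module
    rw [faceTrace_eq, faceTrace_eq, e3]
    simp only [inner_add_left, inner_smul_left, e1, e2, cross_self_inner]
    ext i
    fin_cases i <;> simp <;> ring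

lemma faceTrace_mem {p : ℕ} {v : E3 → E3} (hv : v ∈ w1Sub p) (k : Fin 4) :
    faceTrace T k v ∈ vpolySub 2 (p + 1) := by
  obtain ⟨α, hα, c, hc, h⟩ := faceTrace_form T hv k
  rw [show faceTrace T k v = α + fun y => c y • y from funext h]
  exact add_mem (vpolySub_mono (by simp) hα) (smul_mem_vpolySub hc id_mem_vpolySub le_rfl)

/-- Radial fields are tangential traces. -/
lemma exists_faceTrace_radial {p : ℕ} (k : Fin 4) {c : E2 → ℝ} (hc : c ∈ polySub 2 p) (a : E2) :
    ∃ v ∈ w1Sub p, faceTrace T k v = fun y => c y • (y - a) := by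
  -- Crossing with the normal from the left turns `x - a` by a right angle in the plane, and taking
  -- the trace turns it back.
  refine ⟨fun x => cross (c (faceCoord T k x) • normal T k) (x - faceMap T k a),
    cross_sub_mem_w1Sub (smul_const_mem_vpolySub (faceCoord_comp_mem T hc k) _) _, ?_⟩
  ext1 y
  have h1 : faceMap T k y - faceMap T k a =
      (y 0 - a 0) • faceTan T k 0 + (y 1 - a 1) • faceTan T k 1 := by
    rw [faceMap, faceMap]; module
  have e1 : inner ℝ (cross (normal T k) (faceTan T k 0)) (faceTan T k 1) = 1 := by
    rw [← faceTan_one, inner_tan_one_self]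
  have e2 : inner ℝ (cross (normal T k) (faceTan T k 1)) (faceTan T k 0) = -1 := by
    have : inner ℝ (cross (normal T k) (faceTan T k 1)) (faceTan T k 0) =
      -inner ℝ (cross (faceTan T k 0) (faceTan T k 1)) (normal T k) := by
      simp [cross_eq, inner_E3]; ring
    rw [this, cross_tan, inner_normal_self]
  rw [faceTrace_eq, faceCoord_faceMap, h1]
  simp only [cross_smul_left, cross_add_right, cross_smul_right, inner_add_left, inner_smul_left,
    e1, e2, cross_self_inner]
  ext i
  fin_cases i <;> simp <;> ring

/-! ### Derivatives of traces -/

lemma hasFDerivAt_faceMap (k : Fin 4) (y : E2) : HasFDerivAt (faceMap T k)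
    ((EuclideanSpace.proj 0 : E2 →L[ℝ] ℝ).smulRight (faceTan T k 0) +
      (EuclideanSpace.proj 1 : E2 →L[ℝ] ℝ).smulRight (faceTan T k 1)) y := by
  have h0 := (EuclideanSpace.proj 0 : E2 →L[ℝ] ℝ).hasFDerivAt (x := y) |>.smul_const (faceTan T k 0)
  have h1 := (EuclideanSpace.proj 1 : E2 →L[ℝ] ℝ).hasFDerivAt (x := y) |>.smul_const (faceTan T k 1)
  have h := (h0.const_add (faceOrg T k)).add h1
  exact h

lemma partialD_faceMap {F : Type*} [NormedAddCommGroup F] [NormedSpace ℝ F] {f : E3 → F}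
    (hf : Differentiable ℝ f) (k : Fin 4) (i : Fin 2) (y : E2) :
    partialD i (fun y => f (faceMap T k y)) y = fderiv ℝ f (faceMap T k y) (faceTan T k i) := by
  have h := ((hf (faceMap T k y)).hasFDerivAt.comp y (hasFDerivAt_faceMap T k y)).fderiv
  have h' : fderiv ℝ (fun y => f (faceMap T k y)) y = _ := h
  rw [partialD, h']
  fin_cases i <;> simp

lemma faceTrace_gradient {φ : E3 → ℝ} (hφ : Differentiable ℝ φ) (k : Fin 4) :
    faceTrace T k (gradient φ) = bcurl fun y => φ (faceMap T k y) := by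
  ext1 y
  rw [faceTrace_eq, bcurl, inner_gradient, inner_gradient, partialD_faceMap T hφ,
    partialD_faceMap T hφ]

lemma inner_fderiv_eq {u : E3 → E3} {x : E3} (hu : DifferentiableAt ℝ u x) (v w : E3) :
    inner ℝ (fderiv ℝ u x v) w = ∑ i, ∑ j, v i * w j * partialD i u x j := by
  rw [inner_E3]
  have h : ∀ j, fderiv ℝ u x v j = ∑ i, v i * partialD i u x j := by
    intro j
    have h1 := ((EuclideanSpace.proj j : E3 →L[ℝ] ℝ).hasFDerivAt.comp x hu.hasFDerivAt).fderiv
    have h2 : fderiv ℝ (fun y => u y j) x v = fderiv ℝ u x v j := by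
      have h' : fderiv ℝ (fun y => u y j) x = _ := h1
      rw [h']; simp
    rw [← h2, fderiv_apply_eq_sum]
    simp only [partialD_apply hu]
  simp only [h, Fin.sum_univ_three]; ring

/-- The two surface derivatives form the antisymmetric part of the Jacobian paired with `τ₁ × τ₂`.
This links the face stages to the curl stage. -/
lemma div2_faceTrace {u : E3 → E3} (hu : Differentiable ℝ u) (k : Fin 4) (y : E2) :
    div2 (faceTrace T k u) y = inner ℝ (curl u (faceMap T k y)) (normal T k) := by
  have hd : ∀ w : E3, Differentiable ℝ fun x => inner ℝ (u x) w := fun w =>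
    hu.inner ℝ (differentiable_const w)
  have hfm : Differentiable ℝ (faceMap T k) := (contDiff_faceMap T k).differentiable (by simp)
  have hft : Differentiable ℝ (faceTrace T k u) := by
    rw [differentiable_euclidean]
    intro i
    have h1 : ∀ w : E3, Differentiable ℝ fun y => inner ℝ (u (faceMap T k y)) w :=
      fun w => (hd w).comp hfm
    fin_cases i
    · simpa [faceTrace_eq] using h1 _
    · simpa [faceTrace_eq] using h1 _
  have hfd : ∀ w v x : E3, fderiv ℝ (fun x => inner ℝ (u x) w) x v = inner ℝ (fderiv ℝ u x v) w := by
    intro w v x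
    rw [fderiv_inner_apply ℝ (hu x) (differentiableAt_const w)]
    simp
  have e0 : (fun y => faceTrace T k u y 0) =
      fun y => (fun x => inner ℝ (u x) (faceTan T k 1)) (faceMap T k y) := by
    ext y; simp [faceTrace_eq]
  have e1 : (fun y => faceTrace T k u y 1) =
      fun y => (fun x => inner ℝ (u x) (-faceTan T k 0)) (faceMap T k y) := by
    ext y; simp [faceTrace_eq]
  rw [div2, partialD_apply (hft y), partialD_apply (hft y), e0, e1,
    partialD_faceMap T (hd _), partialD_faceMap T (hd _), hfd, hfd, inner_fderiv_eq (hu _),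
    inner_fderiv_eq (hu _), ← cross_tan, curl]
  simp only [Fin.sum_univ_three, inner_E3, cross_zero, cross_one, cross_two, Matrix.cons_val,
    PiLp.neg_apply]
  ring

lemma partialD_comm {n : ℕ} {f : EN n → ℝ} (hf : ContDiff ℝ ∞ f) (x : EN n) (i j : Fin n) :
    partialD i (partialD j f) x = partialD j (partialD i f) x := by
  have hd : Differentiable ℝ (fderiv ℝ f) :=
    (hf.fderiv_right (m := ∞) (by simp)).differentiable (by simp)
  have h : ∀ i j, partialD i (partialD j f) x =
      fderiv ℝ (fderiv ℝ f) x (EuclideanSpace.single i 1) (EuclideanSpace.single j 1) := by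
    intro i j
    have h1 : partialD j f = fun y => fderiv ℝ f y (EuclideanSpace.single j 1) := rfl
    rw [partialD, h1, fderiv_clm_apply (hd x) (differentiableAt_const _)]
    simp
  rw [h, h]
  exact (hf.contDiffAt.isSymmSndFDerivAt (by
    simp only [minSmoothness_of_isRCLikeNormedField]
    exact WithTop.coe_le_coe.2 (le_top : (2 : ℕ∞) ≤ ⊤))) _ _

lemma partialD_gradient {n : ℕ} {f : EN n → ℝ} (hf : ContDiff ℝ ∞ f) (x : EN n) (i j : Fin n) :
    partialD i (gradient f) x j = partialD i (partialD j f) x := by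
  rw [partialD_apply ((contDiff_gradient hf).differentiable (by simp) x)]
  simp only [gradient_apply]

lemma curl_gradient {f : E3 → ℝ} (hf : ContDiff ℝ ∞ f) : curl (gradient f) = 0 := by
  ext x i
  rw [curl]
  simp only [partialD_gradient hf]
  fin_cases i <;> simp [partialD_comm hf x 1 2, partialD_comm hf x 2 0, partialD_comm hf x 0 1]

lemma div2_faceTrace_gradient {f : E3 → ℝ} (hf : ContDiff ℝ ∞ f) (k : Fin 4) :
    div2 (faceTrace T k (gradient f)) = 0 := by
  ext y
  rw [div2_faceTrace T ((contDiff_gradient hf).differentiable (by simp)), curl_gradient hf]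
  simp

lemma hasDerivAt_edgeMap (e : Edge) (s : ℝ) : HasDerivAt (edgeMap T e) (edgeTan T e) s := by
  have := ((hasDerivAt_id s).smul_const (edgeTan T e)).const_add (T.points e.1.1)
  rw [one_smul] at this
  exact this

lemma hasDerivAt_comp_edgeMap {φ : E3 → ℝ} (hφ : Differentiable ℝ φ) (e : Edge) (s : ℝ) :
    HasDerivAt (fun s => φ (edgeMap T e s)) (edgeTrace T e (gradient φ) s) s := by
  rw [edgeTrace, inner_gradient]
  exact (hφ _).hasFDerivAt.comp_hasDerivAt s (hasDerivAt_edgeMap T e s)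

lemma deriv_comp_edgeMap {φ : E3 → ℝ} (hφ : Differentiable ℝ φ) (e : Edge) :
    (deriv fun s => φ (edgeMap T e s)) = edgeTrace T e (gradient φ) :=
  funext fun s => (hasDerivAt_comp_edgeMap T hφ e s).deriv

/-- Surface curl and edge normal arise from gradient and tangent by the same rotation, so their
product is the tangential derivative. -/
lemma hasDerivAt_comp_faceCoord {h : E2 → ℝ} (hh : Differentiable ℝ h) (k : Fin 4) (e : Edge)
    (s : ℝ) : HasDerivAt (fun s => h (faceCoord T k (edgeMap T e s)))
      (inner ℝ (bcurl h (faceCoord T k (edgeMap T e s))) (edgeNormal T e k)) s := by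
  have h1 : HasDerivAt (fun s => faceCoord T k (edgeMap T e s)) (faceComp T k (edgeTan T e)) s := by
    have := ((hasDerivAt_id s).smul_const (faceComp T k (edgeTan T e))).const_add
      (faceCoord T k (T.points e.1.1))
    simp only [faceCoord_edgeMap]
    simpa using this
  have h2 := (hh (faceCoord T k (edgeMap T e s))).hasFDerivAt.comp_hasDerivAt s h1
  refine h2.congr_deriv ?_
  rw [fderiv_apply_eq_sum, edgeNormal, faceComp_cross_normal]
  simp [bcurl, inner_E2, faceComp, Fin.sum_univ_two]; ring

/-! ### Potentials -/

/-- On rays from the origin the cross term is orthogonal to the direction, so the ray integral has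
degree `p + 1` although `v` itself may have that degree. -/
lemma exists_potential_of_curl {p : ℕ} {v : E3 → E3} (hv : v ∈ w1Sub p) (hc : curl v = 0) :
    ∃ φ ∈ polySub 3 (p + 1), gradient φ = v := by
  refine exists_potential (w1Sub_le p hv) (fun x i j => ?_) fun t => ?_
  · have h := congrFun hc x
    have h0 := congrArg (fun w : E3 => w 0) h
    have h1 := congrArg (fun w : E3 => w 1) h
    have h2 := congrArg (fun w : E3 => w 2) h
    simp [curl] at h0 h1 h2
    fin_cases i <;> fin_cases j <;> simp <;> linarith
  · obtain ⟨a, ha, b, hb, h⟩ := mem_w1Sub.1 hv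
    have hs : ∀ i, (fun x : E3 => (t • x) i) ∈ polySub 3 1 := fun i =>
      Submodule.smul_mem _ t (coord_mem_polySub le_rfl i)
    have h1 : (fun x => inner ℝ (v (t • x)) x) = (fun x => a (t • x) 0 * x 0) +
        (fun x => a (t • x) 1 * x 1) + fun x => a (t • x) 2 * x 2 := by
      ext x
      simp [h, inner_E3, cross_eq]; ring
    rw [h1]
    have hx : ∀ i, (fun x : E3 => x i) ∈ polySub 3 1 := fun i => coord_mem_polySub le_rfl i
    refine add_mem (add_mem ?_ ?_) ?_
    · exact mul_mem_polySub' (comp_mem_polySub (ha 0) hs) (hx 0) le_rfl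
    · exact mul_mem_polySub' (comp_mem_polySub (ha 1) hs) (hx 1) le_rfl
    · exact mul_mem_polySub' (comp_mem_polySub (ha 2) hs) (hx 2) le_rfl

/-- Divergence free fields of Raviart-Thomas type are curls. -/
lemma exists_potential_of_div {p : ℕ} {w α : E2 → E2} {c : E2 → ℝ} (hα : α ∈ vpolySub 2 p)
    (hc : c ∈ polySub 2 p) (hw : ∀ y, w y = α y + c y • y) (hd : div2 w = 0) :
    ∃ h ∈ polySub 2 (p + 1), bcurl h = w := by
  have hwm : w ∈ vpolySub 2 (p + 1) := by
    rw [show w = α + fun y => c y • y from funext hw]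
    exact add_mem (vpolySub_mono (by simp) hα) (smul_mem_vpolySub hc id_mem_vpolySub le_rfl)
  have hdw : Differentiable ℝ w := (contDiff_of_vpolySub hwm).differentiable (by simp)
  -- Rotation by a right angle turns a divergence-free field into a curl-free one, and `bcurl` into
  -- `gradient`.
  set u : E2 → E2 := fun y => !₂[-w y 1, w y 0] with hu
  have hum : u ∈ vpolySub 2 (p + 1) := by
    intro i
    fin_cases i
    · exact neg_mem (hwm 1)
    · exact hwm 0
  have hdu : Differentiable ℝ u := (contDiff_of_vpolySub hum).differentiable (by simp)
  have hu0 : ∀ i x, partialD i u x 0 = -partialD i w x 1 := by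
    intro i x
    rw [partialD_apply (hdu x), partialD_apply (hdw x)]
    simp [partialD, hu]
  have hu1 : ∀ i x, partialD i u x 1 = partialD i w x 0 := by
    intro i x
    rw [partialD_apply (hdu x), partialD_apply (hdw x)]
    simp [hu]
  obtain ⟨φ, hφ, hg⟩ := exists_potential (d := p + 1) hum (fun x i j => by
      have h := congrFun hd x
      simp [div2] at h
      fin_cases i <;> fin_cases j <;> simp [hu0, hu1] <;> linarith) fun t => by
      have hs : ∀ i, (fun x : E2 => (t • x) i) ∈ polySub 2 1 := fun i =>
        Submodule.smul_mem _ t (coord_mem_polySub le_rfl i)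
      -- The radial term, once rotated, is orthogonal to the ray and disappears; only `α`
      -- contributes, which keeps the degree at `p + 1`.
      have h1 : (fun x => inner ℝ (u (t • x)) x) = (fun x => α (t • x) 0 * x 1) -
          fun x => α (t • x) 1 * x 0 := by
        ext x
        simp [hu, hw, inner_E2]; ring
      rw [h1]
      exact sub_mem
        (mul_mem_polySub' (comp_mem_polySub (hα 0) hs) (coord_mem_polySub le_rfl 1) le_rfl)
        (mul_mem_polySub' (comp_mem_polySub (hα 1) hs) (coord_mem_polySub le_rfl 0) le_rfl)
  refine ⟨φ, hφ, ?_⟩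
  ext y i
  rw [bcurl, ← gradient_apply, ← gradient_apply, hg]
  fin_cases i <;> simp [hu]

lemma exists_potential_faceTrace {p : ℕ} {v : E3 → E3} (hv : v ∈ w1Sub p) {k : Fin 4}
    (hd : div2 (faceTrace T k v) = 0) : ∃ h ∈ polySub 2 (p + 1), bcurl h = faceTrace T k v := by
  obtain ⟨α, hα, c, hc, h⟩ := faceTrace_form T hv k
  exact exists_potential_of_div hα hc h hd

/-! ## Unisolvence -/

section Integrals

variable {n : ℕ} {D : Set (EN n)}

lemma integral_inner_linOn_left (hD : IsCompact D) {w : EN n → EN n} (hw : Continuous w) :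
    LinOn {q : EN n → EN n | Continuous q} fun q => ∫ x in D, inner ℝ (q x) (w x) := by
  intro u hu v hv a b
  simp only [mem_ofPred_eq] at hu hv
  have h1 : IntegrableOn (fun x => a * inner ℝ (u x) (w x)) D :=
    (by fun_prop : Continuous _).continuousOn.integrableOn_compact hD
  have h2 : IntegrableOn (fun x => b * inner ℝ (v x) (w x)) D :=
    (by fun_prop : Continuous _).continuousOn.integrableOn_compact hD
  have h3 : (fun x => inner ℝ ((a • u + b • v) x) (w x)) =
      fun x => a * inner ℝ (u x) (w x) + b * inner ℝ (v x) (w x) := by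
    ext x; simp [inner_add_left, inner_smul_left]
  simp only [h3]
  rw [integral_add h1 h2, integral_const_mul, integral_const_mul]; rfl

lemma integral_inner_linOn_right (hD : IsCompact D) {w : EN n → EN n} (hw : Continuous w) :
    LinOn {q : EN n → EN n | Continuous q} fun q => ∫ x in D, inner ℝ (w x) (q x) := by
  simp only [real_inner_comm _ (w _)]
  exact integral_inner_linOn_left hD hw

end Integrals

variable (T : Tetrahedron)

lemma sum_four {M : Type*} [AddCommMonoid M] (f : Fin 4 → M) {a b c d : Fin 4} (hab : a ≠ b)
    (hac : a ≠ c) (had : a ≠ d) (hbc : b ≠ c) (hbd : b ≠ d) (hcd : c ≠ d) :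
    ∑ i, f i = f a + f b + f c + f d := by
  have hu : (Finset.univ : Finset (Fin 4)) = {a, b, c, d} := by
    revert a b c d; decide
  rw [hu, Finset.sum_insert (by simp [*]), Finset.sum_insert (by simp [*]),
    Finset.sum_insert (by simp [*]), Finset.sum_singleton]
  simp only [add_assoc]

/-- Divisibility needs vanishing on whole lines and planes, so the parameter is an arbitrary real
number and the point may lie outside the edge segment. -/
lemma exists_edgeMap_eq {e : Edge} {k j : Fin 4} (hkj : k ≠ j) (hk : EdgeOf e k) (hj : EdgeOf e j)
    {x : E3} (h1 : lam T k x = 0) (h2 : lam T j x = 0) : ∃ s, edgeMap T e s = x := by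
  have hs := sum_four (fun i => lam T i x) hkj hk.1.symm hk.2.symm hj.1.symm hj.2.symm e.2.ne
  have hx := sum_four (fun i => lam T i x • T.points i) hkj hk.1.symm hk.2.symm hj.1.symm
    hj.2.symm e.2.ne
  rw [sum_lam, h1, h2] at hs
  rw [sum_lam_smul, h1, h2] at hx
  refine ⟨lam T e.1.2 x * edgeLen T e, ?_⟩
  have : lam T e.1.1 x = 1 - lam T e.1.2 x := by linarith
  refine Eq.trans ?_ hx.symm
  rw [edgeMap_eq, mul_div_cancel_right₀ _ (edgeLen_pos T e).ne', this]
  simp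

lemma exists_edge_of_ne {k j : Fin 4} (h : k ≠ j) : ∃ e : Edge, EdgeOf e k ∧ EdgeOf e j := by
  unfold EdgeOf; revert k j; decide

lemma exists_face_of_edge (e : Edge) (k : Fin 4) : ∃ j, j ≠ k ∧ EdgeOf e j := by
  unfold EdgeOf; revert e k; decide

lemma inner_faceComp {k : Fin 4} (g : E3) {t : E3} (ht : inner ℝ t (normal T k) = 0) :
    inner ℝ (faceComp T k g) (faceComp T k t) = inner ℝ g t := by
  conv_rhs => rw [frame_expand T k t, ht]
  simp [faceComp, inner_E2, inner_add_right, inner_smul_right]; ring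

lemma inner_edgeTan_self (e : Edge) : inner ℝ (edgeTan T e) (edgeTan T e) = 1 := by
  have h := edgeLen_pos T e
  rw [edgeTan, inner_smul_left, inner_smul_right, real_inner_self_eq_norm_sq]
  change _ * (_ * edgeLen T e ^ 2) = 1
  simp; field_simp

/-- On a face, the gradient of the barycentric coordinate opposite to an edge is parallel to the
edge normal. -/
lemma inner_faceComp_glam_eq_zero {e : Edge} {k j : Fin 4} (hk : EdgeOf e k) (hj : EdgeOf e j)
    {w : E2} (hw : inner ℝ w (edgeNormal T e k) = 0) :
    inner ℝ w (faceComp T k (glam T j)) = 0 := by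
  have ht := inner_edgeTan_normal T hk
  have h1 := inner_faceComp T (glam T j) ht
  rw [inner_glam_edgeTan T hj] at h1
  have h2 := inner_faceComp T (edgeTan T e) ht
  rw [inner_edgeTan_self] at h2
  set d := faceComp T k (glam T j)
  set τ := faceComp T k (edgeTan T e)
  have hN : edgeNormal T e k = !₂[τ 1, -τ 0] := by
    rw [edgeNormal, faceComp_cross_normal]; rfl
  rw [hN] at hw
  rw [inner_E2] at h1 h2 hw ⊢
  simp at hw
  -- Expansion of `w · d` in the orthonormal frame of `τ` and its rotation: one summand vanishes by
  -- `hw`, the other by `h1`.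
  linear_combination (d 0 * τ 1 - d 1 * τ 0) * hw + (w 0 * τ 0 + w 1 * τ 1) * h1 -
    (w 0 * d 0 + w 1 * d 1) * h2

lemma faceComp_glam_ne_zero {k j : Fin 4} (h : j ≠ k) : faceComp T k (glam T j) ≠ 0 := by
  obtain ⟨i, hik, hij⟩ : ∃ i, i ≠ k ∧ i ≠ j := by revert k j; decide
  intro h0
  have ht : inner ℝ (T.points j - T.points i) (normal T k) = 0 := by
    apply inner_normal_eq_zero
    rw [inner_glam_vertices, if_neg h.symm, if_neg hik.symm, sub_zero]
  have h1 := inner_faceComp T (glam T j) ht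
  rw [h0, inner_glam_vertices, if_pos rfl, if_neg hij.symm] at h1
  simp at h1

lemma lam_faceMap_eq (j k : Fin 4) (y : E2) : lam T j (faceMap T k y) =
    lam T j (faceOrg T k) + inner ℝ (faceComp T k (glam T j)) y := by
  have h := lam_sub T j (faceMap T k y) (faceOrg T k)
  rw [faceMap_sub_org] at h
  simp [faceComp, inner_E2, inner_add_right, inner_smul_right] at h ⊢
  linarith

lemma eq_zero_of_inner_faceComp_glam {k : Fin 4} {w : E2}
    (h : ∀ j, j ≠ k → inner ℝ w (faceComp T k (glam T j)) = 0) : w = 0 := by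
  set z : E3 := w 0 • faceTan T k 0 + w 1 • faceTan T k 1 with hz
  have hzn : inner ℝ z (normal T k) = 0 := by
    rw [hz, inner_add_left, inner_smul_left, inner_smul_left, inner_tan_zero_normal,
      inner_tan_one_normal]; simp
  have hzw : faceComp T k z = w := by
    have := faceCoord_faceMap T k w
    rwa [faceCoord, faceMap_sub_org] at this
  have hz0 : z = 0 := by
    refine eq_zero_of_inner_glam T fun j => ?_
    by_cases hj : j = k
    · rw [hj]; exact inner_glam_eq_zero T hzn
    · rw [← inner_faceComp T _ hzn, hzw, real_inner_comm]; exact h j hj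
  rw [← hzw, hz0]
  ext i; fin_cases i <;> simp [faceComp]

lemma sum_faceComp_glam (k : Fin 4) : ∑ j : Fin 3, faceComp T k (glam T (k.succAbove j)) = 0 := by
  have h1 := sum_glam T
  rw [Fin.sum_univ_succAbove _ k] at h1
  have h2 : ∑ j : Fin 3, faceComp T k (glam T (k.succAbove j)) =
      faceComp T k (∑ j : Fin 3, glam T (k.succAbove j)) := by
    simp only [Fin.sum_univ_three, faceComp_add]
  have h3 : ∑ j : Fin 3, glam T (k.succAbove j) = -glam T k := by
    rw [eq_neg_iff_add_eq_zero, add_comm]; exact h1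
  have hg : ∀ i, inner ℝ (glam T k) (faceTan T k i) = 0 := by
    intro i
    apply inner_glam_eq_zero
    fin_cases i
    · exact inner_tan_zero_normal T k
    · exact inner_tan_one_normal T k
  rw [h2, h3]
  ext i
  fin_cases i <;> simp [faceComp, hg]

/-- A tangential trace with vanishing edge traces is determined by its moments. -/
lemma faceTrace_eq_zero_of_dof {p : ℕ} {v : E3 → E3} (hv : v ∈ w1Sub p) {k : Fin 4}
    (he : ∀ e, EdgeOf e k → edgeTrace T e v = 0) (hd : DofZeroF T p k v) :
    faceTrace T k v = 0 := by
  obtain ⟨α, hα, c, hc, hw⟩ := faceTrace_form T hv k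
  have hwm := faceTrace_mem T hv k
  set w := faceTrace T k v with hwdef
  set d : Fin 3 → E2 := fun j => faceComp T k (glam T (k.succAbove j)) with hdd
  set m : Fin 3 → ℝ := fun j => lam T (k.succAbove j) (faceOrg T k) with hmd
  have hμ : ∀ j y, lam T (k.succAbove j) (faceMap T k y) = m j + inner ℝ (d j) y :=
    fun j y => lam_faceMap_eq T _ _ y
  have hd0 : ∀ j, d j ≠ 0 := fun j => faceComp_glam_ne_zero T (Fin.succAbove_ne k j)
  have hsd : ∑ j, d j = 0 := sum_faceComp_glam T k
  -- On the line of an edge, `d j` is parallel to the edge normal, and the normal component of the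
  -- trace is the edge trace, which vanishes.
  have hvan : ∀ j y, m j + inner ℝ (d j) y = 0 → inner ℝ (w y) (d j) = 0 := by
    intro j y hy
    rw [← hμ] at hy
    obtain ⟨e, hek, hej⟩ := exists_edge_of_ne (Fin.succAbove_ne k j).symm
    obtain ⟨s, hs⟩ := exists_edgeMap_eq T (Fin.succAbove_ne k j).symm hek hej (lam_faceMap T k y) hy
    refine inner_faceComp_glam_eq_zero T hek hej ?_
    have h1 := inner_faceTrace_edgeNormal T hek v s
    rw [he e hek, hs, faceCoord_faceMap] at h1
    exact h1
  choose ψ hψ hψw using fun j => exists_quotient (d := (p : ℤ)) (inner_mem_polySub hwm (d j)) (m j)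
    (hd0 j) (hvan j)
  -- The radial part of `w` contributes `c (d j · y)`, which equals `c` times the barycentric
  -- coordinate up to a constant multiple of `c`. Subtracting `c` from the quotient thus removes its
  -- leading part.
  have hψc : ∀ j, ψ j - c ∈ polySub 2 ((p : ℤ) - 1) := by
    intro j
    refine degree_of_affine_mul (c := m j) (hd0 j) (sub_mem (hψ j) hc) ?_
    have : (fun y => (m j + inner ℝ (d j) y) * (ψ j - c) y) =
        (fun y => inner ℝ (α y) (d j)) - m j • c := by
      ext y
      simp only [Pi.sub_apply, Pi.smul_apply, smul_eq_mul, mul_sub, ← hψw, hw, inner_add_left,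
        inner_smul_left, RCLike.conj_to_real, real_inner_comm (d j) y]
      ring
    rw [this, sub_add_cancel]
    exact sub_mem (inner_mem_polySub hα _) (Submodule.smul_mem _ _ hc)
  -- The admissible test field closest to `∑ ψ_j d_j`, whose degree would be too high. The
  -- subtracted multiple of `∑ d_j` is zero, so pairing with `w` still gives `∑ λ_j ψ_j²`.
  set q : E2 → E2 := fun y => ∑ j, (ψ j - c) y • d j with hq
  have hqm : q ∈ vpolySub 2 ((p : ℤ) - 1) := by
    have : q = ∑ j, fun y => (ψ j - c) y • d j := by ext1 y; simp [hq]
    rw [this]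
    exact Submodule.sum_mem _ fun j _ => smul_const_mem_vpolySub (hψc j) _
  have hqw : ∀ y, inner ℝ (q y) (w y) = ∑ j, (m j + inner ℝ (d j) y) * ψ j y ^ 2 := by
    intro y
    have h0 : ∑ j, (m j + inner ℝ (d j) y) * ψ j y = 0 := by
      simp only [← hψw]
      rw [← inner_sum, hsd, inner_zero_right]
    have h1 : inner ℝ (q y) (w y) = ∑ j, (ψ j y - c y) * ((m j + inner ℝ (d j) y) * ψ j y) := by
      rw [real_inner_comm, hq]
      simp only [inner_sum, inner_smul_right, ← hψw]
      rfl
    have h2 : ∑ j, (ψ j y - c y) * ((m j + inner ℝ (d j) y) * ψ j y) =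
      ∑ j, (m j + inner ℝ (d j) y) * ψ j y ^ 2 - c y * ∑ j, (m j + inner ℝ (d j) y) * ψ j y := by
      rw [Finset.mul_sum, ← Finset.sum_sub_distrib]
      exact Finset.sum_congr rfl fun j _ => by ring
    rw [h1, h2, h0, mul_zero, sub_zero]
  have hint := hd q (mem_vpolySub.1 hqm)
  rw [← hwdef] at hint
  simp only [hqw] at hint
  have hcψ : ∀ j, Continuous (ψ j) := fun j => (contDiff_of_polySub (hψ j)).continuous
  have hpos : ∀ j, ∀ y ∈ faceDom T k, 0 ≤ m j + inner ℝ (d j) y := fun j y hy => by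
    rw [← hμ]; exact (mem_faceDom T).1 hy _
  have hzero := eqOn_zero_of_setIntegral (isCompact_faceDom T k)
    (F := fun y => ∑ j, (m j + inner ℝ (d j) y) * ψ j y ^ 2) (by fun_prop)
    (fun y hy => Finset.sum_nonneg fun j _ => mul_nonneg (hpos j y hy) (sq_nonneg _)) hint
  refine vpoly_eq_zero_of_open hwm (isOpen_openFace T k) (openFace_nonempty T k) fun y hy => ?_
  have h1 := hzero y (openFace_subset T k hy)
  have hy' := interior_subset (openFace_subset T k hy)
  rw [Finset.sum_eq_zero_iff_of_nonneg
    fun j _ => mul_nonneg (hpos j y hy') (sq_nonneg _)] at h1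
  refine eq_zero_of_inner_faceComp_glam T (k := k) fun i hi => ?_
  obtain ⟨j, rfl⟩ := Fin.exists_succAbove_eq hi
  change inner ℝ (w y) (d j) = 0
  have h2 := h1 j (Finset.mem_univ j)
  have h3 : ψ j y = 0 := by
    have h4 : 0 < m j + inner ℝ (d j) y := by rw [← hμ]; exact hy _ (Fin.succAbove_ne k j)
    simpa [h4.ne'] using h2
  rw [hψw, h3, mul_zero]

/-- Vanishing tangential trace means that all tangential components vanish. -/
lemma inner_eq_zero_of_faceTrace {v : E3 → E3} {k : Fin 4} (h : faceTrace T k v = 0) {x t : E3}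
    (hx : lam T k x = 0) (ht : inner ℝ (glam T k) t = 0) : inner ℝ (v x) t = 0 := by
  have h1 := congrFun h (faceCoord T k x)
  rw [faceTrace, faceMap_faceCoord T hx] at h1
  rw [← inner_rot T (inner_normal_eq_zero T ht), h1]; simp

lemma edgeTrace_eq_zero_of_faceTrace {v : E3 → E3} {k : Fin 4} (h : faceTrace T k v = 0) {e : Edge}
    (he : EdgeOf e k) : edgeTrace T e v = 0 :=
  funext fun s => inner_eq_zero_of_faceTrace T h (lam_edgeMap T he s) (inner_glam_edgeTan T he)

/-- The vector `a_i - a_j` is tangential to the two faces that contain this edge, so the component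
of `v` along it vanishes on both of their planes. -/
lemma exists_edge_quotient {p : ℕ} {v : E3 → E3} (hv : v ∈ w1Sub p)
    (hf : ∀ k, faceTrace T k v = 0) {i j k l : Fin 4} (hki : k ≠ i) (hkj : k ≠ j) (hli : l ≠ i)
    (hlj : l ≠ j) (hkl : k ≠ l) : ∃ ψ ∈ polySub 3 ((p : ℤ) - 1), ∀ x,
      inner ℝ (v x) (T.points i - T.points j) = lam T k x * lam T l x * ψ x := by
  have hg : ∀ m, m ≠ i → m ≠ j → inner ℝ (glam T m) (T.points i - T.points j) = 0 := by
    intro m h1 h2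
    rw [inner_glam_vertices, if_neg h1, if_neg h2, sub_zero]
  have h0 : ∀ m, m ≠ i → m ≠ j → ∀ x, lam T m 0 + inner ℝ (glam T m) x = 0 →
      inner ℝ (v x) (T.points i - T.points j) = 0 := by
    intro m h1 h2 x hx
    rw [← lam_eq] at hx
    exact inner_eq_zero_of_faceTrace T (hf m) hx (hg m h1 h2)
  -- The direction `a_k - a_i` runs inside the plane of face `l` and crosses the plane of face `k`.
  obtain ⟨ψ, hψ, h⟩ := exists_quotient₂ (d := (p : ℤ) - 1)
    (f := fun x => inner ℝ (v x) (T.points i - T.points j)) (by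
      have := inner_mem_polySub (w1Sub_le p hv) (T.points i - T.points j)
      rwa [show (p : ℤ) - 1 + 2 = p + 1 by ring]) (lam T k 0) (lam T l 0)
    (g := glam T k) (g' := glam T l) (h := T.points k - T.points i)
    (by rw [inner_glam_vertices, if_pos rfl, if_neg hki]; simp) (glam_ne_zero T l)
    (by rw [inner_glam_vertices, if_neg hkl.symm, if_neg hli]; simp) (h0 k hki hkj) (h0 l hli hlj)
  exact ⟨ψ, hψ, fun x => by rw [h, ← lam_eq, ← lam_eq]⟩

lemma polySub_of_lam_mul {d e : ℤ} (i : Fin 4) {f : E3 → ℝ} (hf : f ∈ polySub 3 e)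
    (h : (fun x => lam T i x * f x) ∈ polySub 3 (d + 1)) : f ∈ polySub 3 d :=
  degree_of_affine_mul (c := lam T i 0) (glam_ne_zero T i) hf (by simpa only [← lam_eq] using h)

/-- The sum of the quotients belonging to a vertex has lower degree. -/
lemma vertex_sum_mem {p : ℕ} {v : E3 → E3} (hv : v ∈ w1Sub p) {i j k l : Fin 4} (hij : i ≠ j)
    (hik : i ≠ k) (hil : i ≠ l) (hjk : j ≠ k) (hjl : j ≠ l) (hkl : k ≠ l) {f g h : E3 → ℝ}
    (hf : f ∈ polySub 3 ((p : ℤ) - 1)) (hg : g ∈ polySub 3 ((p : ℤ) - 1))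
    (hh : h ∈ polySub 3 ((p : ℤ) - 1))
    (ef : ∀ x, inner ℝ (v x) (T.points i - T.points j) = lam T k x * lam T l x * f x)
    (eg : ∀ x, inner ℝ (v x) (T.points i - T.points k) = lam T j x * lam T l x * g x)
    (eh : ∀ x, inner ℝ (v x) (T.points i - T.points l) = lam T j x * lam T k x * h x) :
    f + g + h ∈ polySub 3 ((p : ℤ) - 2) := by
  have hs : f + g + h ∈ polySub 3 ((p : ℤ) - 1) := add_mem (add_mem hf hg) hh
  have hl : ∀ m, lam T m ∈ polySub 3 1 := fun m => lam_mem_polySub T le_rfl m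
  have h1 : (fun x => lam T l x * (f + g + h) x) ∈ polySub 3 (p : ℤ) :=
    mul_mem_polySub' (hl l) hs (by linarith)
  have h2 : (fun x => lam T k x * (lam T l x * (f + g + h) x)) ∈ polySub 3 ((p : ℤ) + 1) :=
    mul_mem_polySub' (hl k) h1 (by linarith)
  refine polySub_of_lam_mul T l hs (polySub_of_lam_mul T k h1 (polySub_of_lam_mul T j h2 ?_))
  -- Multiplied by the three other coordinates, the sum becomes `-v · (x - a_i)`, of degree only `p
  -- + 1`. Cancelling three affine factors leaves degree `p - 2`, one less than for each summand.
  have h3 : (fun x => lam T j x * (lam T k x * (lam T l x * (f + g + h) x))) =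
      -fun x => inner ℝ (v x) (x - T.points i) := by
    ext x
    have s1 := sum_four (fun m => lam T m x) hij hik hil hjk hjl hkl
    have s2 := sum_four (fun m => lam T m x • T.points m) hij hik hil hjk hjl hkl
    rw [sum_lam] at s1
    rw [sum_lam_smul] at s2
    have s3 : inner ℝ (v x) x = lam T i x * inner ℝ (v x) (T.points i) +
        lam T j x * inner ℝ (v x) (T.points j) + lam T k x * inner ℝ (v x) (T.points k) +
        lam T l x * inner ℝ (v x) (T.points l) := by
      have := congrArg (inner ℝ (v x)) s2
      simpa only [inner_add_right, inner_smul_right] using this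
    have a1 := ef x
    have a2 := eg x
    have a3 := eh x
    rw [inner_sub_right] at a1 a2 a3
    simp only [Pi.neg_apply, Pi.add_apply, inner_sub_right, s3]
    linear_combination -lam T j x * a1 - lam T k x * a2 - lam T l x * a3 -
      inner ℝ (v x) (T.points i) * s1
  rw [h3, show (p : ℤ) - 2 + 1 + 1 + 1 = p + 1 by ring]
  exact neg_mem (inner_sub_mem_polySub hv _)

/-- A field with vanishing tangential traces is determined by its moments. -/
lemma eq_zero_of_dof {p : ℕ} {v : E3 → E3} (hv : v ∈ w1Sub p) (hf : ∀ k, faceTrace T k v = 0)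
    (hd : DofZeroT T p v) : v = 0 := by
  obtain ⟨f01, m01, e01⟩ := exists_edge_quotient T hv hf (i := 0) (j := 1) (k := 2) (l := 3)
    (by decide) (by decide) (by decide) (by decide) (by decide)
  obtain ⟨f02, m02, e02⟩ := exists_edge_quotient T hv hf (i := 0) (j := 2) (k := 1) (l := 3)
    (by decide) (by decide) (by decide) (by decide) (by decide)
  obtain ⟨f03, m03, e03⟩ := exists_edge_quotient T hv hf (i := 0) (j := 3) (k := 1) (l := 2)
    (by decide) (by decide) (by decide) (by decide) (by decide)
  obtain ⟨f12, m12, e12⟩ := exists_edge_quotient T hv hf (i := 1) (j := 2) (k := 0) (l := 3)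
    (by decide) (by decide) (by decide) (by decide) (by decide)
  obtain ⟨f13, m13, e13⟩ := exists_edge_quotient T hv hf (i := 1) (j := 3) (k := 0) (l := 2)
    (by decide) (by decide) (by decide) (by decide) (by decide)
  obtain ⟨f23, m23, e23⟩ := exists_edge_quotient T hv hf (i := 2) (j := 3) (k := 0) (l := 1)
    (by decide) (by decide) (by decide) (by decide) (by decide)
  have hrev : ∀ {i j : Fin 4} {a b : E3 → ℝ} {f : E3 → ℝ},
      (∀ x, inner ℝ (v x) (T.points i - T.points j) = a x * b x * f x) →
      ∀ x, inner ℝ (v x) (T.points j - T.points i) = a x * b x * (-f) x := by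
    intro i j a b f h x
    rw [← neg_sub, inner_neg_right, h, Pi.neg_apply]; ring
  have h0 := vertex_sum_mem T hv (i := 0) (j := 1) (k := 2) (l := 3) (by decide) (by decide)
    (by decide) (by decide) (by decide) (by decide) m01 m02 m03 e01 e02 e03
  have h1 := vertex_sum_mem T hv (i := 1) (j := 0) (k := 2) (l := 3) (by decide) (by decide)
    (by decide) (by decide) (by decide) (by decide) (neg_mem m01) m12 m13 (hrev e01) e12 e13
  have h2 := vertex_sum_mem T hv (i := 2) (j := 0) (k := 1) (l := 3) (by decide) (by decide)
    (by decide) (by decide) (by decide) (by decide) (neg_mem m02) (neg_mem m12) m23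
    (hrev e02) (hrev e12) e23
  have h3 := vertex_sum_mem T hv (i := 3) (j := 0) (k := 1) (l := 2) (by decide) (by decide)
    (by decide) (by decide) (by decide) (by decide) (neg_mem m03) (neg_mem m13) (neg_mem m23)
    (hrev e03) (hrev e13) (hrev e23)
  -- This is the sum over the edges of `f_ij (a_i - a_j)`, regrouped by vertices so that each
  -- coefficient has degree `p - 2`. Its product with `v` is a sum of squares with weights `λ_k
  -- λ_l`.
  set q : E3 → E3 := fun x => (f01 + f02 + f03) x • T.points 0 + (-f01 + f12 + f13) x • T.points 1 +
    (-f02 + -f12 + f23) x • T.points 2 + (-f03 + -f13 + -f23) x • T.points 3 with hq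
  have hqm : q ∈ vpolySub 3 ((p : ℤ) - 2) :=
    add_mem (add_mem (add_mem (smul_const_mem_vpolySub h0 _) (smul_const_mem_vpolySub h1 _))
      (smul_const_mem_vpolySub h2 _)) (smul_const_mem_vpolySub h3 _)
  have hqv : ∀ x, inner ℝ (q x) (v x) = lam T 2 x * lam T 3 x * f01 x ^ 2 +
      lam T 1 x * lam T 3 x * f02 x ^ 2 + lam T 1 x * lam T 2 x * f03 x ^ 2 +
      lam T 0 x * lam T 3 x * f12 x ^ 2 + lam T 0 x * lam T 2 x * f13 x ^ 2 +
      lam T 0 x * lam T 1 x * f23 x ^ 2 := by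
    intro x
    have a1 := e01 x
    have a2 := e02 x
    have a3 := e03 x
    have a4 := e12 x
    have a5 := e13 x
    have a6 := e23 x
    rw [inner_sub_right] at a1 a2 a3 a4 a5 a6
    rw [real_inner_comm]
    simp only [hq, inner_add_right, inner_smul_right, Pi.add_apply, Pi.neg_apply]
    linear_combination f01 x * a1 + f02 x * a2 + f03 x * a3 + f12 x * a4 + f13 x * a5 + f23 x * a6
  have hint := hd q (mem_vpolySub.1 hqm)
  simp only [hqv] at hint
  have hcf : ∀ {f : E3 → ℝ}, f ∈ polySub 3 ((p : ℤ) - 1) → Continuous f := fun h =>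
    (contDiff_of_polySub h).continuous
  have c1 := hcf m01
  have c2 := hcf m02
  have c3 := hcf m03
  have c4 := hcf m12
  have c5 := hcf m13
  have c6 := hcf m23
  have cl := continuous_lam T
  have hnn : ∀ x ∈ cell T, ∀ i j (f : E3 → ℝ), 0 ≤ lam T i x * lam T j x * f x ^ 2 := by
    intro x hx i j f
    have := (mem_cell T).1 hx
    exact mul_nonneg (mul_nonneg (this i) (this j)) (sq_nonneg _)
  have c0 := cl 0
  have d1 := cl 1
  have d2 := cl 2
  have d3 := cl 3
  have hzero := eqOn_zero_of_setIntegral (isCompact_cell T) (by fun_prop) (fun x hx => by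
    have := hnn x hx
    linarith [this 2 3 f01, this 1 3 f02, this 1 2 f03, this 0 3 f12, this 0 2 f13, this 0 1 f23])
    hint
  refine vpoly_eq_zero_of_open (w1Sub_le p hv) (isOpen_openCell T) (openCell_nonempty T)
    fun x hx => ?_
  have z := hzero x (openCell_subset T hx)
  have hn := hnn x (interior_subset (openCell_subset T hx))
  have z1 : lam T 2 x * lam T 3 x * f01 x ^ 2 = 0 := by
    linarith [hn 2 3 f01, hn 1 3 f02, hn 1 2 f03, hn 0 3 f12, hn 0 2 f13, hn 0 1 f23]
  have z2 : lam T 1 x * lam T 3 x * f02 x ^ 2 = 0 := by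
    linarith [hn 2 3 f01, hn 1 3 f02, hn 1 2 f03, hn 0 3 f12, hn 0 2 f13, hn 0 1 f23]
  have z3 : lam T 1 x * lam T 2 x * f03 x ^ 2 = 0 := by
    linarith [hn 2 3 f01, hn 1 3 f02, hn 1 2 f03, hn 0 3 f12, hn 0 2 f13, hn 0 1 f23]
  have hp : ∀ i, lam T i x ≠ 0 := fun i => (hx i).ne'
  have y1 : f01 x = 0 := by simpa [hp] using z1
  have y2 : f02 x = 0 := by simpa [hp] using z2
  have y3 : f03 x = 0 := by simpa [hp] using z3
  have x1 : inner ℝ (v x) (T.points 0 - T.points 1) = 0 := by rw [e01, y1, mul_zero]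
  have x2 : inner ℝ (v x) (T.points 0 - T.points 2) = 0 := by rw [e02, y2, mul_zero]
  have x3 : inner ℝ (v x) (T.points 0 - T.points 3) = 0 := by rw [e03, y3, mul_zero]
  -- The three edges at vertex 0 span the space: expanding `v x` over the vertices with coefficients
  -- of sum zero shows that it is orthogonal to itself.
  have hv0 := sum_inner_glam_smul T (v x)
  have hs0 : ∑ i, inner ℝ (glam T i) (v x) = 0 := by rw [← sum_inner, sum_glam, inner_zero_left]
  rw [Fin.sum_univ_four] at hv0 hs0
  rw [inner_sub_right] at x1 x2 x3
  have hvv := congrArg (inner ℝ (v x)) hv0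
  simp only [inner_add_right, inner_smul_right] at hvv
  rw [← inner_self_eq_zero (𝕜 := ℝ), ← hvv]
  linear_combination inner ℝ (v x) (T.points 0) * hs0 - inner ℝ (glam T 1) (v x) * x1 -
    inner ℝ (glam T 2) (v x) * x2 - inner ℝ (glam T 3) (v x) * x3

/-! ## Extension from a face -/

variable (T : Tetrahedron)

/-- A field that is built from gradients of barycentric coordinates of the vertices of a face, with
coefficients that sum to zero. -/
def faceField (k : Fin 4) (Q : Fin 3 → E3 → ℝ) (x : E3) : E3 :=
  (lam T (k.succAbove 1) x * lam T (k.succAbove 2) x * Q 0 x) • glam T (k.succAbove 0) +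
  (lam T (k.succAbove 0) x * lam T (k.succAbove 2) x * Q 1 x) • glam T (k.succAbove 1) +
  (lam T (k.succAbove 0) x * lam T (k.succAbove 1) x * Q 2 x) • glam T (k.succAbove 2)

/-- The field is one third of the sum over the three pairs `i < j` of `(Q_j - Q_i) λ_l` times the
Whitney form of the pair. The coefficient of `∇λ_j` comes out as `2 Q_j - Q_i - Q_l = 3 Q_j`. -/
lemma faceField_mem {p : ℕ} (k : Fin 4) {Q : Fin 3 → E3 → ℝ}
    (hQ : ∀ j, Q j ∈ polySub 3 ((p : ℤ) - 1)) (hs : ∀ x, Q 0 x + Q 1 x + Q 2 x = 0) :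
    faceField T k Q ∈ w1Sub p := by
  have h : ∀ i j l, (fun x => (Q j - Q i) x * lam T l x) ∈ polySub 3 (p : ℤ) := fun i j l =>
    mul_mem_polySub' (sub_mem (hQ j) (hQ i)) (lam_mem_polySub T le_rfl l) (by linarith)
  have h01 := smul_whitney_mem_w1Sub T (h 0 1 (k.succAbove 2)) (k.succAbove 0) (k.succAbove 1)
  have h02 := smul_whitney_mem_w1Sub T (h 0 2 (k.succAbove 1)) (k.succAbove 0) (k.succAbove 2)
  have h12 := smul_whitney_mem_w1Sub T (h 1 2 (k.succAbove 0)) (k.succAbove 1) (k.succAbove 2)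
  have := Submodule.smul_mem _ (1 / 3 : ℝ) (add_mem (add_mem h01 h02) h12)
  convert this using 1
  funext x
  have h2 : Q 2 x = -Q 0 x - Q 1 x := by linarith [hs x]
  simp only [faceField, Pi.smul_apply, Pi.add_apply, Pi.sub_apply, h2]
  module

lemma faceTrace_eq_zero_of_parallel {k : Fin 4} {v : E3 → E3}
    (h : ∀ x, lam T k x = 0 → ∃ c : ℝ, v x = c • glam T k) : faceTrace T k v = 0 := by
  funext y
  obtain ⟨c, hc⟩ := h _ (lam_faceMap T k y)
  have h0 := inner_glam_eq_zero T (inner_tan_zero_normal T k)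
  have h1 := inner_glam_eq_zero T (inner_tan_one_normal T k)
  rw [faceTrace_eq, hc, inner_smul_left, inner_smul_left, h0, h1]
  ext i; fin_cases i <;> simp

/-- On another face, only the term without the vanishing coordinate survives, and it points along
the normal of that face. -/
lemma faceTrace_faceField_of_ne {k j : Fin 4} (hj : j ≠ k) (Q : Fin 3 → E3 → ℝ) :
    faceTrace T j (faceField T k Q) = 0 := by
  obtain ⟨i, rfl⟩ := Fin.exists_succAbove_eq hj
  refine faceTrace_eq_zero_of_parallel T fun x hx => ?_
  fin_cases i <;> simp only [Fin.reduceFinMk, Fin.zero_eta, Fin.mk_one] at hx ⊢ <;>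
    (simp [faceField, hx]; exact ⟨_, rfl⟩)

/-- The coefficients of the field that is paired with `q`. -/
def faceCoef (k : Fin 4) (q : E2 → E2) (j : Fin 3) (x : E3) : ℝ :=
  inner ℝ (q (faceCoord T k x)) !₂[faceComp T k (glam T (k.succAbove j)) 1,
    -faceComp T k (glam T (k.succAbove j)) 0]

/-- The coefficients pair `q` with the rotated gradients, so that pairing `q` with the trace on `k`
returns each coefficient once more, hence its square. -/
def faceBubble (k : Fin 4) (q : E2 → E2) : E3 → E3 := faceField T k (faceCoef T k q)

lemma faceCoef_mem {d : ℤ} (k : Fin 4) {q : E2 → E2} (hq : q ∈ vpolySub 2 d) (j : Fin 3) :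
    faceCoef T k q j ∈ polySub 3 d :=
  faceCoord_comp_mem T (inner_mem_polySub hq _) k

lemma sum_faceCoef (k : Fin 4) (q : E2 → E2) (x : E3) :
    faceCoef T k q 0 x + faceCoef T k q 1 x + faceCoef T k q 2 x = 0 := by
  have h := sum_faceComp_glam T k
  rw [Fin.sum_univ_three] at h
  have h0 := congrArg (fun w : E2 => w 0) h
  have h1 := congrArg (fun w : E2 => w 1) h
  simp only [PiLp.add_apply, PiLp.zero_apply] at h0 h1
  simp only [faceCoef, inner_E2]
  simp only [Matrix.cons_val_zero, Matrix.cons_val_one]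
  linear_combination (q (faceCoord T k x)) 0 * h1 - (q (faceCoord T k x)) 1 * h0

lemma faceBubble_mem {p : ℕ} (k : Fin 4) {q : E2 → E2} (hq : q ∈ vpolySub 2 ((p : ℤ) - 1)) :
    faceBubble T k q ∈ w1Sub p :=
  faceField_mem T k (faceCoef_mem T k hq) (sum_faceCoef T k q)

lemma faceBubble_linOn (k : Fin 4) : LinOn univ (faceBubble T k) := by
  intro u _ v _ a b
  funext x
  simp only [faceBubble, faceField, faceCoef, Pi.add_apply, Pi.smul_apply, inner_add_left,
    inner_smul_left, RCLike.conj_to_real]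
  module

lemma inner_faceTrace_faceBubble (k : Fin 4) (q : E2 → E2) (y : E2) :
    inner ℝ (q y) (faceTrace T k (faceBubble T k q) y) =
      lam T (k.succAbove 1) (faceMap T k y) * lam T (k.succAbove 2) (faceMap T k y) *
        faceCoef T k q 0 (faceMap T k y) ^ 2 +
      lam T (k.succAbove 0) (faceMap T k y) * lam T (k.succAbove 2) (faceMap T k y) *
        faceCoef T k q 1 (faceMap T k y) ^ 2 +
      lam T (k.succAbove 0) (faceMap T k y) * lam T (k.succAbove 1) (faceMap T k y) *
        faceCoef T k q 2 (faceMap T k y) ^ 2 := by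
  have hc : ∀ j, faceCoef T k q j (faceMap T k y) =
      q y 0 * inner ℝ (glam T (k.succAbove j)) (faceTan T k 1) -
      q y 1 * inner ℝ (glam T (k.succAbove j)) (faceTan T k 0) := by
    intro j
    rw [faceCoef, faceCoord_faceMap, inner_E2]
    simp [faceComp]; ring
  rw [faceTrace_eq, inner_E2]
  simp only [Matrix.cons_val_zero, Matrix.cons_val_one, faceBubble, faceField,
    inner_add_left, inner_smul_left, RCLike.conj_to_real]
  linear_combination
    - (lam T (k.succAbove 1) (faceMap T k y) * lam T (k.succAbove 2) (faceMap T k y) *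
        faceCoef T k q 0 (faceMap T k y)) * hc 0 -
    (lam T (k.succAbove 0) (faceMap T k y) * lam T (k.succAbove 2) (faceMap T k y) *
        faceCoef T k q 1 (faceMap T k y)) * hc 1 -
    (lam T (k.succAbove 0) (faceMap T k y) * lam T (k.succAbove 1) (faceMap T k y) *
        faceCoef T k q 2 (faceMap T k y)) * hc 2

lemma eq_zero_of_faceCoef {k : Fin 4} {q : E2 → E2} {x : E3} (h : ∀ j, faceCoef T k q j x = 0) :
    q (faceCoord T k x) = 0 := by
  have h1 : !₂[-(q (faceCoord T k x)) 1, (q (faceCoord T k x)) 0] = (0 : E2) := by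
    refine eq_zero_of_inner_faceComp_glam T (k := k) fun i hi => ?_
    obtain ⟨j, rfl⟩ := Fin.exists_succAbove_eq hi
    have := h j
    rw [faceCoef, inner_E2] at this
    rw [inner_E2]
    simp at this ⊢
    linarith
  have h2 := congrArg (fun w : E2 => w 0) h1
  have h3 := congrArg (fun w : E2 => w 1) h1
  ext i; fin_cases i <;> simp at h2 h3 ⊢ <;> assumption

/-- Definiteness comes from the sum of squares, whose weights are positive inside the face. The
representation theorem then yields a bubble with any prescribed moments. -/
lemma isInnerOn_faceBubble (p : ℕ) (k : Fin 4) :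
    IsInnerOn (fun q s => ∫ y in faceDom T k, inner ℝ (s y) (faceTrace T k (faceBubble T k q) y))
      (vpolySub 2 ((p : ℤ) - 1)) (vpolySub 2 ((p : ℤ) - 1)) where
  le := le_rfl
  left s hs := by
    have h1 := integral_inner_linOn_right (isCompact_faceDom T k)
      (contDiff_of_vpolySub hs).continuous
    refine LinOn.comp (D' := fun w => ∫ y in faceDom T k, inner ℝ (s y) (w y)) h1
      ((faceTrace_linOn T k).comp ((faceBubble_linOn T k).mono (subset_univ _))
        fun _ _ => mem_univ _) fun q hq => ?_
    exact (contDiff_of_vpolySub (faceTrace_mem T (faceBubble_mem T k hq) k)).continuous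
  right q hq := by
    refine (integral_inner_linOn_left (isCompact_faceDom T k) (contDiff_of_vpolySub
      (faceTrace_mem T (faceBubble_mem T k hq) k)).continuous).mono fun s hs => ?_
    exact (contDiff_of_vpolySub hs).continuous
  definite q hq h := by
    have hc : ∀ j, Continuous (faceCoef T k q j) := fun j =>
      (contDiff_of_polySub (faceCoef_mem T k hq j)).continuous
    have h0 := hc 0
    have h1 := hc 1
    have h2 := hc 2
    have cl := fun j => continuous_lam T (k.succAbove j)
    have l0 := cl 0
    have l1 := cl 1
    have l2 := cl 2
    have cf := continuous_faceMap T k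
    simp only [inner_faceTrace_faceBubble] at h
    have hnn : ∀ y ∈ faceDom T k, ∀ i j (f : ℝ),
        0 ≤ lam T i (faceMap T k y) * lam T j (faceMap T k y) * f ^ 2 := by
      intro y hy i j f
      have := (mem_faceDom T).1 hy
      exact mul_nonneg (mul_nonneg (this i) (this j)) (sq_nonneg _)
    have hz := eqOn_zero_of_setIntegral (isCompact_faceDom T k) (by fun_prop) (fun y hy =>
      add_nonneg (add_nonneg (hnn y hy _ _ _) (hnn y hy _ _ _)) (hnn y hy _ _ _)) h
    refine vpoly_eq_zero_of_open hq (isOpen_openFace T k) (openFace_nonempty T k) fun y hy => ?_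
    have z := hz y (openFace_subset T k hy)
    have hn := hnn y (interior_subset (openFace_subset T k hy))
    have hp : ∀ j, lam T (k.succAbove j) (faceMap T k y) ≠ 0 := fun j =>
      (hy _ (Fin.succAbove_ne k j)).ne'
    rw [add_eq_zero_iff_of_nonneg (add_nonneg (hn _ _ _) (hn _ _ _)) (hn _ _ _),
      add_eq_zero_iff_of_nonneg (hn _ _ _) (hn _ _ _)] at z
    have : ∀ j, faceCoef T k q j (faceMap T k y) = 0 := by
      obtain ⟨⟨z0, z1⟩, z2⟩ := z
      intro j
      fin_cases j
      · simpa [hp] using z0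
      · simpa [hp] using z1
      · simpa [hp] using z2
    have := eq_zero_of_faceCoef T this
    rwa [faceCoord_faceMap] at this

lemma edgeTrace_eq_zero_of_other {k : Fin 4} {v : E3 → E3} (h : ∀ j, j ≠ k → faceTrace T j v = 0)
    (e : Edge) : edgeTrace T e v = 0 := by
  obtain ⟨j, hj, he⟩ := exists_face_of_edge e k
  exact edgeTrace_eq_zero_of_faceTrace T (h j hj) he

/-- A tangential trace with vanishing edge traces extends by zero to the other faces. -/
lemma exists_extension {p : ℕ} {v : E3 → E3} (hv : v ∈ w1Sub p) {k : Fin 4}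
    (he : ∀ e, EdgeOf e k → edgeTrace T e v = 0) :
    ∃ w ∈ w1Sub p, faceTrace T k w = faceTrace T k v ∧ ∀ j, j ≠ k → faceTrace T j w = 0 := by
  have hcv := (contDiff_of_vpolySub (faceTrace_mem T hv k)).continuous
  -- The bubble is chosen to have the moments of `v` on the face. It has no edge traces, because
  -- every edge lies on another face, so unisolvence identifies the two traces.
  obtain ⟨q, hq, h⟩ := (isInnerOn_faceBubble T p k).exists_repr
    (f := fun s => ∫ y in faceDom T k, inner ℝ (s y) (faceTrace T k v y))
    ((integral_inner_linOn_left (isCompact_faceDom T k) hcv).mono fun s hs =>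
      (contDiff_of_vpolySub hs).continuous)
  have hb := faceBubble_mem T k hq
  have ho : ∀ j, j ≠ k → faceTrace T j (faceBubble T k q) = 0 := fun j hj =>
    faceTrace_faceField_of_ne T hj _
  refine ⟨faceBubble T k q, hb, ?_, ho⟩
  have hcb := (contDiff_of_vpolySub (faceTrace_mem T hb k)).continuous
  have h0 : faceTrace T k (faceBubble T k q - v) = 0 := by
    refine faceTrace_eq_zero_of_dof T (sub_mem hb hv) (fun e hek => ?_) fun s hs => ?_
    · rw [edgeTrace_sub, he e hek, edgeTrace_eq_zero_of_other T ho, sub_zero]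
    · have hs' := (contDiff_of_vpolySub (mem_vpolySub.2 hs)).continuous
      have := LinOn.map_sub (integral_inner_linOn_right (isCompact_faceDom T k) hs') hcb hcv
      rw [faceTrace_sub, this, sub_eq_zero]
      exact h s (mem_vpolySub.2 hs)
  rwa [faceTrace_sub, sub_eq_zero] at h0

/-! ## Interior bubbles -/

/-- On a face only the term along its normal survives, so there is no tangential trace. The factors
`q · ∇λ_i` sum to zero, which keeps the field in the edge element space. -/
def cellBubble (q : E3 → E3) (x : E3) : E3 :=
  (lam T 1 x * lam T 2 x * lam T 3 x * inner ℝ (q x) (glam T 0)) • glam T 0 +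
  (lam T 0 x * lam T 2 x * lam T 3 x * inner ℝ (q x) (glam T 1)) • glam T 1 +
  (lam T 0 x * lam T 1 x * lam T 3 x * inner ℝ (q x) (glam T 2)) • glam T 2 +
  (lam T 0 x * lam T 1 x * lam T 2 x * inner ℝ (q x) (glam T 3)) • glam T 3

/-- As on a face, the field is a combination of Whitney forms weighted by differences of the
coefficients; with four coefficients of sum zero the factor is one quarter. -/
lemma cellBubble_mem {p : ℕ} {q : E3 → E3} (hq : q ∈ vpolySub 3 ((p : ℤ) - 2)) :
    cellBubble T q ∈ w1Sub p := by
  have h : ∀ i j k l, (fun x => lam T k x * (lam T l x *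
      ((fun x => inner ℝ (q x) (glam T j)) - fun x => inner ℝ (q x) (glam T i)) x)) ∈
      polySub 3 (p : ℤ) := fun i j k l =>
    mul_mem_polySub' (lam_mem_polySub T le_rfl k) (mul_mem_polySub' (k := (p : ℤ) - 1)
      (lam_mem_polySub T le_rfl l) (sub_mem (inner_mem_polySub hq _) (inner_mem_polySub hq _))
      (by linarith)) (by linarith)
  have h01 := smul_whitney_mem_w1Sub T (h 0 1 2 3) 0 1
  have h02 := smul_whitney_mem_w1Sub T (h 0 2 1 3) 0 2
  have h03 := smul_whitney_mem_w1Sub T (h 0 3 1 2) 0 3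
  have h12 := smul_whitney_mem_w1Sub T (h 1 2 0 3) 1 2
  have h13 := smul_whitney_mem_w1Sub T (h 1 3 0 2) 1 3
  have h23 := smul_whitney_mem_w1Sub T (h 2 3 0 1) 2 3
  have := Submodule.smul_mem _ (1 / 4 : ℝ)
    (add_mem (add_mem (add_mem (add_mem (add_mem h01 h02) h03) h12) h13) h23)
  convert this using 1
  funext x
  have hs : inner ℝ (q x) (glam T 3) = -inner ℝ (q x) (glam T 0) - inner ℝ (q x) (glam T 1) -
      inner ℝ (q x) (glam T 2) := by
    have h1 := congrArg (inner ℝ (q x)) (sum_glam T)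
    rw [Fin.sum_univ_four] at h1
    simp only [inner_add_right, inner_zero_right] at h1
    linarith
  simp only [cellBubble, Pi.smul_apply, Pi.add_apply, Pi.sub_apply, hs]
  module

lemma cellBubble_linOn : LinOn univ (cellBubble T) := by
  intro u _ v _ a b
  funext x
  simp only [cellBubble, Pi.add_apply, Pi.smul_apply, inner_add_left, inner_smul_left,
    RCLike.conj_to_real]
  module

lemma faceTrace_cellBubble (k : Fin 4) (q : E3 → E3) : faceTrace T k (cellBubble T q) = 0 := by
  refine faceTrace_eq_zero_of_parallel T fun x hx => ?_
  fin_cases k <;> simp only [Fin.reduceFinMk, Fin.zero_eta, Fin.mk_one] at hx ⊢ <;>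
    (simp [cellBubble, hx]; exact ⟨_, rfl⟩)

lemma inner_cellBubble (q : E3 → E3) (x : E3) : inner ℝ (q x) (cellBubble T q x) =
    lam T 1 x * lam T 2 x * lam T 3 x * inner ℝ (q x) (glam T 0) ^ 2 +
    lam T 0 x * lam T 2 x * lam T 3 x * inner ℝ (q x) (glam T 1) ^ 2 +
    lam T 0 x * lam T 1 x * lam T 3 x * inner ℝ (q x) (glam T 2) ^ 2 +
    lam T 0 x * lam T 1 x * lam T 2 x * inner ℝ (q x) (glam T 3) ^ 2 := by
  simp only [cellBubble, inner_add_right, inner_smul_right]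
  ring

lemma isInnerOn_cellBubble (p : ℕ) :
    IsInnerOn (fun q s => ∫ x in cell T, inner ℝ (s x) (cellBubble T q x))
      (vpolySub 3 ((p : ℤ) - 2)) (vpolySub 3 ((p : ℤ) - 2)) where
  le := le_rfl
  left s hs := by
    refine LinOn.comp (D' := fun w => ∫ x in cell T, inner ℝ (s x) (w x))
      (integral_inner_linOn_right (isCompact_cell T) (contDiff_of_vpolySub hs).continuous)
      ((cellBubble_linOn T).mono (subset_univ _)) fun q hq => ?_
    exact (contDiff_of_w1Sub (cellBubble_mem T hq)).continuous
  right q hq := (integral_inner_linOn_left (isCompact_cell T)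
    (contDiff_of_w1Sub (cellBubble_mem T hq)).continuous).mono fun s hs =>
      (contDiff_of_vpolySub hs).continuous
  definite q hq h := by
    have cq := (contDiff_of_vpolySub hq).continuous
    have cl := continuous_lam T
    have l0 := cl 0
    have l1 := cl 1
    have l2 := cl 2
    have l3 := cl 3
    simp only [inner_cellBubble] at h
    have hnn : ∀ x ∈ cell T, ∀ i j k (f : ℝ), 0 ≤ lam T i x * lam T j x * lam T k x * f ^ 2 := by
      intro x hx i j k f
      have := (mem_cell T).1 hx
      exact mul_nonneg (mul_nonneg (mul_nonneg (this i) (this j)) (this k)) (sq_nonneg _)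
    have hz := eqOn_zero_of_setIntegral (isCompact_cell T) (by fun_prop) (fun x hx =>
      add_nonneg (add_nonneg (add_nonneg (hnn x hx _ _ _ _) (hnn x hx _ _ _ _)) (hnn x hx _ _ _ _))
        (hnn x hx _ _ _ _)) h
    refine vpoly_eq_zero_of_open hq (isOpen_openCell T) (openCell_nonempty T) fun x hx => ?_
    have z := hz x (openCell_subset T hx)
    have hn := hnn x (interior_subset (openCell_subset T hx))
    have hp : ∀ i, lam T i x ≠ 0 := fun i => (hx i).ne'
    rw [add_eq_zero_iff_of_nonneg (add_nonneg (add_nonneg (hn _ _ _ _) (hn _ _ _ _)) (hn _ _ _ _))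
      (hn _ _ _ _), add_eq_zero_iff_of_nonneg (add_nonneg (hn _ _ _ _) (hn _ _ _ _)) (hn _ _ _ _),
      add_eq_zero_iff_of_nonneg (hn _ _ _ _) (hn _ _ _ _)] at z
    obtain ⟨⟨⟨z0, z1⟩, z2⟩, z3⟩ := z
    refine eq_zero_of_inner_glam T fun i => ?_
    rw [real_inner_comm]
    fin_cases i
    · simpa [hp] using z0
    · simpa [hp] using z1
    · simpa [hp] using z2
    · simpa [hp] using z3

/-! ## The extension operator -/

/-- The trace has degree `p` and is itself an admissible test polynomial. -/
lemma edgeTrace_eq_zero_of_dof {p : ℕ} {v : E3 → E3} (hv : v ∈ w1Sub p) {e : Edge}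
    (h : DofZeroE T p e v) : edgeTrace T e v = 0 := by
  have hm := edgeTrace_mem T hv e
  have hc : Continuous (edgeTrace T e v) := by
    obtain ⟨P, _, hP⟩ := hm
    rw [show edgeTrace T e v = fun s => P.eval s from funext hP]
    exact P.continuous
  have h0 := eqOn_zero_of_setIntegral (V := ℝ) (D := edgeDom T e) isCompact_Icc
    (F := fun s => edgeTrace T e v s * edgeTrace T e v s) (by fun_prop)
    (fun s _ => mul_self_nonneg _) (h _ hm)
  refine poly1_eq_zero hm (S := interior (edgeDom T e)) ?_ fun s hs => by simpa using h0 s hs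
  rw [edgeDom, interior_Icc]
  exact Ioo_infinite (edgeLen_pos T e)

/-- Unisolvence on the other faces turns moments into traces. Conversely every edge lies on a face
other than `k`, so the edge conditions are implied. -/
lemma mem_y1F {p : ℕ} {k : Fin 4} {v : E3 → E3} : v ∈ Y1F T p k ↔
    v ∈ w1Sub p ∧ (∀ j, j ≠ k → faceTrace T j v = 0) ∧ DofZeroT T p v := by
  constructor
  · rintro ⟨h1, h2, h3, h4⟩
    exact ⟨h1, fun j hj => faceTrace_eq_zero_of_dof T h1
      (fun e _ => edgeTrace_eq_zero_of_dof T h1 (h2 e)) (h3 j hj), h4⟩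
  · rintro ⟨h1, h2, h3⟩
    refine ⟨h1, fun e q _ => ?_, fun j hj q _ => ?_, h3⟩
    · simp [edgeTrace_eq_zero_of_other T h2]
    · simp [h2 j hj]

lemma DofZeroT.sub {p : ℕ} {u v : E3 → E3} (hu : u ∈ w1Sub p) (hv : v ∈ w1Sub p)
    (h : ∀ q ∈ VPoly 3 ((p : ℤ) - 2), ∫ x in cell T, inner ℝ (q x) (u x) =
      ∫ x in cell T, inner ℝ (q x) (v x)) : DofZeroT T p (u - v) := by
  intro q hq
  have := LinOn.map_sub (integral_inner_linOn_right (isCompact_cell T)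
    (contDiff_of_vpolySub (mem_vpolySub.2 hq)).continuous) (contDiff_of_w1Sub hu).continuous
    (contDiff_of_w1Sub hv).continuous
  rw [this, h q hq, sub_self]

lemma y1F_unique {p : ℕ} {k : Fin 4} {u v : E3 → E3} (hu : u ∈ Y1F T p k) (hv : v ∈ Y1F T p k)
    (h : faceTrace T k u = faceTrace T k v) : u = v := by
  rw [mem_y1F] at hu hv
  rw [← sub_eq_zero]
  refine eq_zero_of_dof T (sub_mem hu.1 hv.1) (fun j => ?_) (DofZeroT.sub T hu.1 hv.1 fun q hq => by
    rw [hu.2.2 q hq, hv.2.2 q hq])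
  rw [faceTrace_sub]
  by_cases hj : j = k
  · rw [hj, h, sub_self]
  · rw [hu.2.1 j hj, hv.2.1 j hj, sub_zero]

lemma ext1F_faceTrace {p : ℕ} {k : Fin 4} {v : E3 → E3} (hv : v ∈ Y1F T p k) :
    ext1F T p k (faceTrace T k v) = v :=
  theUnique_eq ⟨hv, rfl⟩ fun _ h => y1F_unique T h.1 hv h.2

/-- A condition on the edge segment becomes one on the whole line, since the edge trace is a
polynomial in arclength. -/
lemma mem_w10F {p : ℕ} {k : Fin 4} {w : E2 → E2} : w ∈ W10F T p k ↔
    ∃ v ∈ w1Sub p, faceTrace T k v = w ∧ ∀ e, EdgeOf e k → edgeTrace T e v = 0 := by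
  constructor
  · rintro ⟨⟨v, hv, rfl⟩, h⟩
    refine ⟨v, hv, rfl, fun e he => ?_⟩
    refine poly1_eq_zero (edgeTrace_mem T hv e) (infinite_edgeDom T e) fun s hs => ?_
    rw [← inner_faceTrace_edgeNormal T he]
    refine h e he _ ?_
    rw [faceMap_faceCoord_edgeMap T he]
    exact edgeMap_mem_edge T hs
  · rintro ⟨v, hv, rfl, h⟩
    refine ⟨⟨v, hv, rfl⟩, fun e he y hy => ?_⟩
    obtain ⟨s, _, hs⟩ := exists_of_mem_edge T hy
    have := inner_faceTrace_edgeNormal T he v s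
    rwa [hs, faceCoord_faceMap, h e he] at this

lemma exists_y1F {p : ℕ} {k : Fin 4} {w : E2 → E2} (hw : w ∈ W10F T p k) :
    ∃ v ∈ Y1F T p k, faceTrace T k v = w := by
  obtain ⟨v₀, hv₀, rfl, he⟩ := (mem_w10F T).1 hw
  obtain ⟨v, hv, hk, ho⟩ := exists_extension T hv₀ he
  -- An interior bubble with the same interior moments is subtracted; it changes no tangential
  -- trace.
  obtain ⟨q, hq, h⟩ := (isInnerOn_cellBubble T p).exists_repr
    (f := fun s => ∫ x in cell T, inner ℝ (s x) (v x))
    ((integral_inner_linOn_left (isCompact_cell T) (contDiff_of_w1Sub hv).continuous).mono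
      fun s hs => (contDiff_of_vpolySub hs).continuous)
  have hb := cellBubble_mem T hq
  refine ⟨v - cellBubble T q, (mem_y1F T).2 ⟨sub_mem hv hb, fun j hj => ?_, ?_⟩, ?_⟩
  · rw [faceTrace_sub, ho j hj, faceTrace_cellBubble, sub_zero]
  · exact DofZeroT.sub T hv hb fun s hs => (h s (mem_vpolySub.2 hs)).symm
  · rw [faceTrace_sub, hk, faceTrace_cellBubble, sub_zero]

lemma ext1F_spec {p : ℕ} {k : Fin 4} {w : E2 → E2} (hw : w ∈ W10F T p k) :
    ext1F T p k w ∈ Y1F T p k ∧ faceTrace T k (ext1F T p k w) = w := by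
  obtain ⟨v, hv, rfl⟩ := exists_y1F T hw
  rw [ext1F_faceTrace T hv]
  exact ⟨hv, rfl⟩

/-- `W10F` as a submodule. -/
def w10FSub (p : ℕ) (k : Fin 4) : Submodule ℝ (E2 → E2) where
  carrier := W10F T p k
  zero_mem' := (mem_w10F T).2 ⟨0, zero_mem _, faceTrace_zero T k, fun e _ => by
    funext s; simp [edgeTrace]⟩
  add_mem' := by
    intro u v hu hv
    obtain ⟨u', h1, rfl, h2⟩ := (mem_w10F T).1 hu
    obtain ⟨v', h3, rfl, h4⟩ := (mem_w10F T).1 hv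
    exact (mem_w10F T).2 ⟨u' + v', add_mem h1 h3, faceTrace_add T k _ _, fun e he => by
      rw [edgeTrace_add, h2 e he, h4 e he, add_zero]⟩
  smul_mem' := by
    intro c u hu
    obtain ⟨u', h1, rfl, h2⟩ := (mem_w10F T).1 hu
    refine (mem_w10F T).2 ⟨c • u', Submodule.smul_mem _ c h1, ?_, fun e he => ?_⟩
    · simpa using faceTrace_linOn T k u' (mem_univ _) u' (mem_univ _) c 0
    · simpa [h2 e he] using edgeTrace_linOn T e u' (mem_univ _) u' (mem_univ _) c 0

lemma w10FSub_le (p : ℕ) (k : Fin 4) : w10FSub T p k ≤ vpolySub 2 (p + 1) := by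
  intro w hw
  obtain ⟨v, hv, rfl, _⟩ := (mem_w10F T).1 hw
  exact faceTrace_mem T hv k

instance (p : ℕ) (k : Fin 4) : FiniteDimensional ℝ (w10FSub T p k) :=
  Submodule.finiteDimensional_of_le (w10FSub_le T p k)

lemma ext1F_linOn (p : ℕ) (k : Fin 4) : LinOn (w10FSub T p k : Set (E2 → E2)) (ext1F T p k) := by
  intro u hu v hv a b
  obtain ⟨u', h1, rfl⟩ := exists_y1F T hu
  obtain ⟨v', h2, rfl⟩ := exists_y1F T hv
  have hl := faceTrace_linOn T k u' (mem_univ _) v' (mem_univ _) a b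
  rw [← hl, ext1F_faceTrace T h1, ext1F_faceTrace T h2]
  refine ext1F_faceTrace T ?_
  rw [mem_y1F] at h1 h2 ⊢
  refine ⟨add_mem (Submodule.smul_mem _ a h1.1) (Submodule.smul_mem _ b h2.1), fun j hj => ?_,
    fun q hq => ?_⟩
  · rw [faceTrace_linOn T j u' (mem_univ _) v' (mem_univ _) a b, h1.2.1 j hj, h2.2.1 j hj]; simp
  · have := integral_inner_linOn_right (isCompact_cell T)
      (contDiff_of_vpolySub (mem_vpolySub.2 hq)).continuous u' (contDiff_of_w1Sub h1.1).continuous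
      v' (contDiff_of_w1Sub h2.1).continuous a b
    simp only at this
    rw [this, h1.2.2 q hq, h2.2.2 q hq]; simp

lemma ext1F_mem (p : ℕ) (k : Fin 4) (w : E2 → E2) : ext1F T p k w ∈ w1Sub p := by
  rcases theUnique_mem_or (fun v => v ∈ Y1F T p k ∧ faceTrace T k v = w) with h | h
  · exact h.1.1
  · rw [ext1F, h]; exact zero_mem _

/-! ## Projections onto images and their liftings -/

section Image

variable {F G : Type*} [AddCommGroup F] [Module ℝ F] [AddCommGroup G] [Module ℝ G]

/-- The bilinear form `B` defines orthogonal projections of elements of `M` onto `D '' V`. -/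
structure ProjectsOn (B : G → G → ℝ) (M : Submodule ℝ G) (V : Submodule ℝ F) (D : F → G) :
    Prop where
  fd : FiniteDimensional ℝ V
  lin : LinOn (V : Set F) D
  maps : ∀ g ∈ V, D g ∈ M
  left : ∀ w ∈ M, LinOn (M : Set G) fun u => B u w
  right : ∀ u ∈ M, LinOn (M : Set G) fun w => B u w
  definite : ∀ g ∈ V, B (D g) (D g) = 0 → D g = 0

variable {B : G → G → ℝ} {M : Submodule ℝ G} {V : Submodule ℝ F} {D : F → G}

lemma ProjectsOn.exists_isInnerOn (h : ProjectsOn B M V D) :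
    ∃ S : Submodule ℝ G, (S : Set G) = D '' V ∧ FiniteDimensional ℝ S ∧ IsInnerOn B M S := by
  have := h.fd
  obtain ⟨S, hS, hfd⟩ := h.lin.exists_image
  have hle : S ≤ M := by
    intro w hw
    obtain ⟨g, hg, rfl⟩ : w ∈ D '' (V : Set F) := hS ▸ hw
    exact h.maps g hg
  refine ⟨S, hS, hfd, hle, fun w hw => h.left w (hle hw), fun u hu => (h.right u hu).mono hle, ?_⟩
  intro w hw h0
  obtain ⟨g, hg, rfl⟩ : w ∈ D '' (V : Set F) := hS ▸ hw
  exact h.definite g hg h0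

lemma ProjectsOn.proj_linOn (h : ProjectsOn B M V D) :
    LinOn (M : Set G) (orthProj B (D '' V)) := by
  obtain ⟨S, hS, _, hi⟩ := h.exists_isInnerOn
  rw [← hS]; exact hi.orthProj_linOn

lemma ProjectsOn.proj_mem (h : ProjectsOn B M V D) {u : G} (hu : u ∈ M) :
    orthProj B (D '' V) u ∈ D '' V := by
  obtain ⟨S, hS, _, hi⟩ := h.exists_isInnerOn
  rw [← hS]; exact (hi.orthProj_spec hu).1

lemma ProjectsOn.proj_self (h : ProjectsOn B M V D) {g : F} (hg : g ∈ V) :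
    orthProj B (D '' V) (D g) = D g := by
  obtain ⟨S, hS, _, hi⟩ := h.exists_isInnerOn
  have : D g ∈ (S : Set G) := by rw [hS]; exact mem_image_of_mem D hg
  rw [← hS]; exact hi.orthProj_self this

lemma ProjectsOn.proj_eq_zero (h : ProjectsOn B M V D) {u : G} (hu : u ∈ M)
    (h0 : ∀ s, B u s = 0) : orthProj B (D '' V) u = 0 := by
  obtain ⟨S, hS, _, hi⟩ := h.exists_isInnerOn
  rw [← hS]; exact hi.orthProj_eq_zero hu fun s _ => h0 s

variable (hlin : LinOn (V : Set F) D) (hinj : ∀ g ∈ V, D g = 0 → g = 0)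
include hlin hinj

lemma lift_eq {g : F} (hg : g ∈ V) : (theUnique fun f => f ∈ (V : Set F) ∧ D f = D g) = g := by
  refine theUnique_eq ⟨hg, rfl⟩ fun f hf => ?_
  rw [← sub_eq_zero]
  exact hinj _ (V.sub_mem hf.1 hg) (by rw [hlin.map_sub hf.1 hg, hf.2, sub_self])

lemma lift_linOn : LinOn (D '' V) fun u => theUnique fun f => f ∈ (V : Set F) ∧ D f = u := by
  rintro _ ⟨f, hf, rfl⟩ _ ⟨g, hg, rfl⟩ a b
  simp only
  rw [lift_eq hlin hinj hf, lift_eq hlin hinj hg, ← hlin f hf g hg a b]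
  exact lift_eq hlin hinj (V.add_mem (V.smul_mem a hf) (V.smul_mem b hg))

end Image

lemma lift_mem {F : Type*} [AddCommGroup F] [Module ℝ F] {V : Submodule ℝ F} (Q : F → Prop) :
    (theUnique fun f => f ∈ (V : Set F) ∧ Q f) ∈ V := by
  rcases theUnique_mem_or fun f => f ∈ (V : Set F) ∧ Q f with h | h
  · exact h.1
  · rw [h]; exact V.zero_mem

/-! ## Smooth and continuous functions -/

section Smooth

/-- Continuous functions. -/
def contSub (E F : Type*) [TopologicalSpace E] [NormedAddCommGroup F] [NormedSpace ℝ F] :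
    Submodule ℝ (E → F) where
  carrier := {f | Continuous f}
  zero_mem' := continuous_const
  add_mem' := fun hf hg => Continuous.add hf hg
  smul_mem' := fun c _ hf => Continuous.const_smul hf c

/-- Smooth functions. -/
def smoothSub (E F : Type*) [NormedAddCommGroup E] [NormedSpace ℝ E] [NormedAddCommGroup F]
    [NormedSpace ℝ F] : Submodule ℝ (E → F) where
  carrier := {f | ContDiff ℝ ∞ f}
  zero_mem' := (contDiff_const : ContDiff ℝ ∞ fun _ : E => (0 : F))
  add_mem' := fun {f g} (hf : ContDiff ℝ ∞ f) (hg : ContDiff ℝ ∞ g) => hf.add hg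
  smul_mem' := fun c f (hf : ContDiff ℝ ∞ f) => contDiff_const.smul hf

variable {E F : Type*} [NormedAddCommGroup E] [NormedSpace ℝ E] [NormedAddCommGroup F]
    [NormedSpace ℝ F]

lemma mem_smoothSub {f : E → F} : f ∈ smoothSub E F ↔ ContDiff ℝ ∞ f := Iff.rfl

lemma smoothSub_le : smoothSub E F ≤ contSub E F := fun f (hf : ContDiff ℝ ∞ f) => hf.continuous

lemma smoothSub.differentiable {f : E → F} (hf : f ∈ smoothSub E F) : Differentiable ℝ f :=
  (mem_smoothSub.1 hf).differentiable (by simp)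

lemma w1Sub_le_smoothSub (p : ℕ) : w1Sub p ≤ smoothSub E3 E3 := fun _ => contDiff_of_w1Sub

lemma deriv_linOn : LinOn (smoothSub ℝ ℝ : Set (ℝ → ℝ)) deriv := by
  intro u hu v hv a b
  funext s
  have h1 := smoothSub.differentiable hu s
  have h2 := smoothSub.differentiable hv s
  rw [((h1.hasDerivAt.const_smul a).add (h2.hasDerivAt.const_smul b)).deriv]
  rfl

variable {n : ℕ}

lemma partialD_linOn (i : Fin n) (x : EN n) :
    LinOn (smoothSub (EN n) F : Set (EN n → F)) fun u => partialD i u x := by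
  intro u hu v hv a b
  have h1 := smoothSub.differentiable hu x
  have h2 := smoothSub.differentiable hv x
  simp only [partialD]
  rw [((h1.hasFDerivAt.const_smul a).add (h2.hasFDerivAt.const_smul b)).fderiv]
  rfl

lemma partialD_mem {u : EN n → F} (hu : u ∈ smoothSub (EN n) F) (i : Fin n) :
    partialD i u ∈ smoothSub (EN n) F := by
  have h : ContDiff ℝ ∞ (fderiv ℝ u) := (mem_smoothSub.1 hu).fderiv_right (by simp)
  exact h.clm_apply contDiff_const

lemma gradient_linOn : LinOn (smoothSub (EN n) ℝ : Set (EN n → ℝ)) gradient := by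
  intro u hu v hv a b
  have h1 := smoothSub.differentiable hu
  have h2 := smoothSub.differentiable hv
  rw [gradient_add (h1.const_smul a) (h2.const_smul b), gradient_smul, gradient_smul]

lemma bcurl_linOn : LinOn (smoothSub E2 ℝ : Set (E2 → ℝ)) bcurl := by
  intro u hu v hv a b
  funext y
  have h := fun i => partialD_linOn i y u hu v hv a b
  simp only at h
  ext i
  fin_cases i <;> simp [bcurl, h]
  ring

lemma div2_linOn : LinOn (smoothSub E2 E2 : Set (E2 → E2)) div2 := by
  intro u hu v hv a b
  funext y
  have h := fun i => partialD_linOn i y u hu v hv a b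
  simp only at h
  simp [div2, h]
  ring

lemma contDiff_apply {m : ℕ} {u : EN n → EN m} (hu : ContDiff ℝ ∞ u) (i : Fin m) :
    ContDiff ℝ ∞ fun x => u x i := contDiff_euclidean.1 hu i

lemma div2_mem {u : E2 → E2} (hu : u ∈ smoothSub E2 E2) : div2 u ∈ smoothSub E2 ℝ :=
  (contDiff_apply (partialD_mem hu 0) 0).add (contDiff_apply (partialD_mem hu 1) 1)

lemma curl_linOn : LinOn (smoothSub E3 E3 : Set (E3 → E3)) curl := by
  intro u hu v hv a b
  funext y
  have h := fun i => partialD_linOn i y u hu v hv a b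
  simp only at h
  ext i
  fin_cases i <;> simp [curl, h] <;> ring

lemma curl_mem {u : E3 → E3} (hu : u ∈ smoothSub E3 E3) : curl u ∈ smoothSub E3 E3 := by
  rw [mem_smoothSub, contDiff_euclidean]
  have h := fun i j => contDiff_apply (partialD_mem hu i) j
  intro i
  fin_cases i
  · exact (h 1 2).sub (h 2 1)
  · exact (h 2 0).sub (h 0 2)
  · exact (h 0 1).sub (h 1 0)

variable (T : Tetrahedron)

lemma contDiff_edgeMap (e : Edge) : ContDiff ℝ ∞ (edgeMap T e) := by
  unfold edgeMap; fun_prop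

lemma edgeTrace_mem_smooth {u : E3 → E3} (hu : u ∈ smoothSub E3 E3) (e : Edge) :
    edgeTrace T e u ∈ smoothSub ℝ ℝ :=
  ContDiff.inner ℝ ((mem_smoothSub.1 hu).comp (contDiff_edgeMap T e)) contDiff_const

lemma faceTrace_mem_smooth {u : E3 → E3} (hu : u ∈ smoothSub E3 E3) (k : Fin 4) :
    faceTrace T k u ∈ smoothSub E2 E2 := by
  have h : ∀ w : E3, ContDiff ℝ ∞ fun y => inner ℝ (u (faceMap T k y)) w := fun w =>
    ContDiff.inner ℝ ((mem_smoothSub.1 hu).comp (contDiff_faceMap T k)) contDiff_const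
  rw [mem_smoothSub, contDiff_euclidean]
  intro i
  simp only [faceTrace_eq]
  fin_cases i
  · exact h _
  · exact (h _).neg

end Smooth

/-! ## Polynomials of one variable -/

lemma contDiff_of_poly1Sub {d : ℕ} {g : ℝ → ℝ} (hg : g ∈ poly1Sub d) : ContDiff ℝ ∞ g := by
  obtain ⟨P, _, hP⟩ := hg
  rw [show g = fun s => P.eval s from funext hP]
  exact P.contDiff_aeval ∞

lemma deriv_mem_poly1Sub {d : ℕ} {g : ℝ → ℝ} (hg : g ∈ poly1Sub (d + 1)) :
    deriv g ∈ poly1Sub d := by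
  obtain ⟨P, hd, hP⟩ := hg
  rw [show g = fun s => P.eval s from funext hP]
  refine ⟨P.derivative, ?_, fun s => P.deriv⟩
  exact (Polynomial.natDegree_derivative_le P).trans (by omega)

lemma exists_primitive {d : ℕ} {u : ℝ → ℝ} (hu : u ∈ poly1Sub d) :
    ∃ g ∈ poly1Sub (d + 1), deriv g = u := by
  obtain ⟨P, hd, hP⟩ := hu
  let Q : Polynomial ℝ :=
    ∑ i ∈ Finset.range (d + 1), Polynomial.C (P.coeff i / (i + 1)) * Polynomial.X ^ (i + 1)
  refine ⟨fun s => Q.eval s, ⟨Q, ?_, fun s => rfl⟩, ?_⟩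
  · refine Polynomial.natDegree_sum_le_of_forall_le _ _ fun i hi => ?_
    refine (Polynomial.natDegree_C_mul_X_pow_le _ _).trans ?_
    have := Finset.mem_range.1 hi
    omega
  · funext s
    rw [Polynomial.deriv, hP]
    congr 1
    conv_rhs => rw [Polynomial.as_sum_range' P (d + 1) (by omega)]
    simp only [Q, Polynomial.derivative_sum]
    refine Finset.sum_congr rfl fun i _ => ?_
    rw [Polynomial.derivative_C_mul_X_pow, ← Polynomial.C_mul_X_pow_eq_monomial]
    simp only [Nat.add_sub_cancel, Nat.cast_add, Nat.cast_one]
    rw [div_mul_cancel₀]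
    positivity

lemma const_mem_poly1Sub (d : ℕ) (c : ℝ) : (fun _ => c) ∈ poly1Sub d :=
  ⟨Polynomial.C c, by simp, by simp⟩

/-! ## Polynomials vanishing on the boundary -/

variable (T : Tetrahedron)

def poly0ESub (d : ℕ) (e : Edge) : Submodule ℝ (ℝ → ℝ) where
  carrier := Poly0E T d e
  zero_mem' := ⟨(poly1Sub d).zero_mem, rfl, rfl⟩
  add_mem' := by
    rintro f g ⟨h1, h2, h3⟩ ⟨h4, h5, h6⟩
    exact ⟨(poly1Sub d).add_mem h1 h4, by simp [h2, h5], by simp [h3, h6]⟩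
  smul_mem' := by
    rintro c f ⟨h1, h2, h3⟩
    exact ⟨(poly1Sub d).smul_mem c h1, by simp [h2], by simp [h3]⟩

lemma poly0ESub_le (d : ℕ) (e : Edge) : poly0ESub T d e ≤ poly1Sub d := fun _ h => h.1

instance (d : ℕ) (e : Edge) : FiniteDimensional ℝ (poly0ESub T d e) :=
  Submodule.finiteDimensional_of_le (poly0ESub_le T d e)

def poly0FSub (d : ℤ) (k : Fin 4) : Submodule ℝ (E2 → ℝ) where
  carrier := Poly0F T d k
  zero_mem' := ⟨mem_polySub.1 (zero_mem _), fun _ _ _ _ => rfl⟩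
  add_mem' := by
    rintro f g ⟨h1, h2⟩ ⟨h3, h4⟩
    exact ⟨mem_polySub.1 (add_mem (mem_polySub.2 h1) (mem_polySub.2 h3)), fun e he y hy => by
      simp [h2 e he y hy, h4 e he y hy]⟩
  smul_mem' := by
    rintro c f ⟨h1, h2⟩
    exact ⟨mem_polySub.1 (Submodule.smul_mem _ c (mem_polySub.2 h1)), fun e he y hy => by
      simp [h2 e he y hy]⟩

lemma poly0FSub_le (d : ℤ) (k : Fin 4) : poly0FSub T d k ≤ polySub 2 d :=
  fun _ h => mem_polySub.2 h.1

instance (d : ℤ) (k : Fin 4) : FiniteDimensional ℝ (poly0FSub T d k) :=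
  Submodule.finiteDimensional_of_le (poly0FSub_le T d k)

def poly0TSub (d : ℤ) : Submodule ℝ (E3 → ℝ) where
  carrier := Poly0T T d
  zero_mem' := ⟨mem_polySub.1 (zero_mem _), fun _ _ _ => rfl⟩
  add_mem' := by
    rintro f g ⟨h1, h2⟩ ⟨h3, h4⟩
    exact ⟨mem_polySub.1 (add_mem (mem_polySub.2 h1) (mem_polySub.2 h3)), fun k x hx => by
      simp [h2 k x hx, h4 k x hx]⟩
  smul_mem' := by
    rintro c f ⟨h1, h2⟩
    exact ⟨mem_polySub.1 (Submodule.smul_mem _ c (mem_polySub.2 h1)), fun k x hx => by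
      simp [h2 k x hx]⟩

lemma poly0TSub_le (d : ℤ) : poly0TSub T d ≤ polySub 3 d := fun _ h => mem_polySub.2 h.1

instance (d : ℤ) : FiniteDimensional ℝ (poly0TSub T d) :=
  Submodule.finiteDimensional_of_le (poly0TSub_le T d)

lemma faceTrace_linComb (k : Fin 4) (u v : E3 → E3) (a b : ℝ) :
    faceTrace T k (a • u + b • v) = a • faceTrace T k u + b • faceTrace T k v :=
  faceTrace_linOn T k u (mem_univ _) v (mem_univ _) a b

lemma mem_w10T {p : ℕ} {v : E3 → E3} :
    v ∈ W10T T p ↔ v ∈ w1Sub p ∧ ∀ k, faceTrace T k v = 0 := by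
  constructor
  · rintro ⟨h1, h2⟩
    refine ⟨h1, fun k => vpoly_eq_zero_of_open (faceTrace_mem T h1 k) (isOpen_openFace T k)
      (openFace_nonempty T k) fun y hy => ?_⟩
    have hy' := interior_subset (openFace_subset T k hy)
    have h3 := h2 k (faceMap T k y) hy'
    rw [faceTrace, h3]
    ext i; fin_cases i <;> simp [faceComp]
  · rintro ⟨h1, h2⟩
    refine ⟨h1, fun k x hx => ?_⟩
    have hx0 := ((mem_face T).1 hx).1
    have h3 := inner_eq_zero_of_faceTrace T (h2 k) hx0
      (inner_glam_eq_zero T (inner_tan_zero_normal T k))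
    have h4 := inner_eq_zero_of_faceTrace T (h2 k) hx0
      (inner_glam_eq_zero T (inner_tan_one_normal T k))
    rw [frame_expand T k (v x), h3, h4, zero_smul, zero_smul, zero_add, zero_add, cross_smul_left]
    simp [cross]

def w10TSub (p : ℕ) : Submodule ℝ (E3 → E3) where
  carrier := W10T T p
  zero_mem' := (mem_w10T T).2 ⟨zero_mem _, faceTrace_zero T⟩
  add_mem' := by
    intro u v hu hv
    rw [mem_w10T] at *
    exact ⟨add_mem hu.1 hv.1, fun k => by rw [faceTrace_add, hu.2, hv.2, add_zero]⟩
  smul_mem' := by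
    intro c u hu
    rw [mem_w10T] at *
    refine ⟨Submodule.smul_mem _ c hu.1, fun k => ?_⟩
    simpa [hu.2] using faceTrace_linComb T k u u c 0

lemma w10TSub_le (p : ℕ) : w10TSub T p ≤ w1Sub p := fun _ h => h.1

instance (p : ℕ) : FiniteDimensional ℝ (w10TSub T p) :=
  Submodule.finiteDimensional_of_le (w10TSub_le T p)

lemma poly1_eq_of_edgeDom {d : ℕ} {f g : ℝ → ℝ} (hf : f ∈ poly1Sub d) (hg : g ∈ poly1Sub d)
    (e : Edge) (h : ∀ s ∈ edgeDom T e, f s = g s) : f = g := by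
  rw [← sub_eq_zero]
  exact poly1_eq_zero (sub_mem hf hg) (infinite_edgeDom T e) fun s hs => by simp [h s hs]

lemma poly_eq_of_faceDom {d : ℤ} {f g : E2 → ℝ} (hf : f ∈ polySub 2 d) (hg : g ∈ polySub 2 d)
    (k : Fin 4) (h : ∀ y ∈ faceDom T k, f y = g y) : f = g := by
  rw [← sub_eq_zero]
  exact poly_eq_zero_of_open (sub_mem hf hg) (isOpen_openFace T k) (openFace_nonempty T k)
    fun y hy => by simp [h y (interior_subset (openFace_subset T k hy))]

lemma comp_edgeMap_mem {d : ℕ} {f : E3 → ℝ} (hf : f ∈ polySub 3 d) (e : Edge) :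
    (fun s => f (edgeMap T e s)) ∈ poly1Sub d := line_mem_poly1Sub hf _ _

/-! ## Functions with constant boundary values -/

lemma exists_edge {i j : Fin 4} (h : i ≠ j) :
    ∃ e : Edge, (e.1.1 = i ∧ e.1.2 = j) ∨ (e.1.1 = j ∧ e.1.2 = i) := by
  revert i j; decide

lemma EdgeOf.of_ends {e : Edge} {i j k : Fin 4}
    (he : (e.1.1 = i ∧ e.1.2 = j) ∨ (e.1.1 = j ∧ e.1.2 = i)) (hi : i ≠ k) (hj : j ≠ k) :
    EdgeOf e k := by
  rcases he with ⟨rfl, rfl⟩ | ⟨rfl, rfl⟩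
  exacts [⟨hi, hj⟩, ⟨hj, hi⟩]

lemma eq_of_deriv_edge {e : Edge} {h : E3 → ℝ}
    (hd : Differentiable ℝ fun s => h (edgeMap T e s))
    (h0 : deriv (fun s => h (edgeMap T e s)) = 0) (s : ℝ) :
    h (edgeMap T e s) = h (T.points e.1.1) ∧ h (T.points e.1.2) = h (T.points e.1.1) := by
  have h1 := is_const_of_deriv_eq_zero hd (fun s => congrFun h0 s)
  have h2 := h1 s 0
  have h3 := h1 (edgeLen T e) 0
  simp only [edgeMap_zero, edgeMap_len] at h2 h3
  exact ⟨h2, h3⟩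

/-- The derivative of a function on a face along an edge. -/
lemma deriv_faceCoord_edgeMap {h : E2 → ℝ} {v : E3 → E3} (hh : Differentiable ℝ h) {k : Fin 4}
    (hv : bcurl h = faceTrace T k v) {e : Edge} (he : EdgeOf e k) :
    deriv (fun s => h (faceCoord T k (edgeMap T e s))) = edgeTrace T e v := by
  funext s
  rw [(hasDerivAt_comp_faceCoord T hh k e s).deriv, hv, inner_faceTrace_edgeNormal T he]

lemma exists_ne_mem (k : Fin 4) : ∃ i, i ≠ k := by revert k; decide

/-- The derivative of the potential along an edge is the edge trace of `v`, so the potential is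
constant on each edge. Edges share vertices, hence there is a single boundary constant to subtract.
-/
lemma sub_const_mem_poly0F {p : ℕ} {v : E3 → E3} {k : Fin 4} {h : E2 → ℝ}
    (hm : h ∈ polySub 2 (p + 1)) (hh : bcurl h = faceTrace T k v)
    (he : ∀ e, EdgeOf e k → edgeTrace T e v = 0) :
    ∃ g ∈ poly0FSub T (p + 1) k, bcurl g = faceTrace T k v := by
  have hs := contDiff_of_polySub hm
  have hd := hs.differentiable (by simp)
  have hc : ∀ e, EdgeOf e k → ∀ s, h (faceCoord T k (edgeMap T e s)) =
      h (faceCoord T k (T.points e.1.1)) ∧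
      h (faceCoord T k (T.points e.1.2)) = h (faceCoord T k (T.points e.1.1)) := by
    intro e hek
    refine eq_of_deriv_edge T (h := fun x => h (faceCoord T k x)) (fun s => ?_) ?_
    · exact (hasDerivAt_comp_faceCoord T hd k e s).differentiableAt
    · rw [deriv_faceCoord_edgeMap T hd hh hek, he e hek]
  obtain ⟨i, hi⟩ := exists_ne_mem k
  set c := h (faceCoord T k (T.points i)) with hcdef
  have hv : ∀ j, j ≠ k → h (faceCoord T k (T.points j)) = c := by
    intro j hj
    by_cases hij : j = i
    · rw [hij]
    obtain ⟨e, hee⟩ := exists_edge hij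
    have h1 := (hc e (EdgeOf.of_ends hee hj hi) 0).2
    rcases hee with ⟨rfl, rfl⟩ | ⟨rfl, rfl⟩
    exacts [h1.symm, h1]
  refine ⟨h - fun _ => c, ⟨mem_polySub.1 (sub_mem hm (const_mem_polySub (by positivity) c)), ?_⟩, ?_⟩
  · intro e hek y hy
    obtain ⟨s, _, hs⟩ := exists_of_mem_edge T hy
    have h1 := (hc e hek s).1
    rw [hs, faceCoord_faceMap, hv _ hek.1] at h1
    simp [h1]
  · rw [← hh, LinOn.map_sub bcurl_linOn hs (contDiff_const : ContDiff ℝ ∞ fun _ : E2 => c)]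
    have : bcurl (fun _ => c) = 0 := by
      funext y; ext i; fin_cases i <;> simp [bcurl, partialD]
    rw [this, sub_zero]

lemma exists_poly0F {p : ℕ} {v : E3 → E3} (hv : v ∈ w1Sub p) {k : Fin 4}
    (he : ∀ e, EdgeOf e k → edgeTrace T e v = 0) (hd : div2 (faceTrace T k v) = 0) :
    ∃ g ∈ poly0FSub T (p + 1) k, bcurl g = faceTrace T k v := by
  obtain ⟨h, hm, hh⟩ := exists_potential_faceTrace T hv hd
  exact sub_const_mem_poly0F T hm hh he

lemma fderiv_eq_zero_of_partialD {n : ℕ} {g : EN n → ℝ} {y : EN n} (h : ∀ i, partialD i g y = 0) :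
    fderiv ℝ g y = 0 := by
  ext v
  rw [fderiv_apply_eq_sum]
  simp [h]

lemma const_of_bcurl {g : E2 → ℝ} (hg : Differentiable ℝ g) (h : bcurl g = 0) (x y : E2) :
    g x = g y := by
  refine is_const_of_fderiv_eq_zero hg (fun z => fderiv_eq_zero_of_partialD fun i => ?_) x y
  have h1 := congrArg (fun w : E2 => w 0) (congrFun h z)
  have h2 := congrArg (fun w : E2 => w 1) (congrFun h z)
  fin_cases i
  · simpa [bcurl] using h2
  · simpa [bcurl] using h1

lemma const_of_gradient {n : ℕ} {g : EN n → ℝ} (hg : Differentiable ℝ g) (h : gradient g = 0)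
    (x y : EN n) : g x = g y := by
  refine is_const_of_fderiv_eq_zero hg (fun z => fderiv_eq_zero_of_partialD fun i => ?_) x y
  rw [← gradient_apply, h]; rfl

lemma vertex_mem_face {k j : Fin 4} (h : j ≠ k) : T.points j ∈ face T k := by
  rw [mem_face]
  refine ⟨by rw [lam_vertex, if_neg h.symm], fun i => ?_⟩
  rw [lam_vertex]; split_ifs <;> norm_num

/-- The potential has vanishing surface curl on each face, so it is constant there. Faces meet in
vertices, so all constants agree and can be subtracted. -/
lemma exists_poly0T {p : ℕ} {v : E3 → E3} (hv : v ∈ w10TSub T p) (hc : curl v = 0) :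
    ∃ g ∈ poly0TSub T (p + 1), gradient g = v := by
  obtain ⟨h1, h2⟩ := (mem_w10T T).1 hv
  obtain ⟨φ, hm, hφ⟩ := exists_potential_of_curl h1 hc
  have hs := contDiff_of_polySub hm
  have hd := hs.differentiable (by simp)
  have hk : ∀ k, ∀ x ∈ face T k, ∀ x' ∈ face T k, φ x = φ x' := by
    intro k x hx x' hx'
    have h3 := faceTrace_gradient T hd k
    rw [hφ, h2] at h3
    have h4 := const_of_bcurl ((hs.comp (contDiff_faceMap T k)).differentiable (by simp)) h3.symm
      (faceCoord T k x) (faceCoord T k x')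
    simpa only [Function.comp, faceMap_faceCoord T ((mem_face T).1 hx).1,
      faceMap_faceCoord T ((mem_face T).1 hx').1] using h4
  have hv : ∀ k, ∀ x ∈ face T k, φ x = φ (T.points 0) := by
    intro k x hx
    -- Vertex `j` lies on the faces `k` and `l`, and face `l` also contains vertex 0, where the
    -- reference value is taken.
    obtain ⟨j, hj, l, hl, hl0⟩ : ∃ j, j ≠ k ∧ ∃ l, j ≠ l ∧ 0 ≠ l :=
      (by decide : ∀ k : Fin 4, ∃ j, j ≠ k ∧ ∃ l, j ≠ l ∧ 0 ≠ l) k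
    rw [hk k x hx _ (vertex_mem_face T hj),
      hk l _ (vertex_mem_face T hl) _ (vertex_mem_face T hl0)]
  refine ⟨φ - fun _ => φ (T.points 0),
    ⟨mem_polySub.1 (sub_mem hm (const_mem_polySub (by positivity) _)), ?_⟩, ?_⟩
  · intro k x hx
    simp [hv k x hx]
  · rw [gradient_sub hd (differentiable_const _), hφ]
    have : gradient (fun _ : E3 => φ (T.points 0)) = 0 := by
      funext x; ext i; rw [gradient_apply]; simp [partialD]
    rw [this, sub_zero]

/-! ## The projections -/

lemma poly0E_inj {d : ℕ} {e : Edge} : ∀ g ∈ poly0ESub T d e, deriv g = 0 → g = 0 := by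
  rintro g ⟨h1, h2, _⟩ h
  funext s
  rw [is_const_of_deriv_eq_zero ((contDiff_of_poly1Sub h1).differentiable (by simp))
    (fun s => congrFun h s) s 0, h2]; rfl

lemma poly0F_inj {d : ℤ} {k : Fin 4} : ∀ g ∈ poly0FSub T d k, bcurl g = 0 → g = 0 := by
  intro g hg h
  have hd := (contDiff_of_polySub (poly0FSub_le T d k hg)).differentiable (by simp)
  obtain ⟨e, he, _⟩ := exists_edge_of_ne ((by decide : ∀ k : Fin 4, k ≠ k + 1) k)
  funext y
  rw [const_of_bcurl hd h y (faceCoord T k (T.points e.1.1))]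
  refine hg.2 e he _ ?_
  rw [← edgeMap_zero, faceMap_faceCoord_edgeMap T he]
  exact edgeMap_mem_edge T ⟨le_rfl, (edgeLen_pos T e).le⟩

lemma poly0T_inj {d : ℤ} : ∀ g ∈ poly0TSub T d, gradient g = 0 → g = 0 := by
  intro g hg h
  have hd := (contDiff_of_polySub (poly0TSub_le T d hg)).differentiable (by simp)
  funext x
  rw [const_of_gradient hd h x (T.points 1)]
  exact hg.2 0 _ (vertex_mem_face T (by decide))

lemma negInner_contSub_left {V : Type*} [NormedAddCommGroup V] [InnerProductSpace ℝ V]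
    [MeasureSpace V] [BorelSpace V] [FiniteDimensional ℝ V] [(volume : Measure V).IsAddHaarMeasure]
    (s : ℝ) {D : Set V} (hD : IsCompact D) (w : V → ℝ) :
    LinOn (contSub V ℝ : Set (V → ℝ)) fun u => negInner s D u w :=
  (negInner_linOn_left s D w).mono fun _ hu => memLp_of_continuous hD hu

lemma negInner_contSub_right {V : Type*} [NormedAddCommGroup V] [InnerProductSpace ℝ V]
    [MeasureSpace V] [BorelSpace V] [FiniteDimensional ℝ V] [(volume : Measure V).IsAddHaarMeasure]
    (s : ℝ) {D : Set V} (hD : IsCompact D) (u : V → ℝ) :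
    LinOn (contSub V ℝ : Set (V → ℝ)) fun w => negInner s D u w :=
  (negInner_linOn_right s D u).mono fun _ hu => memLp_of_continuous hD hu

lemma interior_edgeDom_infinite (e : Edge) : (interior (edgeDom T e)).Infinite := by
  rw [edgeDom, interior_Icc]
  exact Ioo_infinite (edgeLen_pos T e)

variable {p : ℕ} {ε : ℝ}

/-- Positivity of `ε` keeps the order `1 - ε` below 1, so test functions have finite norm and the
dual form is definite on polynomials. -/
lemma projectsOn_edge (h0 : 0 < ε) (e : Edge) : ProjectsOn (negInner (1 - ε) (edgeDom T e))
    (contSub ℝ ℝ) (poly0ESub T (p + 1) e) deriv where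
  fd := inferInstance
  lin := deriv_linOn.mono fun g hg => contDiff_of_poly1Sub hg.1
  maps g hg := (contDiff_of_poly1Sub (deriv_mem_poly1Sub hg.1)).continuous
  left w _ := negInner_contSub_left _ isCompact_Icc w
  right u _ := negInner_contSub_right _ isCompact_Icc u
  definite g hg h := by
    have hm := deriv_mem_poly1Sub hg.1
    have hc := (contDiff_of_poly1Sub hm).continuous
    exact poly1_eq_zero hm (interior_edgeDom_infinite T e) (eqOn_zero_of_negInner_self (by linarith)
      (by simp) isCompact_Icc.measurableSet isCompact_Icc.isBounded hc
      (memLp_of_continuous isCompact_Icc hc) h)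

lemma bcurl_mem_vpolySub {d : ℤ} {g : E2 → ℝ} (hg : g ∈ polySub 2 (d + 1)) :
    bcurl g ∈ vpolySub 2 d := by
  have h := fun i => partialD_mem_polySub hg i
  rw [add_sub_cancel_right] at h
  intro i
  fin_cases i
  · exact h 1
  · exact neg_mem (h 0)

lemma projectsOn_face (h0 : 0 < ε) (k : Fin 4) : ProjectsOn (negInnerF T ε k)
    (contSub E2 E2) (poly0FSub T (p + 1) k) bcurl where
  fd := inferInstance
  lin := bcurl_linOn.mono fun g hg => contDiff_of_polySub (poly0FSub_le T _ k hg)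
  maps g hg := (contDiff_of_vpolySub (bcurl_mem_vpolySub (poly0FSub_le T _ k hg))).continuous
  left w _ := by
    refine LinOn.sum _ fun i => ?_
    intro u hu v hv a b
    have h1 : Continuous fun y => u y i := by have : Continuous u := hu; fun_prop
    have h2 : Continuous fun y => v y i := by have : Continuous v := hv; fun_prop
    exact negInner_contSub_left (1 / 2 - ε) (isCompact_faceDom T k) (fun y => w y i) _ h1 _ h2 a b
  right w _ := by
    refine LinOn.sum _ fun i => ?_
    intro u hu v hv a b
    have h1 : Continuous fun y => u y i := by have : Continuous u := hu; fun_prop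
    have h2 : Continuous fun y => v y i := by have : Continuous v := hv; fun_prop
    exact negInner_contSub_right (1 / 2 - ε) (isCompact_faceDom T k) (fun y => w y i) _ h1 _ h2 a b
  definite g hg h := by
    have hm := bcurl_mem_vpolySub (poly0FSub_le T _ k hg)
    rw [negInnerF, Finset.sum_eq_zero_iff_of_nonneg fun i _ => negInner_self_nonneg _ _ _] at h
    refine vpoly_eq_zero_of_open hm (isOpen_openFace T k) (openFace_nonempty T k) fun y hy => ?_
    ext i
    have hc : Continuous fun y => bcurl g y i := (contDiff_of_polySub (hm i)).continuous
    exact eqOn_zero_of_negInner_self (by linarith) (by simp) (isCompact_faceDom T k).measurableSet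
      (isCompact_faceDom T k).isBounded hc (memLp_of_continuous (isCompact_faceDom T k) hc)
      (h i (Finset.mem_univ i)) y (openFace_subset T k hy)

lemma div2_mem_polySub {d : ℤ} {w : E2 → E2} (hw : w ∈ vpolySub 2 (d + 1)) :
    div2 w ∈ polySub 2 d := by
  have hd := (contDiff_of_vpolySub hw).differentiable (by simp)
  have h : div2 w = partialD 0 (fun y => w y 0) + partialD 1 (fun y => w y 1) := by
    funext y
    simp only [div2, partialD_apply (hd y), Pi.add_apply]
  rw [h]
  have := fun i => partialD_mem_polySub (hw i) i
  rw [add_sub_cancel_right] at this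
  exact add_mem (this 0) (this 1)

lemma projectsOn_div (h0 : 0 < ε) (k : Fin 4) : ProjectsOn (negInner (1 / 2 - ε) (faceDom T k))
    (contSub E2 ℝ) (w10FSub T p k) div2 where
  fd := inferInstance
  lin := div2_linOn.mono fun g hg => contDiff_of_vpolySub (w10FSub_le T p k hg)
  maps g hg := (contDiff_of_polySub (div2_mem_polySub (w10FSub_le T p k hg))).continuous
  left w _ := negInner_contSub_left _ (isCompact_faceDom T k) w
  right u _ := negInner_contSub_right _ (isCompact_faceDom T k) u
  definite g hg h := by
    have hm := div2_mem_polySub (w10FSub_le T p k hg)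
    have hc := (contDiff_of_polySub hm).continuous
    exact poly_eq_zero_of_open hm (isOpen_openFace T k) (openFace_nonempty T k) fun y hy =>
      eqOn_zero_of_negInner_self (by linarith) (by simp) (isCompact_faceDom T k).measurableSet
      (isCompact_faceDom T k).isBounded hc (memLp_of_continuous (isCompact_faceDom T k) hc) h y
      (openFace_subset T k hy)

lemma eq_zero_of_l2Inner_self {d : ℤ} {v : E3 → E3} (hv : v ∈ vpolySub 3 d)
    (h : l2Inner T v v = 0) : v = 0 := by
  have hc := (contDiff_of_vpolySub hv).continuous
  refine vpoly_eq_zero_of_open hv (isOpen_openCell T) (openCell_nonempty T) fun x hx => ?_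
  simpa using eqOn_zero_of_setIntegral (isCompact_cell T) (F := fun x => inner ℝ (v x) (v x))
    (by fun_prop) (fun x _ => real_inner_self_nonneg) h x (openCell_subset T hx)

lemma projectsOn_grad : ProjectsOn (l2Inner T) (contSub E3 E3) (poly0TSub T (p + 1)) gradient where
  fd := inferInstance
  lin := gradient_linOn.mono fun g hg => contDiff_of_polySub (poly0TSub_le T _ hg)
  maps g hg := (contDiff_of_vpolySub (gradient_mem_vpolySub (poly0TSub_le T _ hg))).continuous
  left w hw := integral_inner_linOn_left (isCompact_cell T) hw
  right u hu := integral_inner_linOn_right (isCompact_cell T) hu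
  definite g hg h := eq_zero_of_l2Inner_self T (gradient_mem_vpolySub (poly0TSub_le T _ hg)) h

lemma curl_mem_vpolySub {d : ℤ} {v : E3 → E3} (hv : v ∈ vpolySub 3 (d + 1)) :
    curl v ∈ vpolySub 3 d := by
  have hd := (contDiff_of_vpolySub hv).differentiable (by simp)
  have h := fun i j => partialD_mem_polySub (hv j) i
  rw [add_sub_cancel_right] at h
  have h' : ∀ i j, (fun x => partialD i v x j) ∈ polySub 3 d := by
    intro i j
    simp only [partialD_apply (hd _)]
    exact h i j
  intro i
  fin_cases i
  · exact sub_mem (h' 1 2) (h' 2 1)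
  · exact sub_mem (h' 2 0) (h' 0 2)
  · exact sub_mem (h' 0 1) (h' 1 0)

lemma projectsOn_curl : ProjectsOn (l2Inner T) (contSub E3 E3) (w10TSub T p) curl where
  fd := inferInstance
  lin := curl_linOn.mono fun g hg => contDiff_of_w1Sub hg.1
  maps g hg := (contDiff_of_vpolySub (curl_mem_vpolySub (w1Sub_le p hg.1))).continuous
  left w hw := integral_inner_linOn_left (isCompact_cell T) hw
  right u hu := integral_inner_linOn_right (isCompact_cell T) hu
  definite g hg h := eq_zero_of_l2Inner_self T (curl_mem_vpolySub (w1Sub_le p hg.1)) h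

/-! ## The liftings of potentials -/

lemma lift1E_deriv {e : Edge} {g : ℝ → ℝ} (hg : g ∈ poly0ESub T (p + 1) e) :
    lift1E T p e (deriv g) = g :=
  lift_eq (deriv_linOn.mono fun g hg => contDiff_of_poly1Sub (poly0ESub_le T _ e hg)) (poly0E_inj T)
    hg

lemma lift1F_bcurl {k : Fin 4} {g : E2 → ℝ} (hg : g ∈ poly0FSub T (p + 1) k) :
    lift1F T p k (bcurl g) = g :=
  lift_eq (bcurl_linOn.mono fun g hg => contDiff_of_polySub (poly0FSub_le T _ k hg))
    (poly0F_inj T) hg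

lemma lift1T_gradient {g : E3 → ℝ} (hg : g ∈ poly0TSub T (p + 1)) :
    lift1T T p (gradient g) = g :=
  lift_eq (gradient_linOn.mono fun g hg => contDiff_of_polySub (poly0TSub_le T _ hg))
    (poly0T_inj T) hg

lemma lift1E_mem (e : Edge) (u : ℝ → ℝ) : lift1E T p e u ∈ poly0ESub T (p + 1) e := lift_mem _

lemma lift1F_mem (k : Fin 4) (u : E2 → E2) : lift1F T p k u ∈ poly0FSub T (p + 1) k := lift_mem _

lemma lift1T_mem (u : E3 → E3) : lift1T T p u ∈ poly0TSub T (p + 1) := lift_mem _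

lemma lift1E_linOn (e : Edge) :
    LinOn (deriv '' (poly0ESub T (p + 1) e : Set (ℝ → ℝ))) (lift1E T p e) :=
  lift_linOn (deriv_linOn.mono fun g hg => contDiff_of_poly1Sub hg.1) (poly0E_inj T)

lemma lift1F_linOn (k : Fin 4) :
    LinOn (bcurl '' (poly0FSub T (p + 1) k : Set (E2 → ℝ))) (lift1F T p k) :=
  lift_linOn (bcurl_linOn.mono fun g hg => contDiff_of_polySub (poly0FSub_le T _ k hg))
    (poly0F_inj T)

lemma lift1T_linOn :
    LinOn (gradient '' (poly0TSub T (p + 1) : Set (E3 → ℝ))) (lift1T T p) :=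
  lift_linOn (gradient_linOn.mono fun g hg => contDiff_of_polySub (poly0TSub_le T _ hg))
    (poly0T_inj T)

/-! ## Traces of extended polynomials -/

section Extension

variable {T : Tetrahedron} {p : ℕ} (X : ExtensionOperators T p)

lemma ExtensionOperators.E_mem {e : Edge} {u : ℝ → ℝ} (hu : u ∈ poly0ESub T (p + 1) e) :
    X.E e u ∈ polySub 3 (p + 1) := mem_polySub.2 (X.E_poly e u hu)

lemma ExtensionOperators.F_mem {k : Fin 4} {u : E2 → ℝ} (hu : u ∈ poly0FSub T (p + 1) k) :
    X.F k u ∈ polySub 3 (p + 1) := mem_polySub.2 (X.F_poly k u hu)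

/-- Extensions are prescribed on the closed edge only, whereas the liftings compare functions on the
whole line; polynomials do not see the difference. -/
lemma ExtensionOperators.E_comp_self {e : Edge} {u : ℝ → ℝ} (hu : u ∈ poly0ESub T (p + 1) e) :
    (fun s => X.E e u (edgeMap T e s)) = u :=
  poly1_eq_of_edgeDom T (comp_edgeMap_mem T (X.E_mem hu) e) hu.1 e (X.E_self e u hu)

lemma ExtensionOperators.E_comp_other {e e' : Edge} (h : e' ≠ e) {u : ℝ → ℝ}
    (hu : u ∈ poly0ESub T (p + 1) e) : (fun s => X.E e u (edgeMap T e' s)) = 0 :=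
  poly1_eq_of_edgeDom T (comp_edgeMap_mem T (X.E_mem hu) e') (zero_mem _) e' fun _ hs =>
    X.E_other e u hu e' h _ (edgeMap_mem_edge T hs)

lemma ExtensionOperators.F_comp_self {k : Fin 4} {u : E2 → ℝ} (hu : u ∈ poly0FSub T (p + 1) k) :
    (fun y => X.F k u (faceMap T k y)) = u :=
  poly_eq_of_faceDom T (faceMap_comp_mem T (X.F_mem hu) k) (poly0FSub_le T _ k hu) k
    (X.F_self k u hu)

lemma ExtensionOperators.F_comp_other {k j : Fin 4} (h : j ≠ k) {u : E2 → ℝ}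
    (hu : u ∈ poly0FSub T (p + 1) k) : (fun y => X.F k u (faceMap T j y)) = 0 :=
  poly_eq_of_faceDom T (faceMap_comp_mem T (X.F_mem hu) j) (zero_mem _) j fun _ hy =>
    X.F_other k u hu j h _ hy

lemma ExtensionOperators.edgeTrace_E_self {e : Edge} {u : ℝ → ℝ}
    (hu : u ∈ poly0ESub T (p + 1) e) : edgeTrace T e (gradient (X.E e u)) = deriv u := by
  rw [← deriv_comp_edgeMap T ((contDiff_of_polySub (X.E_mem hu)).differentiable (by simp)),
    X.E_comp_self hu]

lemma ExtensionOperators.edgeTrace_E_other {e e' : Edge} (h : e' ≠ e) {u : ℝ → ℝ}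
    (hu : u ∈ poly0ESub T (p + 1) e) : edgeTrace T e' (gradient (X.E e u)) = 0 := by
  rw [← deriv_comp_edgeMap T ((contDiff_of_polySub (X.E_mem hu)).differentiable (by simp)),
    X.E_comp_other h hu]
  exact deriv_const' 0

lemma ExtensionOperators.faceTrace_F_self {k : Fin 4} {u : E2 → ℝ}
    (hu : u ∈ poly0FSub T (p + 1) k) : faceTrace T k (gradient (X.F k u)) = bcurl u := by
  rw [faceTrace_gradient T ((contDiff_of_polySub (X.F_mem hu)).differentiable (by simp)),
    X.F_comp_self hu]

lemma bcurl_zero : bcurl 0 = 0 :=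
  LinOn.map_zero bcurl_linOn

lemma ExtensionOperators.faceTrace_F_other {k j : Fin 4} (h : j ≠ k) {u : E2 → ℝ}
    (hu : u ∈ poly0FSub T (p + 1) k) : faceTrace T j (gradient (X.F k u)) = 0 := by
  rw [faceTrace_gradient T ((contDiff_of_polySub (X.F_mem hu)).differentiable (by simp)),
    X.F_comp_other h hu, bcurl_zero]

lemma ExtensionOperators.grad_E_mem {e : Edge} {u : ℝ → ℝ} (hu : u ∈ poly0ESub T (p + 1) e) :
    gradient (X.E e u) ∈ w1Sub p := gradient_mem_w1Sub (X.E_mem hu)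

lemma ExtensionOperators.grad_F_mem {k : Fin 4} {u : E2 → ℝ} (hu : u ∈ poly0FSub T (p + 1) k) :
    gradient (X.F k u) ∈ w1Sub p := gradient_mem_w1Sub (X.F_mem hu)

lemma ExtensionOperators.grad_E_linOn (e : Edge) :
    LinOn (poly0ESub T (p + 1) e : Set (ℝ → ℝ)) fun u => gradient (X.E e u) :=
  gradient_linOn.comp (LinearMap.linOn _ (X.E e)) fun _ hu => contDiff_of_polySub (X.E_mem hu)

lemma ExtensionOperators.grad_F_linOn (k : Fin 4) :
    LinOn (poly0FSub T (p + 1) k : Set (E2 → ℝ)) fun u => gradient (X.F k u) :=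
  gradient_linOn.comp (LinearMap.linOn _ (X.F k)) fun _ hu => contDiff_of_polySub (X.F_mem hu)

end Extension

/-! ## The lifting of the divergence -/

lemma coneAvg_linOn {n : ℕ} (a : EN n) : LinOn (contSub (EN n) ℝ : Set (EN n → ℝ)) (coneAvg a) := by
  intro u hu v hv α β
  have hu' : Continuous u := hu
  have hv' : Continuous v := hv
  funext x
  have h1 : IntervalIntegrable (fun t => α * (t * u (a + t • (x - a)))) volume 0 1 :=
    (by fun_prop : Continuous _).intervalIntegrable _ _
  have h2 : IntervalIntegrable (fun t => β * (t * v (a + t • (x - a)))) volume 0 1 :=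
    (by fun_prop : Continuous _).intervalIntegrable _ _
  simp only [coneAvg, Pi.add_apply, Pi.smul_apply, smul_eq_mul]
  rw [← intervalIntegral.integral_const_mul, ← intervalIntegral.integral_const_mul,
    ← intervalIntegral.integral_add h1 h2]
  congr 1; funext t; ring

lemma poincare2_linOn (a : E2) : LinOn (contSub E2 ℝ : Set (E2 → ℝ)) (poincare2 a) := by
  intro u hu v hv α β
  simp only [poincare2_eq, coneAvg_linOn a u hu v hv]
  funext y
  simp only [Pi.add_apply, Pi.smul_apply, smul_eq_mul]
  module

lemma poincare3_linOn (a : E3) : LinOn (contSub E3 E3 : Set (E3 → E3)) (poincare3 a) := by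
  intro u hu v hv α β
  have h : Continuous (α • u + β • v) := add_mem (Submodule.smul_mem (contSub E3 E3) α hu)
    (Submodule.smul_mem (contSub E3 E3) β hv)
  rw [poincare3_eq a hu, poincare3_eq a hv, poincare3_eq a h]
  have hc : coneAvgField a (α • u + β • v) = α • coneAvgField a u + β • coneAvgField a v := by
    funext x
    ext i
    have h1 : Continuous fun x => u x i := by have : Continuous u := hu; fun_prop
    have h2 : Continuous fun x => v x i := by have : Continuous v := hv; fun_prop
    exact congrFun (coneAvg_linOn a _ h1 _ h2 α β) x
  funext x
  simp only [hc, Pi.add_apply, Pi.smul_apply, cross_add_left, cross_smul_left]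

section Lift

variable {T : Tetrahedron} {p : ℕ} (X : ExtensionOperators T p) (c : LiftingChoice)

lemma LiftingChoice.edgeOf (k : Fin 4) : EdgeOf (c.faceEdge k) k := by
  have h := c.opposite k
  unfold EdgeOf
  revert h
  generalize c.faceVertex k = a
  generalize c.faceEdge k = e
  revert k a e
  decide

lemma LiftingChoice.vertex_ne (k : Fin 4) : c.faceVertex k ≠ k := by
  have h := c.opposite k
  revert h
  generalize c.faceVertex k = a
  generalize c.faceEdge k = e
  revert k a e
  decide

lemma LiftingChoice.ends_ne (k : Fin 4) :
    (c.faceEdge k).1.1 ≠ c.faceVertex k ∧ (c.faceEdge k).1.2 ≠ c.faceVertex k := by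
  have h := c.opposite k
  revert h
  generalize c.faceVertex k = a
  generalize c.faceEdge k = e
  revert k a e
  decide

lemma LiftingChoice.vertex_mem {k : Fin 4} {e : Edge} (he : EdgeOf e k) (hne : e ≠ c.faceEdge k) :
    e.1.1 = c.faceVertex k ∨ e.1.2 = c.faceVertex k := by
  have h := c.opposite k
  unfold EdgeOf at he
  revert h he hne
  generalize c.faceVertex k = a
  generalize c.faceEdge k = e'
  revert k a e e'
  decide

lemma inner_faceComp_edgeTan_edgeNormal (e : Edge) (k : Fin 4) :
    inner ℝ (faceComp T k (edgeTan T e)) (edgeNormal T e k) = 0 := by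
  rw [edgeNormal, faceComp_cross_normal, inner_E2]
  simp [faceComp]; ring

/-- An edge through the base point is itself radial. Hence the Poincaré lifting has a normal
component only on the opposite edge. -/
lemma radial_tangent {e : Edge} {i : Fin 4} (h : e.1.1 = i ∨ e.1.2 = i) (k : Fin 4) (s : ℝ) :
    inner ℝ (faceCoord T k (edgeMap T e s) - faceCoord T k (T.points i)) (edgeNormal T e k) = 0 := by
  rcases h with rfl | rfl
  · rw [faceCoord_edgeMap, add_sub_cancel_left, inner_smul_left,
      inner_faceComp_edgeTan_edgeNormal, mul_zero]
  · rw [← edgeMap_len, faceCoord_edgeMap, faceCoord_edgeMap, add_sub_add_left_eq_sub, ← sub_smul,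
      inner_smul_left, inner_faceComp_edgeTan_edgeNormal, mul_zero]

/-- The normal component of the Poincaré lifting on the edge opposite to its base point. -/
def liftEdge (T : Tetrahedron) (c : LiftingChoice) (k : Fin 4) (u : E2 → ℝ) (s : ℝ) : ℝ :=
  inner ℝ (poincare2 (faceCoord T k (T.points (c.faceVertex k))) u
    (faceCoord T k (edgeMap T (c.faceEdge k) s))) (edgeNormal T (c.faceEdge k) k)

lemma lift2F_eq (k : Fin 4) (u : E2 → ℝ) : lift2F X c k u =
    poincare2 (faceCoord T k (T.points (c.faceVertex k))) u -
      bcurl fun y => X.E (c.faceEdge k) (lift1E T p (c.faceEdge k) (liftEdge T c k u))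
        (faceMap T k y) := rfl

lemma exists_radial {k : Fin 4} {u : E2 → ℝ} (hu : u ∈ polySub 2 p) (i : Fin 4) :
    ∃ v ∈ w1Sub p, faceTrace T k v = poincare2 (faceCoord T k (T.points i)) u ∧
      ∀ e, EdgeOf e k → (e.1.1 = i ∨ e.1.2 = i) → edgeTrace T e v = 0 := by
  obtain ⟨v, hv, h⟩ := exists_faceTrace_radial T k (coneAvg_mem (faceCoord T k (T.points i)) hu)
    (faceCoord T k (T.points i))
  refine ⟨v, hv, by rw [h, poincare2_eq], fun e he hi => ?_⟩
  funext s
  rw [← inner_faceTrace_edgeNormal T he, h]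
  simp only [inner_smul_left, radial_tangent hi, mul_zero]; rfl

/-- The Poincaré lifting and `w` have the same divergence, so they differ by the curl of some `φ`.
On the edges through the base vertex neither has a normal component, so `φ` is constant there and
takes equal values at both ends of the opposite edge. Along that edge the derivative of `φ` is the
normal component in question. -/
lemma liftEdge_mem {k : Fin 4} {w : E2 → E2} (hw : w ∈ w10FSub T p k) :
    liftEdge T c k (div2 w) ∈ deriv '' (poly0ESub T (p + 1) (c.faceEdge k) : Set (ℝ → ℝ)) := by
  obtain ⟨v, hv, rfl, hve⟩ := (mem_w10F T).1 hw
  have hu := div2_mem_polySub (faceTrace_mem T hv k)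
  obtain ⟨v', hv', h, he⟩ := exists_radial (k := k) hu (c.faceVertex k)
  have hL : liftEdge T c k (div2 (faceTrace T k v)) = edgeTrace T (c.faceEdge k) v' := by
    funext s
    rw [liftEdge, ← h, inner_faceTrace_edgeNormal T (c.edgeOf k)]
  obtain ⟨φ, hm, hφ⟩ := exists_potential_faceTrace T (sub_mem hv' hv) (k := k) (by
    rw [faceTrace_sub, LinOn.map_sub div2_linOn (faceTrace_mem_smooth T (contDiff_of_w1Sub hv') k)
      (faceTrace_mem_smooth T (contDiff_of_w1Sub hv) k), h, div2_poincare2 _ hu, sub_self])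
  have hd := (contDiff_of_polySub hm).differentiable (by simp)
  have hde : ∀ e, EdgeOf e k → deriv (fun s => φ (faceCoord T k (edgeMap T e s))) =
      edgeTrace T e v' := by
    intro e hek
    rw [deriv_faceCoord_edgeMap T hd hφ hek, edgeTrace_sub, hve e hek, sub_zero]
  have hend : ∀ j, j ≠ k → j ≠ c.faceVertex k →
      φ (faceCoord T k (T.points j)) = φ (faceCoord T k (T.points (c.faceVertex k))) := by
    intro j hjk hja
    obtain ⟨e, hee⟩ := exists_edge hja
    have hek := EdgeOf.of_ends hee hjk (c.vertex_ne k)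
    have h1 := (eq_of_deriv_edge T (e := e) (h := fun x => φ (faceCoord T k x))
      (fun s => (hasDerivAt_comp_faceCoord T hd k e s).differentiableAt)
      (by rw [hde e hek, he e hek (by rcases hee with h | h; exacts [Or.inr h.2, Or.inl h.1])]) 0).2
    rcases hee with ⟨rfl, h2⟩ | ⟨h2, rfl⟩
    · rw [← h1, h2]
    · rw [h1, h2]
  set e := c.faceEdge k with hedef
  set C := φ (faceCoord T k (T.points (c.faceVertex k)))
  have hek : EdgeOf e k := c.edgeOf k
  refine ⟨(fun s => φ (faceCoord T k (edgeMap T e s))) - fun _ => C, ⟨?_, ?_, ?_⟩, ?_⟩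
  · exact sub_mem (comp_edgeMap_mem T (d := p + 1) (by exact_mod_cast faceCoord_comp_mem T hm k) e)
      (const_mem_poly1Sub _ C)
  · simp [edgeMap_zero, hend _ hek.1 (c.ends_ne k).1, C]
  · simp [edgeMap_len, hend _ hek.2 (c.ends_ne k).2, C]
  · rw [hL, ← hde e hek]
    funext s
    exact deriv_sub_const C

/-- The correction is divergence-free, cancels the normal component on the opposite edge and has
none on the others. It is the trace of a gradient, so the result stays in the trace space. -/
lemma lift2F_spec {k : Fin 4} {w : E2 → E2} (hw : w ∈ w10FSub T p k) :
    lift2F X c k (div2 w) ∈ w10FSub T p k ∧ div2 (lift2F X c k (div2 w)) = div2 w := by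
  obtain ⟨g, hg, hge⟩ := liftEdge_mem c hw
  obtain ⟨v, hv, rfl, hve⟩ := (mem_w10F T).1 hw
  have hu := div2_mem_polySub (faceTrace_mem T hv k)
  obtain ⟨v', hv', h, he⟩ := exists_radial (k := k) hu (c.faceVertex k)
  have hL : liftEdge T c k (div2 (faceTrace T k v)) = edgeTrace T (c.faceEdge k) v' := by
    funext s
    rw [liftEdge, ← h, inner_faceTrace_edgeNormal T (c.edgeOf k)]
  have hG := X.E_mem hg
  have hGd := (contDiff_of_polySub hG).differentiable (by simp)
  have heq : lift2F X c k (div2 (faceTrace T k v)) =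
      faceTrace T k (v' - gradient (X.E (c.faceEdge k) g)) := by
    rw [lift2F_eq, ← hge, lift1E_deriv T hg, ← h, faceTrace_sub, faceTrace_gradient T hGd]
  rw [heq]
  have hgm := X.grad_E_mem hg
  constructor
  · refine (mem_w10F T).2 ⟨_, sub_mem hv' hgm, rfl, fun e hek => ?_⟩
    rw [edgeTrace_sub]
    by_cases hee : e = c.faceEdge k
    · rw [hee, X.edgeTrace_E_self hg, hge, hL, sub_self]
    · rw [X.edgeTrace_E_other hee hg, he e hek (c.vertex_mem hek hee), sub_self]
  · rw [faceTrace_sub, LinOn.map_sub div2_linOn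
      (faceTrace_mem_smooth T (contDiff_of_w1Sub hv') k)
      (faceTrace_mem_smooth T (contDiff_of_w1Sub hgm) k), h, div2_poincare2 _ hu,
      div2_faceTrace_gradient T (contDiff_of_polySub hG), sub_zero]

lemma lift2F_linOn (k : Fin 4) :
    LinOn (div2 '' (w10FSub T p k : Set (E2 → E2))) (lift2F X c k) := by
  have hS : div2 '' (w10FSub T p k : Set (E2 → E2)) ⊆ polySub 2 p := by
    rintro _ ⟨w, hw, rfl⟩
    exact div2_mem_polySub (w10FSub_le T p k hw)
  have hP := (poincare2_linOn (faceCoord T k (T.points (c.faceVertex k)))).mono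
    fun u hu => (contDiff_of_polySub (hS hu)).continuous
  refine hP.sub ?_
  have h1 : LinOn (div2 '' (w10FSub T p k : Set (E2 → E2))) (liftEdge T c k) := by
    intro u hu v hv a b
    funext s
    simp only [liftEdge, hP u hu v hv, Pi.add_apply, Pi.smul_apply, inner_add_left, inner_smul_left,
      RCLike.conj_to_real, smul_eq_mul]
  have h2 : LinOn (div2 '' (w10FSub T p k : Set (E2 → E2)))
      fun u => lift1E T p (c.faceEdge k) (liftEdge T c k u) :=
    (lift1E_linOn T _).comp h1 (by rintro _ ⟨w, hw, rfl⟩; exact liftEdge_mem c hw)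
  have h3 : LinOn (poly0ESub T (p + 1) (c.faceEdge k) : Set (ℝ → ℝ))
      fun g y => X.E (c.faceEdge k) g (faceMap T k y) := by
    intro u hu v hv a b
    funext y
    simp
  have h4 := h3.comp h2 fun u _ => lift1E_mem T _ _
  exact bcurl_linOn.comp h4 fun u _ =>
    contDiff_of_polySub (faceMap_comp_mem T (X.E_mem (lift1E_mem T _ _)) k)

/-! ## The lifting of the curl -/

lemma sum_partialD_curl {v : E3 → E3} (hv : ContDiff ℝ ∞ v) (x : E3) :
    ∑ i, partialD i (fun x => curl v x i) x = 0 := by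
  have hd : Differentiable ℝ v := hv.differentiable (by simp)
  have hs : ∀ j, ContDiff ℝ ∞ fun x => v x j := contDiff_apply hv
  have hp : ∀ i j, DifferentiableAt ℝ (partialD i fun x => v x j) x := fun i j =>
    smoothSub.differentiable (partialD_mem (hs j) i) x
  have h0 : (fun x => curl v x 0) = fun x =>
      partialD 1 (fun x => v x 2) x - partialD 2 (fun x => v x 1) x := by
    funext x; simp [curl, partialD_apply (hd x)]
  have h1 : (fun x => curl v x 1) = fun x =>
      partialD 2 (fun x => v x 0) x - partialD 0 (fun x => v x 2) x := by
    funext x; simp [curl, partialD_apply (hd x)]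
  have h2 : (fun x => curl v x 2) = fun x =>
      partialD 0 (fun x => v x 1) x - partialD 1 (fun x => v x 0) x := by
    funext x; simp [curl, partialD_apply (hd x)]
  rw [Fin.sum_univ_three, h0, h1, h2, partialD_sub (hp 1 2) (hp 2 1), partialD_sub (hp 2 0) (hp 0 2),
    partialD_sub (hp 0 1) (hp 1 0), partialD_comm (hs 2) x 0 1, partialD_comm (hs 1) x 0 2,
    partialD_comm (hs 0) x 1 2]
  ring

lemma curl_inner_normal {v : E3 → E3} (hv : Differentiable ℝ v) {k : Fin 4}
    (h : faceTrace T k v = 0) {x : E3} (hx : lam T k x = 0) :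
    inner ℝ (curl v x) (normal T k) = 0 := by
  have h1 := div2_faceTrace T hv k (faceCoord T k x)
  rw [faceMap_faceCoord T hx] at h1
  rw [← h1, h, LinOn.map_zero div2_linOn]; rfl

lemma inner_coneAvgField (a : E3) {u : E3 → E3} (hu : Continuous u) (x w : E3) :
    inner ℝ (coneAvgField a u x) w = coneAvg a (fun x => inner ℝ (u x) w) x := by
  have hc : ∀ i, Continuous fun x => u x i := fun i => by fun_prop
  have h := fun i j => congrFun (coneAvg_linOn a _ (hc i) _ (hc j) (w i) (w j)) x
  have h01 := congrFun (coneAvg_linOn a _ (add_mem (Submodule.smul_mem (contSub E3 ℝ) (w 0) (hc 0))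
    (Submodule.smul_mem (contSub E3 ℝ) (w 1) (hc 1))) _ (hc 2) 1 (w 2)) x
  have h1 : (fun x => inner ℝ (u x) w) = (1 : ℝ) • ((w 0 • fun x => u x 0) + w 1 • fun x => u x 1) +
      w 2 • fun x => u x 2 := by
    funext x
    simp [inner_E3]; ring
  have h2 := h 0 1
  simp only [Pi.add_apply, Pi.smul_apply, smul_eq_mul] at h01 h2
  rw [h1, h01, h2, inner_E3]
  simp only [coneAvgField_apply]; ring

/-- On the plane of a face through the base point, the segments to that point stay in the plane. The
average of `u` and the vector `x - a` are then both tangential, and their vector product is normal.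
-/
lemma faceTrace_poincare3 {u : E3 → E3} (hu : Continuous u) {i k : Fin 4} (hik : i ≠ k)
    (h : ∀ x, lam T k x = 0 → inner ℝ (u x) (normal T k) = 0) :
    faceTrace T k (poincare3 (T.points i) u) = 0 := by
  funext y
  set x := faceMap T k y with hxdef
  have hx : lam T k x = 0 := lam_faceMap T k y
  have hi : lam T k (T.points i) = 0 := by rw [lam_vertex, if_neg hik.symm]
  have hg : inner ℝ (glam T k) (x - T.points i) = 0 := by rw [← lam_sub, hx, hi, sub_zero]
  have hC : inner ℝ (coneAvgField (T.points i) u x) (normal T k) = 0 := by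
    rw [inner_coneAvgField _ hu, coneAvg]
    have : ∀ t : ℝ, inner ℝ (u (T.points i + t • (x - T.points i))) (normal T k) = 0 := by
      intro t
      refine h _ ?_
      have := lam_sub T k (T.points i + t • (x - T.points i)) (T.points i)
      rwa [hi, sub_zero, add_sub_cancel_left, inner_smul_right, hg, mul_zero] at this
    simp [this]
  have hn := inner_normal_eq_zero T hg
  have hcr : cross (cross (coneAvgField (T.points i) u x) (x - T.points i)) (normal T k) = 0 := by
    have hanti : ∀ a b : E3, cross a b = -cross b a := by
      intro a b; ext j; fin_cases j <;> simp [cross_eq] <;> ring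
    rw [hanti, cross_cross_right, real_inner_comm, hn, real_inner_comm, hC]; simp
  rw [faceTrace, poincare3_eq _ hu]
  simp only [← hxdef]
  rw [hcr]
  ext j; fin_cases j <;> simp [faceComp]

lemma poincare3_mem (a : E3) {u : E3 → E3} (hu : u ∈ vpolySub 3 p) : poincare3 a u ∈ w1Sub p := by
  rw [poincare3_eq a (contDiff_of_vpolySub hu).continuous]
  exact cross_sub_mem_w1Sub (coneAvgField_mem a hu) a

/-- A field without tangential trace has a curl without normal component. So the lifting has no
trace on the faces through the base point, hence no edge traces. On the opposite face its trace has
divergence `curl v · n = 0` and is the curl of a polynomial vanishing on the boundary. -/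
lemma faceTrace_poincare3_apex {v : E3 → E3} (hv : v ∈ w10TSub T p) (i : Fin 4) :
    (∀ k, k ≠ i → faceTrace T k (poincare3 (T.points i) (curl v)) = 0) ∧
    ∃ g ∈ poly0FSub T (p + 1) i,
      bcurl g = faceTrace T i (poincare3 (T.points i) (curl v)) := by
  obtain ⟨h1, h2⟩ := (mem_w10T T).1 hv
  have hs := contDiff_of_w1Sub h1
  have hu := curl_mem_vpolySub (w1Sub_le p h1)
  have hn : ∀ k x, lam T k x = 0 → inner ℝ (curl v x) (normal T k) = 0 := fun k x hx =>
    curl_inner_normal (hs.differentiable (by simp)) (h2 k) hx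
  have hr := poincare3_mem (T.points i) hu
  have ho : ∀ k, k ≠ i → faceTrace T k (poincare3 (T.points i) (curl v)) = 0 := fun k hk =>
    faceTrace_poincare3 (contDiff_of_vpolySub hu).continuous hk.symm (hn k)
  refine ⟨ho, exists_poly0F T hr (fun e _ => edgeTrace_eq_zero_of_other T ho e) ?_⟩
  funext y
  rw [div2_faceTrace T ((contDiff_of_w1Sub hr).differentiable (by simp)),
    curl_poincare3 _ hu (sum_partialD_curl hs), hn _ _ (lam_faceMap T i y)]; rfl

lemma lift2T_spec {v : E3 → E3} (hv : v ∈ w10TSub T p) :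
    lift2T X c (curl v) ∈ w10TSub T p ∧ curl (lift2T X c (curl v)) = curl v := by
  obtain ⟨ho, g, hg, hgr⟩ := faceTrace_poincare3_apex hv c.apex
  obtain ⟨h1, h2⟩ := (mem_w10T T).1 hv
  have hu := curl_mem_vpolySub (w1Sub_le p h1)
  have hr := poincare3_mem (T.points c.apex) hu
  have hgm := X.grad_F_mem hg
  have heq : lift2T X c (curl v) =
      poincare3 (T.points c.apex) (curl v) - gradient (X.F c.apex g) := by
    rw [← lift1F_bcurl T hg, hgr]; rfl
  rw [heq]
  constructor
  · refine (mem_w10T T).2 ⟨sub_mem hr hgm, fun k => ?_⟩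
    rw [faceTrace_sub]
    by_cases hk : k = c.apex
    · rw [hk, X.faceTrace_F_self hg, hgr, sub_self]
    · rw [X.faceTrace_F_other hk hg, ho k hk, sub_self]
  · rw [LinOn.map_sub curl_linOn (contDiff_of_w1Sub hr) (contDiff_of_w1Sub hgm),
      curl_poincare3 _ hu (sum_partialD_curl (contDiff_of_w1Sub h1)),
      curl_gradient (contDiff_of_polySub (X.F_mem hg)), sub_zero]

lemma lift2T_linOn : LinOn (curl '' (w10TSub T p : Set (E3 → E3))) (lift2T X c) := by
  have hP : LinOn (curl '' (w10TSub T p : Set (E3 → E3))) (poincare3 (T.points c.apex)) := by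
    refine (poincare3_linOn _).mono ?_
    rintro _ ⟨v, hv, rfl⟩
    exact (contDiff_of_vpolySub (curl_mem_vpolySub (w1Sub_le p hv.1))).continuous
  refine hP.sub ?_
  have h1 : LinOn (curl '' (w10TSub T p : Set (E3 → E3)))
      fun u => faceTrace T c.apex (poincare3 (T.points c.apex) u) :=
    ((faceTrace_linOn T c.apex).comp hP fun _ _ => mem_univ _)
  have h2 := (lift1F_linOn T (p := p) c.apex).comp h1 (by
    rintro _ ⟨v, hv, rfl⟩
    obtain ⟨g, hg, hgr⟩ := (faceTrace_poincare3_apex hv c.apex).2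
    exact ⟨g, hg, hgr⟩)
  exact (X.grad_F_linOn c.apex).comp h2 fun _ _ => lift1F_mem T _ _

end Lift

/-! ## The contributions to the interpolation operator -/

variable {T : Tetrahedron} {p : ℕ} (X : ExtensionOperators T p) (c : LiftingChoice) {ε : ℝ}

lemma lift1E_zero (e : Edge) : lift1E T p e 0 = 0 := by
  have h := lift1E_deriv T (p := p) (e := e) (zero_mem _)
  rwa [LinOn.map_zero deriv_linOn] at h

lemma lift1F_zero (k : Fin 4) : lift1F T p k 0 = 0 := by
  have h := lift1F_bcurl T (p := p) (k := k) (zero_mem _)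
  rwa [bcurl_zero] at h

lemma lift1T_zero : lift1T T p 0 = 0 := by
  have h := lift1T_gradient T (p := p) (zero_mem _)
  rwa [gradient_zero] at h

lemma LinOn.image_map_zero {F G H : Type*} [AddCommGroup F] [Module ℝ F] [AddCommGroup G]
    [Module ℝ G] [AddCommGroup H] [Module ℝ H] {V : Submodule ℝ F} {D : F → G} {L : G → H}
    (hD : LinOn (V : Set F) D) (hL : LinOn (D '' V) L) : L 0 = 0 := by
  have h0 : (0 : G) ∈ D '' V := ⟨0, V.zero_mem, hD.map_zero⟩
  simpa using hL 0 h0 0 h0 0 0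

lemma lift2F_zero (k : Fin 4) : lift2F X c k 0 = 0 :=
  LinOn.image_map_zero (div2_linOn.mono fun _ hg => contDiff_of_vpolySub (w10FSub_le T p k hg))
    (lift2F_linOn X c k)

lemma lift2T_zero : lift2T X c 0 = 0 :=
  LinOn.image_map_zero (V := w10TSub T p)
    (curl_linOn.mono fun _ hg => contDiff_of_w1Sub (w10TSub_le T p hg)) (lift2T_linOn X c)

lemma integral_edgeTrace_linOn (e : Edge) :
    LinOn (smoothSub E3 E3 : Set (E3 → E3)) fun u => ∫ s in edgeDom T e, edgeTrace T e u s := by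
  intro u hu v hv a b
  have h : ∀ {w : E3 → E3} (r : ℝ), w ∈ smoothSub E3 E3 →
      IntegrableOn (fun s => r * edgeTrace T e w s) (edgeDom T e) := by
    intro w r hw
    have : Continuous (edgeTrace T e w) := smoothSub_le (edgeTrace_mem_smooth T hw e)
    exact (by fun_prop : Continuous _).continuousOn.integrableOn_compact isCompact_Icc
  simp only [edgeTrace_linOn T e u (mem_univ _) v (mem_univ _), Pi.add_apply, Pi.smul_apply,
    smul_eq_mul]
  rw [integral_add (h a hu) (h b hv), integral_const_mul, integral_const_mul]

lemma fieldW0_linOn : LinOn (smoothSub E3 E3 : Set (E3 → E3)) (fieldW0 T) := by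
  refine LinOn.sum _ fun e => ?_
  intro u hu v hv a b
  have := integral_edgeTrace_linOn (T := T) e u hu v hv a b
  simp only at this
  simp only [this, smul_eq_mul, add_smul, mul_smul]

lemma fieldW0_mem (u : E3 → E3) : fieldW0 T u ∈ w1Sub p :=
  Submodule.sum_mem _ fun e _ => Submodule.smul_mem _ _ (whitney_mem_w1Sub T p e)

lemma fieldW1_linOn (h0 : 0 < ε) :
    LinOn (smoothSub E3 E3 : Set (E3 → E3)) (fieldW1 X ε) := by
  refine LinOn.sum _ fun e => ?_
  have h1 := (projectsOn_edge T (p := p) h0 e).proj_linOn.comp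
    ((edgeTrace_linOn T e).mono (subset_univ (smoothSub E3 E3 : Set (E3 → E3))))
    fun u hu => smoothSub_le (edgeTrace_mem_smooth T hu e)
  have h2 := (lift1E_linOn T (p := p) e).comp h1 fun u hu =>
    (projectsOn_edge T h0 e).proj_mem (smoothSub_le (edgeTrace_mem_smooth T hu e))
  exact (X.grad_E_linOn e).comp h2 fun _ _ => lift1E_mem T _ _

lemma fieldW1_mem (u : E3 → E3) : fieldW1 X ε u ∈ w1Sub p :=
  Submodule.sum_mem _ fun e _ => X.grad_E_mem (lift1E_mem T e _)

lemma proj_div_mem (h0 : 0 < ε) {u : E3 → E3} (hu : u ∈ smoothSub E3 E3) (k : Fin 4) :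
    proj2F T ε p k (div2 (faceTrace T k u)) ∈ div2 '' (w10FSub T p k : Set (E2 → E2)) :=
  (projectsOn_div T h0 k).proj_mem (smoothSub_le (div2_mem (faceTrace_mem_smooth T hu k)))

lemma fieldW2_linOn (h0 : 0 < ε) :
    LinOn (smoothSub E3 E3 : Set (E3 → E3)) (fieldW2 X c ε) := by
  refine LinOn.sum _ fun k => ?_
  have h1 := div2_linOn.comp
    ((faceTrace_linOn T k).mono (subset_univ (smoothSub E3 E3 : Set (E3 → E3))))
    fun u hu => faceTrace_mem_smooth T hu k
  have h2 := (projectsOn_div T (p := p) h0 k).proj_linOn.comp h1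
    fun u hu => smoothSub_le (div2_mem (faceTrace_mem_smooth T hu k))
  have h3 := (lift2F_linOn X c k).comp h2 fun u hu => proj_div_mem h0 hu k
  refine (ext1F_linOn T p k).comp h3 fun u hu => ?_
  obtain ⟨w, hw, hw'⟩ := proj_div_mem (p := p) h0 hu k
  change lift2F X c k (proj2F T ε p k (div2 (faceTrace T k u))) ∈ w10FSub T p k
  rw [← hw']
  exact (lift2F_spec X c hw).1

lemma fieldW2_mem (u : E3 → E3) : fieldW2 X c ε u ∈ w1Sub p :=
  Submodule.sum_mem _ fun k _ => ext1F_mem T p k _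

lemma fieldW3_linOn (h0 : 0 < ε) :
    LinOn (smoothSub E3 E3 : Set (E3 → E3)) (fieldW3 X ε) := by
  refine LinOn.sum _ fun k => ?_
  have h1 := (projectsOn_face T (p := p) h0 k).proj_linOn.comp
    ((faceTrace_linOn T k).mono (subset_univ (smoothSub E3 E3 : Set (E3 → E3))))
    fun u hu => smoothSub_le (faceTrace_mem_smooth T hu k)
  have h2 := (lift1F_linOn T (p := p) k).comp h1 fun u hu =>
    (projectsOn_face T h0 k).proj_mem (smoothSub_le (faceTrace_mem_smooth T hu k))
  exact (X.grad_F_linOn k).comp h2 fun _ _ => lift1F_mem T _ _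

lemma fieldW3_mem (u : E3 → E3) : fieldW3 X ε u ∈ w1Sub p :=
  Submodule.sum_mem _ fun k _ => X.grad_F_mem (lift1F_mem T k _)

lemma proj_curl_mem {u : E3 → E3} (hu : u ∈ smoothSub E3 E3) :
    proj2T T p (curl u) ∈ curl '' (w10TSub T p : Set (E3 → E3)) :=
  (projectsOn_curl T).proj_mem (smoothSub_le (curl_mem hu))

lemma fieldW4_linOn : LinOn (smoothSub E3 E3 : Set (E3 → E3)) (fieldW4 X c) := by
  have h1 := (projectsOn_curl T (p := p)).proj_linOn.comp curl_linOn
    fun u hu => smoothSub_le (curl_mem hu)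
  exact (lift2T_linOn X c).comp h1 fun u hu => proj_curl_mem hu

lemma fieldW4_mem {u : E3 → E3} (hu : u ∈ smoothSub E3 E3) : fieldW4 X c u ∈ w1Sub p := by
  obtain ⟨v, hv, h⟩ := proj_curl_mem (T := T) (p := p) hu
  rw [fieldW4, ← h]
  exact (lift2T_spec X c hv).1.1

/-- The second interior contribution. -/
def fieldW5 (T : Tetrahedron) (p : ℕ) (u : E3 → E3) : E3 → E3 :=
  gradient (lift1T T p (proj1T T p u))

lemma fieldW5_linOn : LinOn (smoothSub E3 E3 : Set (E3 → E3)) (fieldW5 T p) := by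
  have h1 := (lift1T_linOn T (p := p)).comp
    ((projectsOn_grad T (p := p)).proj_linOn.mono smoothSub_le)
    fun u hu => (projectsOn_grad T).proj_mem (smoothSub_le hu)
  exact gradient_linOn.comp h1 fun u _ =>
    contDiff_of_polySub (poly0TSub_le T _ (lift1T_mem T _))

lemma fieldW5_mem (u : E3 → E3) : fieldW5 T p u ∈ w1Sub p :=
  gradient_mem_w1Sub (poly0TSub_le T _ (lift1T_mem T _))

/-! ## The residuals -/

/-- The stages of the `let` chain in `Pi1`, as functions of the field, so that linearity, membership
and traces can be treated stage by stage. -/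
def res0 (T : Tetrahedron) (u : E3 → E3) : E3 → E3 := u - fieldW0 T u

def res1 (ε : ℝ) (u : E3 → E3) : E3 → E3 := res0 T u - fieldW1 X ε (res0 T u)

def res2 (ε : ℝ) (u : E3 → E3) : E3 → E3 := res1 X ε u - fieldW2 X c ε (res1 X ε u)

def res3 (ε : ℝ) (u : E3 → E3) : E3 → E3 := res2 X c ε u - fieldW3 X ε (res2 X c ε u)

def res4 (ε : ℝ) (u : E3 → E3) : E3 → E3 := res3 X c ε u - fieldW4 X c (res3 X c ε u)

lemma Pi1_eq (u : E3 → E3) : Pi1 X c ε u = fieldW5 T p (res4 X c ε u) + fieldW4 X c (res3 X c ε u) +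
    fieldW3 X ε (res2 X c ε u) + fieldW2 X c ε (res1 X ε u) + fieldW1 X ε (res0 T u) +
    fieldW0 T u := by
  simp only [Pi1, res4, res3, res2, res1, res0, fieldW5]

section Residuals

variable {M : Submodule ℝ (E3 → E3)} (hM : w1Sub p ≤ M) (hM' : M ≤ smoothSub E3 E3)
  {u : E3 → E3} (hu : u ∈ M)
include hM hu

/-- The space `M` is used with two values: `smoothSub` for linearity and the commuting property,
`w1Sub p` for the projection property. -/
lemma res0_mem : res0 T u ∈ M := sub_mem hu (hM (fieldW0_mem u))

lemma res1_mem : res1 X ε u ∈ M := sub_mem (res0_mem hM hu) (hM (fieldW1_mem X _))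

lemma res2_mem : res2 X c ε u ∈ M := sub_mem (res1_mem X hM hu) (hM (fieldW2_mem X c _))

lemma res3_mem : res3 X c ε u ∈ M := sub_mem (res2_mem X c hM hu) (hM (fieldW3_mem X _))

include hM' in
lemma res4_mem : res4 X c ε u ∈ M :=
  sub_mem (res3_mem X c hM hu) (hM (fieldW4_mem X c (hM' (res3_mem X c hM hu))))

end Residuals

lemma res0_linOn : LinOn (smoothSub E3 E3 : Set (E3 → E3)) (res0 T) := LinOn.id.sub fieldW0_linOn

lemma res1_linOn (h0 : 0 < ε) : LinOn (smoothSub E3 E3 : Set (E3 → E3)) (res1 X ε) :=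
  res0_linOn.sub ((fieldW1_linOn X h0).comp res0_linOn fun _ hu =>
    res0_mem (w1Sub_le_smoothSub p) hu)

lemma res2_linOn (h0 : 0 < ε) : LinOn (smoothSub E3 E3 : Set (E3 → E3)) (res2 X c ε) :=
  (res1_linOn X h0).sub ((fieldW2_linOn X c h0).comp (res1_linOn X h0) fun _ hu =>
    res1_mem X (w1Sub_le_smoothSub p) hu)

lemma res3_linOn (h0 : 0 < ε) : LinOn (smoothSub E3 E3 : Set (E3 → E3)) (res3 X c ε) :=
  (res2_linOn X c h0).sub ((fieldW3_linOn X h0).comp (res2_linOn X c h0) fun _ hu =>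
    res2_mem X c (w1Sub_le_smoothSub p) hu)

lemma res4_linOn (h0 : 0 < ε) : LinOn (smoothSub E3 E3 : Set (E3 → E3)) (res4 X c ε) :=
  (res3_linOn X c h0).sub ((fieldW4_linOn X c).comp (res3_linOn X c h0) fun _ hu =>
    res3_mem X c (w1Sub_le_smoothSub p) hu)

lemma Pi1_linOn (h0 : 0 < ε) : LinOn (smoothSub E3 E3 : Set (E3 → E3)) (Pi1 X c ε) := by
  have hM := w1Sub_le_smoothSub p
  have h := ((((((fieldW5_linOn (T := T) (p := p)).comp (res4_linOn X c h0)
    fun _ hu => res4_mem X c hM le_rfl hu).add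
    ((fieldW4_linOn X c).comp (res3_linOn X c h0) fun _ hu => res3_mem X c hM hu)).add
    ((fieldW3_linOn X h0).comp (res2_linOn X c h0) fun _ hu => res2_mem X c hM hu)).add
    ((fieldW2_linOn X c h0).comp (res1_linOn X h0) fun _ hu => res1_mem X hM hu)).add
    ((fieldW1_linOn X h0).comp res0_linOn fun _ hu => res0_mem (T := T) hM hu)).add
    (fieldW0_linOn (T := T))
  simpa only [← Pi1_eq] using h

lemma Pi1_mem {u : E3 → E3} (hu : u ∈ smoothSub E3 E3) : Pi1 X c ε u ∈ w1Sub p := by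
  rw [Pi1_eq]
  exact add_mem (add_mem (add_mem (add_mem (add_mem (fieldW5_mem _)
    (fieldW4_mem X c (res3_mem X c (w1Sub_le_smoothSub p) hu))) (fieldW3_mem X _))
    (fieldW2_mem X c _)) (fieldW1_mem X _)) (fieldW0_mem _)

/-! ## Dependence on the values on the tetrahedron -/

lemma convex_faceDom (T : Tetrahedron) (k : Fin 4) : Convex ℝ (faceDom T k) := by
  intro x hx y hy a b ha hb hab
  rw [mem_faceDom] at *
  intro i
  have h1 := hx i
  have h2 := hy i
  rw [lam_faceMap_eq] at *
  rw [inner_add_right, inner_smul_right, inner_smul_right]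
  have h3 := add_nonneg (mul_nonneg ha h1) (mul_nonneg hb h2)
  have h4 : lam T i (faceOrg T k) = (a + b) * lam T i (faceOrg T k) := by rw [hab, one_mul]
  linarith

lemma subset_closure_interior {V : Type*} [NormedAddCommGroup V] [NormedSpace ℝ V] {D U : Set V}
    (hD : Convex ℝ D) (hU : U.Nonempty) (h : U ⊆ interior D) : D ⊆ closure (interior D) := by
  rw [hD.closure_interior_eq_closure_of_nonempty_interior (hU.mono h)]
  exact subset_closure

/-- Derivatives of a function that vanishes on a convex set with interior points vanish there. -/
lemma eqOn_zero_of_interior {V F : Type*} [NormedAddCommGroup V] [NormedSpace ℝ V]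
    [NormedAddCommGroup F] {D U : Set V} (hD : Convex ℝ D) (hU : U.Nonempty) (h : U ⊆ interior D)
    {f : V → F} (hf : Continuous f) (h0 : ∀ x ∈ interior D, f x = 0) : ∀ x ∈ D, f x = 0 := by
  have hc : IsClosed {x | f x = 0} := isClosed_eq hf continuous_const
  intro x hx
  exact closure_minimal (fun y hy => h0 y hy) hc (subset_closure_interior hD hU h hx)

lemma partialD_eq_zero_of_interior {n : ℕ} {F : Type*} [NormedAddCommGroup F] [NormedSpace ℝ F]
    {D : Set (EN n)} {f : EN n → F} (h : ∀ x ∈ D, f x = 0) {x : EN n} (hx : x ∈ interior D)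
    (i : Fin n) : partialD i f x = 0 := by
  have : f =ᶠ[nhds x] fun _ => 0 := by
    filter_upwards [mem_interior_iff_mem_nhds.1 hx] with y hy using h y hy
  rw [partialD, this.fderiv_eq]; simp

lemma ae_eq_zero_of_forall {V F : Type*} [MeasureSpace V] [Zero F] {D : Set V}
    (hD : MeasurableSet D) {f : V → F} (hf : ∀ x ∈ D, f x = 0) :
    f =ᵐ[(volume : Measure V).restrict D] 0 := by
  filter_upwards [ae_restrict_mem hD] with x hx using hf x hx

section Vanishing

variable {u : E3 → E3} (hu : u ∈ smoothSub E3 E3) (h : ∀ x ∈ cell T, u x = 0)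
include h

lemma edgeTrace_eq_zero_on (e : Edge) : ∀ s ∈ edgeDom T e, edgeTrace T e u s = 0 := by
  intro s hs
  rw [edgeTrace, h, inner_zero_left]
  refine segment_subset_convexHull (mem_range_self _) (mem_range_self _) (edgeMap_mem_edge T hs)

lemma faceTrace_eq_zero_on (k : Fin 4) : ∀ y ∈ faceDom T k, faceTrace T k u y = 0 := by
  intro y hy
  rw [faceTrace_eq, h _ ((mem_cell T).2 ((mem_faceDom T).1 hy)), inner_zero_left, inner_zero_left]
  ext i; fin_cases i <;> simp

lemma fieldW0_eq_zero : fieldW0 T u = 0 := by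
  refine Finset.sum_eq_zero fun e _ => ?_
  rw [setIntegral_eq_zero_of_forall_eq_zero (edgeTrace_eq_zero_on h e), zero_smul]

include hu

lemma fieldW1_eq_zero (h0 : 0 < ε) : fieldW1 X ε u = 0 := by
  refine Finset.sum_eq_zero fun e _ => ?_
  have h1 : proj1E T ε p e (edgeTrace T e u) = 0 :=
    (projectsOn_edge T h0 e).proj_eq_zero (smoothSub_le (edgeTrace_mem_smooth T hu e)) fun s =>
      negInner_eq_zero_of_ae _ _ (ae_eq_zero_of_forall isCompact_Icc.measurableSet
        (edgeTrace_eq_zero_on h e))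
  rw [h1, lift1E_zero, map_zero, gradient_zero]

/-- The trace vanishes on the triangle, so its divergence vanishes in the interior; continuity and
convexity carry this to the whole triangle, including boundary points where derivatives look
outside. -/
lemma fieldW2_eq_zero (h0 : 0 < ε) : fieldW2 X c ε u = 0 := by
  refine Finset.sum_eq_zero fun k _ => ?_
  have hm := div2_mem (faceTrace_mem_smooth T hu k)
  have h1 : proj2F T ε p k (div2 (faceTrace T k u)) = 0 :=
    (projectsOn_div T h0 k).proj_eq_zero (smoothSub_le hm) fun s =>
      negInner_eq_zero_of_ae _ _ (ae_eq_zero_of_forall (isCompact_faceDom T k).measurableSet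
        (eqOn_zero_of_interior (convex_faceDom T k) (openFace_nonempty T k) (openFace_subset T k)
          (smoothSub_le hm) fun y hy => by
            simp [div2, partialD_eq_zero_of_interior (faceTrace_eq_zero_on h k) hy]))
  rw [h1, lift2F_zero, LinOn.map_zero (ext1F_linOn T p k)]

lemma fieldW3_eq_zero (h0 : 0 < ε) : fieldW3 X ε u = 0 := by
  refine Finset.sum_eq_zero fun k _ => ?_
  have h1 : proj1F T ε p k (faceTrace T k u) = 0 :=
    (projectsOn_face T h0 k).proj_eq_zero (smoothSub_le (faceTrace_mem_smooth T hu k)) fun s =>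
      Finset.sum_eq_zero fun i _ => negInner_eq_zero_of_ae _ _
        (ae_eq_zero_of_forall (isCompact_faceDom T k).measurableSet fun y hy => by
          rw [faceTrace_eq_zero_on h k y hy]; rfl)
  rw [h1, lift1F_zero, map_zero, gradient_zero]

lemma fieldW4_eq_zero : fieldW4 X c u = 0 := by
  have hm := curl_mem hu
  have hz : ∀ x ∈ cell T, curl u x = 0 :=
    eqOn_zero_of_interior (convex_convexHull ℝ _) (openCell_nonempty T) (openCell_subset T)
      (smoothSub_le hm) fun x hx => by
        ext i
        fin_cases i <;> simp [curl, partialD_eq_zero_of_interior h hx]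
  have h1 : proj2T T p (curl u) = 0 :=
    (projectsOn_curl T).proj_eq_zero (smoothSub_le hm) fun s =>
      setIntegral_eq_zero_of_forall_eq_zero fun x hx => by rw [hz x hx, inner_zero_left]
  rw [fieldW4, h1, lift2T_zero]

lemma fieldW5_eq_zero : fieldW5 T p u = 0 := by
  have h1 : proj1T T p u = 0 :=
    (projectsOn_grad T).proj_eq_zero (smoothSub_le hu) fun s =>
      setIntegral_eq_zero_of_forall_eq_zero fun x hx => by rw [h x hx, inner_zero_left]
  rw [fieldW5, h1, lift1T_zero, gradient_zero]

lemma Pi1_eq_zero (h0 : 0 < ε) : Pi1 X c ε u = 0 := by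
  have r0 : res0 T u = u := by rw [res0, fieldW0_eq_zero h, sub_zero]
  have r1 : res1 X ε u = u := by rw [res1, r0, fieldW1_eq_zero X hu h h0, sub_zero]
  have r2 : res2 X c ε u = u := by rw [res2, r1, fieldW2_eq_zero X c hu h h0, sub_zero]
  have r3 : res3 X c ε u = u := by rw [res3, r2, fieldW3_eq_zero X hu h h0, sub_zero]
  have r4 : res4 X c ε u = u := by rw [res4, r3, fieldW4_eq_zero X c hu h, sub_zero]
  rw [Pi1_eq, r0, r1, r2, r3, r4, fieldW0_eq_zero h, fieldW1_eq_zero X hu h h0,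
    fieldW2_eq_zero X c hu h h0, fieldW3_eq_zero X hu h h0, fieldW4_eq_zero X c hu h,
    fieldW5_eq_zero hu h]
  simp

end Vanishing

lemma Pi1_congr (h0 : 0 < ε) {u v : E3 → E3} (hu : u ∈ smoothSub E3 E3) (hv : v ∈ smoothSub E3 E3)
    (h : EqOn u v (cell T)) : Pi1 X c ε u = Pi1 X c ε v := by
  rw [← sub_eq_zero, ← LinOn.map_sub (Pi1_linOn X c h0) hu hv]
  exact Pi1_eq_zero X c (sub_mem hu hv) (fun x hx => by simp [h hx]) h0

/-! ## The projection property -/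

lemma sum_edge {M : Type*} [AddCommMonoid M] (f : Fin 4 → Fin 4 → M) :
    ∑ e : Edge, f e.1.1 e.1.2 = f 0 1 + (f 0 2 + (f 0 3 + (f 1 2 + (f 1 3 + f 2 3)))) := by
  have : (Finset.univ : Finset Edge) = {⟨(0, 1), by decide⟩, ⟨(0, 2), by decide⟩,
    ⟨(0, 3), by decide⟩, ⟨(1, 2), by decide⟩, ⟨(1, 3), by decide⟩, ⟨(2, 3), by decide⟩} := by
    decide
  rw [this, Finset.sum_insert (by decide), Finset.sum_insert (by decide),
    Finset.sum_insert (by decide), Finset.sum_insert (by decide), Finset.sum_insert (by decide),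
    Finset.sum_singleton]

lemma lam_edgeMap_eq (i : Fin 4) (e : Edge) (s : ℝ) : lam T i (edgeMap T e s) =
    (if i = e.1.1 then 1 else 0) + s * inner ℝ (glam T i) (edgeTan T e) := by
  have h := lam_sub T i (edgeMap T e s) (T.points e.1.1)
  rw [lam_vertex, edgeMap, add_sub_cancel_left, inner_smul_right] at h
  rw [edgeMap]; linarith

/-- On its own edge the two coordinates sum to 1 and have tangential derivatives `± 1 / |e|`. On
another edge, one of the two coordinates vanishes identically together with its tangential
derivative, which kills both terms. -/
lemma edgeTrace_whitney (e e' : Edge) :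
    edgeTrace T e (whitney T e') = fun _ => if e = e' then (edgeLen T e)⁻¹ else 0 := by
  funext s
  have ht : ∀ i, inner ℝ (glam T i) (edgeTan T e) =
      (edgeLen T e)⁻¹ * ((if i = e.1.2 then 1 else 0) - if i = e.1.1 then 1 else 0) := by
    intro i
    rw [edgeTan, inner_smul_right, inner_glam_vertices]
  rw [edgeTrace, whitney_eq]
  simp only [inner_sub_left, inner_smul_left, RCLike.conj_to_real, lam_edgeMap_eq, ht]
  obtain ⟨⟨i, j⟩, hij⟩ := e
  obtain ⟨⟨a, b⟩, hab⟩ := e'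
  simp only [Subtype.mk.injEq, Prod.mk.injEq] at hij hab ⊢
  by_cases h1 : a = i
  · subst h1
    have h2 : a ≠ j := hij.ne
    have h3 : b ≠ a := hab.ne'
    by_cases h4 : b = j
    · subst h4; simp [h2, h3]; ring
    · simp [h2, h3, h4, Ne.symm h4]
  · by_cases h5 : b = i
    · subst h5
      have h6 : a ≠ j := (hab.trans hij).ne
      have h7 : b ≠ j := hij.ne
      simp [h1, h6, h7, Ne.symm h1]
    · simp [h1, h5, Ne.symm h1]
      split_ifs <;> ring

lemma setIntegral_edgeDom (e : Edge) (f : ℝ → ℝ) :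
    ∫ s in edgeDom T e, f s = ∫ s in (0 : ℝ)..edgeLen T e, f s := by
  rw [edgeDom, integral_Icc_eq_integral_Ioc, intervalIntegral.integral_of_le (edgeLen_pos T e).le]

lemma integral_edgeTrace_res0 {u : E3 → E3} (hu : u ∈ smoothSub E3 E3) (e : Edge) :
    ∫ s in edgeDom T e, edgeTrace T e (res0 T u) s = 0 := by
  have h1 := LinOn.map_sub (integral_edgeTrace_linOn (T := T) e) hu
    (w1Sub_le_smoothSub 0 (fieldW0_mem (T := T) u))
  have h2 : edgeTrace T e (fieldW0 T u) =
      fun _ => (∫ s in edgeDom T e, edgeTrace T e u s) * (edgeLen T e)⁻¹ := by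
    rw [fieldW0, edgeTrace_sum]
    funext s
    have h3 : ∀ (e' : Edge) (a : ℝ), edgeTrace T e (a • whitney T e') s =
        if e = e' then a * (edgeLen T e)⁻¹ else 0 := by
      intro e' a
      have h4 := edgeTrace_linOn T e (whitney T e') (mem_univ _) 0 (mem_univ _) a 0
      rw [smul_zero, add_zero, zero_smul, add_zero] at h4
      rw [h4, edgeTrace_whitney]
      simp
    rw [Finset.sum_apply]
    simp only [h3]
    simp
  have h3 : ∀ r : ℝ, ∫ _ in edgeDom T e, r * (edgeLen T e)⁻¹ = r := by
    intro r
    have := (edgeLen_pos T e).ne'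
    rw [setIntegral_edgeDom, intervalIntegral.integral_const]
    simp; field_simp
  rw [res0, h1, h2, h3, sub_self]

/-- The mean of the trace is zero, so a primitive has equal values at both ends; subtracting that
value makes both vanish. -/
lemma exists_edgeTrace_res0 {u : E3 → E3} (hu : u ∈ w1Sub p) (e : Edge) :
    ∃ g ∈ poly0ESub T (p + 1) e, deriv g = edgeTrace T e (res0 T u) := by
  obtain ⟨g, hg, h⟩ := exists_primitive (edgeTrace_mem T (res0_mem le_rfl hu) e)
  have hd := contDiff_of_poly1Sub hg
  have h0 := integral_edgeTrace_res0 (T := T) (contDiff_of_w1Sub hu) e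
  rw [setIntegral_edgeDom, ← h, intervalIntegral.integral_deriv_eq_sub
    (fun s _ => hd.differentiable (by simp) s)
    ((hd.continuous_deriv (by simp)).intervalIntegrable _ _), sub_eq_zero] at h0
  refine ⟨g - fun _ => g 0, ⟨sub_mem hg (const_mem_poly1Sub _ _), ?_, ?_⟩, ?_⟩
  · simp
  · simp [h0]
  · rw [← h]; funext s; exact deriv_sub_const _

lemma edgeTrace_res1 (h0 : 0 < ε) {u : E3 → E3} (hu : u ∈ w1Sub p) (e : Edge) :
    edgeTrace T e (res1 X ε u) = 0 := by
  choose g hg h using exists_edgeTrace_res0 (T := T) hu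
  have h1 : fieldW1 X ε (res0 T u) = ∑ e, gradient (X.E e (g e)) := by
    refine Finset.sum_congr rfl fun e _ => ?_
    have : proj1E T ε p e (deriv (g e)) = deriv (g e) := (projectsOn_edge T h0 e).proj_self (hg e)
    rw [← h, this, lift1E_deriv T (hg e)]
  rw [res1, edgeTrace_sub, h1, edgeTrace_sum, Finset.sum_eq_single e, X.edgeTrace_E_self (hg e), h,
    sub_self]
  · intro e' _ he
    exact X.edgeTrace_E_other he.symm (hg e')
  · simp

lemma faceTrace_sum_eq {v : Fin 4 → E3 → E3} (hv : ∀ k j, j ≠ k → faceTrace T j (v k) = 0)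
    (k : Fin 4) : faceTrace T k (∑ j, v j) = faceTrace T k (v k) := by
  rw [faceTrace_sum, Finset.sum_eq_single k]
  · intro j _ hj
    exact hv j k hj.symm
  · simp

/-- An extension from one face has no trace on the other faces, hence no trace on any edge. On face
`k` only its own term acts, and it has the divergence to be removed. -/
lemma res2_spec (h0 : 0 < ε) {u : E3 → E3} (hu : u ∈ w1Sub p) :
    (∀ e, edgeTrace T e (res2 X c ε u) = 0) ∧ ∀ k, div2 (faceTrace T k (res2 X c ε u)) = 0 := by
  have hr := res1_mem (ε := ε) X le_rfl hu
  have hw : ∀ k, faceTrace T k (res1 X ε u) ∈ w10FSub T p k := fun k =>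
    (mem_w10F T).2 ⟨_, hr, rfl, fun e _ => edgeTrace_res1 X h0 hu e⟩
  have hl := fun k => lift2F_spec X c (hw k)
  set w := fun k => lift2F X c k (div2 (faceTrace T k (res1 X ε u))) with hwdef
  have he := fun k => ext1F_spec T (hl k).1
  have hy := fun k => ((mem_y1F T).1 (he k).1)
  have h1 : fieldW2 X c ε (res1 X ε u) = ∑ k, ext1F T p k (w k) := by
    refine Finset.sum_congr rfl fun k _ => ?_
    have : proj2F T ε p k (div2 (faceTrace T k (res1 X ε u))) = div2 (faceTrace T k (res1 X ε u)) :=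
      (projectsOn_div T h0 k).proj_self (hw k)
    rw [this]
  constructor
  · intro e
    rw [res2, edgeTrace_sub, edgeTrace_res1 X h0 hu, h1, edgeTrace_sum, Finset.sum_eq_zero, sub_zero]
    intro k _
    exact edgeTrace_eq_zero_of_other T (hy k).2.1 e
  · intro k
    rw [res2, faceTrace_sub, h1, faceTrace_sum_eq (fun k j hj => (hy k).2.1 j hj), (he k).2,
      LinOn.map_sub div2_linOn (contDiff_of_vpolySub (w10FSub_le T p k (hw k)))
      (contDiff_of_vpolySub (w10FSub_le T p k (hl k).1)), (hl k).2, sub_self]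

lemma res3_mem_w10T (h0 : 0 < ε) {u : E3 → E3} (hu : u ∈ w1Sub p) :
    res3 X c ε u ∈ w10TSub T p := by
  obtain ⟨he, hd⟩ := res2_spec X c h0 hu
  choose g hg h using fun k => exists_poly0F T (res2_mem (ε := ε) X c le_rfl hu) (k := k)
    (fun e _ => he e) (hd k)
  have h1 : fieldW3 X ε (res2 X c ε u) = ∑ k, gradient (X.F k (g k)) := by
    refine Finset.sum_congr rfl fun k _ => ?_
    have : proj1F T ε p k (bcurl (g k)) = bcurl (g k) := (projectsOn_face T h0 k).proj_self (hg k)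
    rw [← h, this, lift1F_bcurl T (hg k)]
  refine (mem_w10T T).2 ⟨res3_mem X c le_rfl hu, fun k => ?_⟩
  rw [res3, faceTrace_sub, h1, faceTrace_sum_eq (fun k j hj => X.faceTrace_F_other hj (hg k)),
    X.faceTrace_F_self (hg k), h, sub_self]

/-- The last residual lies in `W10T` and is curl-free, so it is reproduced as a gradient; the sum of
all contributions then telescopes. -/
lemma Pi1_self (h0 : 0 < ε) {u : E3 → E3} (hu : u ∈ w1Sub p) : Pi1 X c ε u = u := by
  have h3 := res3_mem_w10T X c h0 hu
  obtain ⟨h4, hc⟩ := lift2T_spec X c h3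
  have hW : fieldW4 X c (res3 X c ε u) = lift2T X c (curl (res3 X c ε u)) := by
    have : proj2T T p (curl (res3 X c ε u)) = curl (res3 X c ε u) :=
      (projectsOn_curl T).proj_self h3
    rw [fieldW4, this]
  have hr : res4 X c ε u ∈ w10TSub T p := by rw [res4, hW]; exact sub_mem h3 h4
  obtain ⟨g, hg, hgr⟩ := exists_poly0T T hr (by
    rw [res4, hW, LinOn.map_sub curl_linOn (contDiff_of_w1Sub (w10TSub_le T p h3))
      (contDiff_of_w1Sub (w10TSub_le T p h4)), hc, sub_self])
  have h5 : fieldW5 T p (res4 X c ε u) = res4 X c ε u := by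
    have : proj1T T p (gradient g) = gradient g := (projectsOn_grad T).proj_self hg
    rw [fieldW5, ← hgr, this, lift1T_gradient T hg]
  rw [Pi1_eq, h5, res4, res3, res2, res1, res0]
  abel

/-! ## The commuting diagram property -/

section Commuting

variable {u : E3 → ℝ} (hu : u ∈ smoothSub E3 ℝ)

lemma lam_mem_smooth (i : Fin 4) : lam T i ∈ smoothSub E3 ℝ :=
  contDiff_of_polySub (lam_mem_polySub T le_rfl i)

lemma scalarW0_mem (u : E3 → ℝ) : scalarW0 T u ∈ smoothSub E3 ℝ :=
  Submodule.sum_mem _ fun i _ => Submodule.smul_mem _ _ (lam_mem_smooth i)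

lemma scalarW1_mem (u : E3 → ℝ) : scalarW1 X ε u ∈ smoothSub E3 ℝ :=
  Submodule.sum_mem _ fun e _ => contDiff_of_polySub (X.E_mem (lift1E_mem T e _))

lemma scalarW2_mem (u : E3 → ℝ) : scalarW2 X ε u ∈ smoothSub E3 ℝ :=
  Submodule.sum_mem _ fun k _ => contDiff_of_polySub (X.F_mem (lift1F_mem T k _))

include hu

/-- Edge integrals of a gradient are differences of vertex values. Collecting `(u_j - u_i) (λ_i ∇λ_j
- λ_j ∇λ_i)` by vertex values gives `∑ u_j ∇λ_j`, because the coordinates sum to 1 and their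
gradients to 0. -/
lemma fieldW0_gradient : fieldW0 T (gradient u) = gradient (scalarW0 T u) := by
  have h1 : ∀ e, ∫ s in edgeDom T e, edgeTrace T e (gradient u) s =
      u (T.points e.1.2) - u (T.points e.1.1) := by
    intro e
    have hs : ContDiff ℝ ∞ fun s => u (edgeMap T e s) :=
      (mem_smoothSub.1 hu).comp (contDiff_edgeMap T e)
    rw [setIntegral_edgeDom, ← deriv_comp_edgeMap T (smoothSub.differentiable hu) e,
      intervalIntegral.integral_deriv_eq_sub (fun s _ => hs.differentiable (by simp) s)
      ((hs.continuous_deriv (by simp)).intervalIntegrable _ _), edgeMap_zero, edgeMap_len]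
  have h2 : gradient (scalarW0 T u) = ∑ i, u (T.points i) • fun _ => glam T i := by
    rw [scalarW0, gradient_sum _ fun i => (smoothSub.differentiable (lam_mem_smooth i)).const_smul _]
    refine Finset.sum_congr rfl fun i _ => ?_
    rw [gradient_smul]
    congr 1
    funext x
    exact gradient_lam T i x
  rw [h2, fieldW0, Fin.sum_univ_four]
  simp only [h1, whitney_eq]
  rw [sum_edge fun i j => (u (T.points j) - u (T.points i)) •
    fun x => lam T i x • glam T j - lam T j x • glam T i]
  funext x
  have hg := sum_glam T
  have hl := sum_lam T x
  rw [Fin.sum_univ_four] at hg hl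
  -- Eliminating the last coordinate and its gradient removes the two linear relations, after which
  -- the identity is purely algebraic.
  have hg3 : glam T 3 = -(glam T 0 + glam T 1 + glam T 2) :=
    eq_neg_of_add_eq_zero_right hg
  have hl3 : lam T 3 x = 1 - lam T 0 x - lam T 1 x - lam T 2 x := by linarith
  simp only [Pi.add_apply, Pi.smul_apply, hg3]
  simp only [hl3]
  module

lemma fieldW1_gradient : fieldW1 X ε (gradient u) = gradient (scalarW1 X ε u) := by
  rw [scalarW1, gradient_sum _ fun e => smoothSub.differentiable
    (contDiff_of_polySub (X.E_mem (lift1E_mem T e _)))]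
  simp only [deriv_comp_edgeMap T (smoothSub.differentiable hu)]
  rfl

lemma fieldW2_gradient (h0 : 0 < ε) : fieldW2 X c ε (gradient u) = 0 := by
  refine Finset.sum_eq_zero fun k _ => ?_
  have h1 : proj2F T ε p k 0 = 0 := LinOn.map_zero (projectsOn_div T h0 k).proj_linOn
  rw [div2_faceTrace_gradient T hu, h1, lift2F_zero, LinOn.map_zero (ext1F_linOn T p k)]

lemma fieldW3_gradient : fieldW3 X ε (gradient u) = gradient (scalarW2 X ε u) := by
  rw [scalarW2, gradient_sum _ fun k => smoothSub.differentiable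
    (contDiff_of_polySub (X.F_mem (lift1F_mem T k _)))]
  simp only [← faceTrace_gradient T (smoothSub.differentiable hu)]
  rfl

lemma fieldW4_gradient : fieldW4 X c (gradient u) = 0 := by
  have h1 : proj2T T p 0 = 0 := LinOn.map_zero (projectsOn_curl T).proj_linOn
  rw [fieldW4, curl_gradient hu, h1, lift2T_zero]

/-- Residuals of the gradient are gradients of scalar residuals at each stage. The divergence and
curl stages are idle, so `res2` repeats `res1` and `res4` repeats `res3`. -/
lemma Pi1_gradient (h0 : 0 < ε) : Pi1 X c ε (gradient u) = gradient (Pi0 X ε u) := by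
  have d : ∀ {f : E3 → ℝ}, f ∈ smoothSub E3 ℝ → Differentiable ℝ f := smoothSub.differentiable
  set w0 := scalarW0 T u with hw0
  have m0 : w0 ∈ smoothSub E3 ℝ := scalarW0_mem u
  set u0 := u - w0 with hu0
  have n0 : u0 ∈ smoothSub E3 ℝ := sub_mem hu m0
  set w1 := scalarW1 X ε u0 with hw1
  have m1 : w1 ∈ smoothSub E3 ℝ := scalarW1_mem X u0
  set u1 := u0 - w1 with hu1
  have n1 : u1 ∈ smoothSub E3 ℝ := sub_mem n0 m1
  set w2 := scalarW2 X ε u1 with hw2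
  have m2 : w2 ∈ smoothSub E3 ℝ := scalarW2_mem X u1
  set u2 := u1 - w2 with hu2
  have r0 : res0 T (gradient u) = gradient u0 := by
    rw [res0, fieldW0_gradient hu, hu0, gradient_sub (d hu) (d m0)]
  have r1 : res1 X ε (gradient u) = gradient u1 := by
    rw [res1, r0, fieldW1_gradient X n0, hu1, gradient_sub (d n0) (d m1)]
  have r2 : res2 X c ε (gradient u) = gradient u1 := by
    rw [res2, r1, fieldW2_gradient X c n1 h0, sub_zero]
  have n2 : u2 ∈ smoothSub E3 ℝ := sub_mem n1 m2
  have r3 : res3 X c ε (gradient u) = gradient u2 := by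
    rw [res3, r2, fieldW3_gradient X n1, hu2, gradient_sub (d n1) (d m2)]
  have r4 : res4 X c ε (gradient u) = gradient u2 := by
    rw [res4, r3, fieldW4_gradient X c n2, sub_zero]
  have hP : Pi0 X ε u = lift1T T p (proj1T T p (gradient u2)) + w2 + w1 + w0 := rfl
  have m3 : Differentiable ℝ (lift1T T p (proj1T T p (gradient u2))) :=
    (contDiff_of_polySub (poly0TSub_le T _ (lift1T_mem T _))).differentiable (by simp)
  rw [Pi1_eq, r0, r1, r2, r3, r4, fieldW0_gradient hu, fieldW1_gradient X n0,
    fieldW2_gradient X c n1 h0, fieldW3_gradient X n1, fieldW4_gradient X c n2, hP,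
    gradient_add ((m3.add (d m2)).add (d m1)) (d m0), gradient_add (m3.add (d m2)) (d m1),
    gradient_add m3 (d m2), add_zero, add_zero]
  rfl

end Commuting

end EdgeElement

end

/-- Smooth fields on the closed tetrahedron are represented by extensions to the whole space; the
first clause expresses that the choice of extension is immaterial. The commuting identity is
obtained on the whole space and then restricted. -/
theorem lemma4p2 (T : EdgeElement.Tetrahedron) (p : ℕ) (ε : ℝ) (hε₀ : 0 < ε) (hε₁ : ε < 1 / 2)
    (X : EdgeElement.ExtensionOperators T p) (c : EdgeElement.LiftingChoice) :
    (∀ u v : E3 → E3, ContDiff ℝ ∞ u → ContDiff ℝ ∞ v → Set.EqOn u v (cell T) →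
      Pi1 X c ε u = Pi1 X c ε v) ∧
    (∀ u v : E3 → E3, ContDiff ℝ ∞ u → ContDiff ℝ ∞ v → ∀ a b : ℝ,
      Pi1 X c ε (a • u + b • v) = a • Pi1 X c ε u + b • Pi1 X c ε v) ∧
    (∀ u : E3 → E3, ContDiff ℝ ∞ u → Pi1 X c ε u ∈ W1 p) ∧
    (∀ u ∈ W1 p, Pi1 X c ε u = u) ∧
    (∀ u : E3 → ℝ, ContDiff ℝ ∞ u →
      Set.EqOn (Pi1 X c ε (gradient u)) (gradient (Pi0 X ε u)) (cell T)) :=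
  ⟨fun _ _ hu hv h => Pi1_congr X c hε₀ hu hv h,
    fun u v hu hv a b => Pi1_linOn X c hε₀ u hu v hv a b,
    fun _ hu => Pi1_mem X c hu, fun _ hu => Pi1_self X c hε₀ hu,
    fun _ hu _ _ => congrFun (Pi1_gradient X c hu hε₀) _⟩
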